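/- **Setting.** $G_n$ is the $n\times n$ torus grid; its edges carry Boolean variables. Let $T,m$ be odd, $n=Tm$, $\Delta=\lfloor\sqrt T/2\rfloor\ge 1$. Divide $G_n$ into $m\times m$ subgrids of size $T\times T$. In each subgrid, $\Delta$ vertices at distance $3\Delta$ from each other in each direction along the diagonal of the central square of side $\lfloor 3T/4\rfloor$ are its *centers*, numbered $1,\dots,\Delta$. Any two centers of adjacent subgrids are joined by a fixed path: for the $j$-th center of the lower and the $i$-th center of the upper subgrid, go left $i$ steps from the lower one and then up to a row (between the two central squares) reserved for the pair $(i,j)$; go right $j$ steps from the upper one and then down to the same row; join the two pieces in that row. Horizontal neighbours are treated in the same way, turned by a quarter. **The distribution $\mathcal R^{\rm grid}_\Delta$.** Choose one center of each subgrid uniformly and independently; then choose uniformly a solution $a$ (the suggested assignment) of the Tseitin system on $G_n$ with charge $0$ at the chosen centers and $1$ at all other vertices. The restriction $\rho$ sends $x_e$ to $a(e)$ if $e$ is on no path between chosen centers of adjacent subgrids, and to $x_P+a(e)$ (mod 2) if $e$ is on such a path $P$. The variables $x_P$ are indexed by the edges of $G_m$. For a DNF $F$ over the edges of $G_n$, $F\restriction\rho$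 is the resulting DNF over the edges of $G_m$: false terms are deleted, true literals are dropped, and it is $1$ if some term becomes true. **Trees.** For a partial assignment $\beta$ to edges of $G_m$ whose support is independent (removing it leaves $G_m$ connected), the *closure* of $\beta$ also gives each bridge $e$ of $G_m-\mathrm{supp}\,\beta$ its forced value: of the two components that $e$ separates, the larger one gets odd total charge (charges induced from the all-ones charge) and the smaller one even. Restricting a decision tree by $\beta$ means following, at each query, the value known from the closure of $\beta$ together with the answers so far, and querying only if there is no such value. The canonical decision tree of a DNF $F$ under $\beta$ first restricts $F$ by the closure of $\beta$, then processes the terms in order, starting from a $0$-leaf: at each $0$-leaf reached so far, attach the restricted tree that queries the next term's variables until the term is decided, if it has a $1$-leaf, and skip the term otherwise. For an ordered collection $F_1,\dots,F_s$, $\mathrm{CCDT}_\ell$ is the tree built as follows, starting from the empty restriction. If the collection is empty, stop. If the canonical decision tree of the first formula under the current restriction has depth $\le\ell$, drop that formula. Otherwise take the leftmost path of length $\ell+1$ in it, query all its variables exhaustively, and recurse at each leaf with the restriction extended by the answers. **Theorem.** There are absolute constants $C,c>0$ such that for all such $T,m,n,\Delta$, all integers $k,s,t\ge 0$ and $\ell\ge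 1$ with $k+t\le m/8$, and all $k$-DNFs $F_1,\dots,F_s$ over the edge variables of $G_n$, $$\Pr_{\rho\sim\mathcal R^{\rm grid}_\Delta}\bigl[\mathrm{depth}(\mathrm{CCDT}_\ell(F_1\restriction\rho,\dots,F_s\restriction\rho))\ge t\bigr]\;\le\; s^{\lceil t/\ell\rceil}\Bigl(\frac{2^{Ck}}{\Delta}\Bigr)^{ct}.$$ -/

import Mathlib

namespace GridSwitching

/-! ### The toroidal grid -/

/-- Vertices of the `n × n` torus, as pairs (horizontal coordinate, vertical coordinate). -/
abbrev Vertex (n : ℕ) : Type := ZMod n × ZMod n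

/-- Edges of the `n × n` torus. `(v, false)` is the edge from `v` to its right neighbour,
`(v, true)` the edge from `v` to its upper neighbour. -/
abbrev Edge (n : ℕ) : Type := Vertex n × Bool

/-- The other endpoint of the edge `e`. -/
def Edge.target {n : ℕ} (e : Edge n) : Vertex n :=
  if e.2 then (e.1.1, e.1.2 + 1) else (e.1.1 + 1, e.1.2)

/-- The unordered pair of endpoints of an edge. -/
def Edge.ends {n : ℕ} (e : Edge n) : Sym2 (Vertex n) := s(e.1, e.target)

/-- The graph `G_n - S`: the torus with the edges in `S` removed. -/
def gridMinus {n : ℕ} (S : Set (Edge n)) : SimpleGraph (Vertex n) :=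
  SimpleGraph.fromEdgeSet (Edge.ends '' Sᶜ)

/-! ### Restrictions and charges -/

/-- Partial assignments to the edge variables; `none` is the value `*`. -/
abbrev Restriction (n : ℕ) : Type := Edge n → Option (ZMod 2)

/-- The support of a restriction. -/
def Restriction.supp {n : ℕ} (β : Restriction n) : Set (Edge n) := {e | β e ≠ none}

open Classical in
/-- The restriction `β ∘ (e → b)`. -/
noncomputable def Restriction.set {n : ℕ} (β : Restriction n) (e : Edge n) (b : ZMod 2) :
    Restriction n :=
  Function.update β e (some b)

/-- The restriction with empty support. -/
def Restriction.empty (n : ℕ) : Restriction n := fun _ => none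

open Classical in
/-- The charge at `v` that the restriction `β` induces from the all-ones charge. -/
noncomputable def inducedCharge {n : ℕ} [NeZero n] (β : Restriction n) (v : Vertex n) : ZMod 2 :=
  1 - ∑ e : Edge n with v ∈ e.ends, (β e).getD 0

/-- A connected component is giant if it contains more than half of all vertices. -/
def IsGiant {n : ℕ} {H : SimpleGraph (Vertex n)} (K : H.ConnectedComponent) : Prop :=
  Nat.card (Vertex n) < 2 * K.supp.ncard

open Classical in
/-- `β` pushes the contradiction of the all-ones charge into the giant component of
`G_n - supp β`: that graph has a giant component, and the induced charge of a component
is odd exactly when the component is giant. -/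
def PushesContradiction {n : ℕ} [NeZero n] (β : Restriction n) : Prop :=
  (∃ K : (gridMinus β.supp).ConnectedComponent, IsGiant K) ∧
    ∀ K : (gridMinus β.supp).ConnectedComponent,
      (∑ v : Vertex n with v ∈ K.supp, inducedCharge β v) = 1 ↔ IsGiant K

open Classical in
/-- The closure of a restriction `β` with independent support: an unset edge that is a bridge of
`G_n - supp β` gets the (unique) value which pushes the contradiction into the giant component. -/
noncomputable def closure {n : ℕ} [NeZero n] (β : Restriction n) : Restriction n := fun e =>
  match β e with
  | some b => some b
  | none =>
    if (gridMinus β.supp).IsBridge e.ends then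
      if PushesContradiction (β.set e 0) then some 0 else some 1
    else none

/-! ### Decision trees -/

/-- Decision trees over the variables `E` with leaf labels in `L`; `node e T₀ T₁` queries `e`
and continues with `T₀` if the answer is `0`, with `T₁` if the answer is `1`. -/
inductive DTree (E L : Type) : Type
  | leaf : L → DTree E L
  | node : E → DTree E L → DTree E L → DTree E L

namespace DTree

variable {E L : Type}

/-- The length of a longest branch. -/
def depth : DTree E L → ℕ
  | leaf _ => 0
  | node _ T₀ T₁ => max T₀.depth T₁.depth + 1

/-- The tree has a leaf labelled `1`. -/
def HasOneLeaf : DTree E Bool → Prop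
  | leaf b => b = true
  | node _ T₀ T₁ => T₀.HasOneLeaf ∨ T₁.HasOneLeaf

/-- The variables on the leftmost path of length `r` that starts at the root
(`none` if every branch is shorter than `r`). -/
def leftmostPath : ℕ → DTree E L → Option (List E)
  | 0, _ => some []
  | _ + 1, leaf _ => none
  | r + 1, node e T₀ T₁ =>
    match leftmostPath r T₀ with
    | some η => some (e :: η)
    | none =>
      match leftmostPath r T₁ with
      | some η => some (e :: η)
      | none => none

end DTree

/-- The restricted tree `T ↾ β`: variables whose value is known from the closure of `β` and of
the answers received so far are not queried (so every branch queries an independent set). -/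
noncomputable def prune {n : ℕ} [NeZero n] : DTree (Edge n) Bool → Restriction n →
    DTree (Edge n) Bool
  | .leaf b, _ => .leaf b
  | .node e T₀ T₁, β =>
    match closure β e with
    | some b => if b = 0 then prune T₀ β else prune T₁ β
    | none => .node e (prune T₀ (β.set e 0)) (prune T₁ (β.set e 1))

/-- Every leaf of `S` labelled `0` is replaced by the tree `next σ`, where `σ` is `β` extended by
the branch of `S` that leads to the leaf. -/
noncomputable def attachAtZero {n : ℕ} (next : Restriction n → DTree (Edge n) Bool) :
    DTree (Edge n) Bool → Restriction n → DTree (Edge n) Bool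
  | .leaf true, _ => .leaf true
  | .leaf false, β => next β
  | .node e S₀ S₁, β =>
    .node e (attachAtZero next S₀ (β.set e 0)) (attachAtZero next S₁ (β.set e 1))

/-! ### DNFs -/

/-- The literal `(e, b)` says that the variable `x_e` has the value `b`. -/
abbrev Literal (n : ℕ) : Type := Edge n × ZMod 2

/-- A term is the conjunction of a list of literals. -/
abbrev Term (n : ℕ) : Type := List (Literal n)

/-- A DNF is the disjunction of an ordered list of terms. -/
abbrev DNF (n : ℕ) : Type := List (Term n)

/-- `k`-DNFs: all terms have at most `k` literals. -/
def DNF.IsWidth {n : ℕ} (k : ℕ) (F : DNF n) : Prop := ∀ C ∈ F, C.length ≤ k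

/-- A substitution replaces each variable `x_e` either by a constant (`inl b`), or by
`x_P + b` for a variable `x_P` of an `m × m` torus (`inr (P, b)`). -/
abbrev Subst (n m : ℕ) : Type := Edge n → ZMod 2 ⊕ (Edge m × ZMod 2)

/-- Substitution in a term: `none` if some literal becomes false; otherwise the literals that
become true are dropped. -/
def Term.subst {n m : ℕ} (σ : Subst n m) : Term n → Option (Term m)
  | [] => some []
  | (e, b) :: C =>
    match σ e with
    | .inl v => if v = b then Term.subst σ C else none
    | .inr (P, d) =>
      match Term.subst σ C with
      | some C' => some ((P, b - d) :: C')
      | none => none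

/-- Substitution in a DNF: the formula `1` (the DNF with one empty term) if some term becomes
true, and otherwise the disjunction of the terms that do not become false. -/
def DNF.subst {n m : ℕ} (σ : Subst n m) (F : DNF n) : DNF m :=
  if [] ∈ F.filterMap (Term.subst σ) then [[]] else F.filterMap (Term.subst σ)

/-- A restriction as a substitution. -/
def Restriction.toSubst {n : ℕ} (β : Restriction n) : Subst n n := fun e =>
  match β e with
  | some b => .inl b
  | none => .inr (e, 0)

/-! ### Canonical decision trees -/

/-- The tree which queries the variables of a term one by one until the term is decided. -/
def Term.tree {n : ℕ} : Term n → DTree (Edge n) Bool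
  | [] => .leaf true
  | (e, b) :: C =>
    if b = 0 then .node e (Term.tree C) (.leaf false) else .node e (.leaf false) (Term.tree C)

open Classical in
/-- Processing the terms in order, starting from the restriction `β`: at each `0`-leaf reached so
far, the restricted tree of the next term is attached if it has a `1`-leaf, and skipped
otherwise. -/
noncomputable def cdtFrom {n : ℕ} [NeZero n] : DNF n → Restriction n → DTree (Edge n) Bool
  | [], _ => .leaf false
  | C :: F, β =>
    if (prune (Term.tree C) β).HasOneLeaf then
      attachAtZero (cdtFrom F) (prune (Term.tree C) β) β
    else cdtFrom F β

/-- The canonical decision tree of `F ↾ π`, independent with respect to `G_n - supp π`. -/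
noncomputable def cdt {n : ℕ} [NeZero n] (F : DNF n) (π : Restriction n) : DTree (Edge n) Bool :=
  cdtFrom (F.subst (closure π).toSubst) π

/-- The tree that exhaustively queries the listed variables, continued by `next` at each leaf. -/
noncomputable def queryAll {n : ℕ} (next : Restriction n → DTree (Edge n) Unit) :
    List (Edge n) → Restriction n → DTree (Edge n) Unit
  | [], π => next π
  | e :: η, π => .node e (queryAll next η (π.set e 0)) (queryAll next η (π.set e 1))

/-- The recursion defining the canonical common `ℓ`-partial decision tree of `F_1 ↾ π, F_2 ↾ π, …`.
The first argument bounds the number of recursive calls along a branch. -/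
noncomputable def ccdtAux {n : ℕ} [NeZero n] (ℓ : ℕ) :
    ℕ → List (DNF n) → Restriction n → DTree (Edge n) Unit
  | 0, _, _ => .leaf ()
  | _ + 1, [], _ => .leaf ()
  | r + 1, F :: Fs, π =>
    match (cdt F π).leftmostPath (ℓ + 1) with
    | none => ccdtAux ℓ r Fs π
    | some η => queryAll (ccdtAux ℓ r (F :: Fs)) η π

/-- The canonical common `ℓ`-partial decision tree of an ordered collection of DNFs. Each recursive
call either drops a formula or queries new variables, so the bound on the number of calls is never
exhausted. -/
noncomputable def ccdt {n : ℕ} [NeZero n] (ℓ : ℕ) (Fs : List (DNF n)) : DTree (Edge n) Unit :=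
  ccdtAux ℓ (Fs.length + Fintype.card (Edge n)) Fs (Restriction.empty n)

/-! ### Grid restrictions

The `(T * m) × (T * m)` torus is divided into `m × m` subgrids of size `T × T`; the subgrid
`q : Vertex m` has lower left corner `(T * q.1, T * q.2)`. -/

/-- The number of centers of a subgrid, `Δ = ⌊√T / 2⌋`. -/
def numCenters (T : ℕ) : ℕ := Nat.sqrt T / 2

/-- The side length of the central square of a subgrid. -/
def squareSide (T : ℕ) : ℕ := 3 * T / 4

/-- The distance of the central square from the left and the lower border of its subgrid. -/
def squareMargin (T : ℕ) : ℕ := (T - squareSide T) / 2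

/-- Both coordinates, within its subgrid, of the center with index `i`: the centers lie on the
diagonal of the central square, at distance `3 * Δ` from each other in each direction. -/
def centerPos (T i : ℕ) : ℕ :=
  squareMargin T + 3 * numCenters T * i + 3 * numCenters T / 2

/-- A choice of one center in each subgrid. -/
abbrev Centers (T m : ℕ) : Type := Vertex m → Fin (numCenters T)

/-- The vertex of the large torus that is chosen as the center of the subgrid `q`. -/
def centerVertex {T m : ℕ} (c : Centers T m) (q : Vertex m) : Vertex (T * m) :=
  (((T * q.1.val + centerPos T (c q) : ℕ) : ZMod (T * m)),
    ((T * q.2.val + centerPos T (c q) : ℕ) : ZMod (T * m)))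

/-- The edges of a horizontal segment between the columns `x₁` and `x₂`, in the row `y`. -/
def hSegment (n x₁ x₂ y : ℕ) : Set (Edge n) :=
  {e | ∃ x : ℕ, min x₁ x₂ ≤ x ∧ x < max x₁ x₂ ∧ e = (((x : ZMod n), (y : ZMod n)), false)}

/-- The edges of a vertical segment between the rows `y₁` and `y₂`, in the column `x`. -/
def vSegment (n x y₁ y₂ : ℕ) : Set (Edge n) :=
  {e | ∃ y : ℕ, min y₁ y₂ ≤ y ∧ y < max y₁ y₂ ∧ e = (((x : ZMod n), (y : ZMod n)), true)}

/-- The path from the center with index `j` of the subgrid `q` to the center with index `i` of the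
subgrid above it. With centers numbered `1, …, Δ`, it goes left of the lower center by the number
of the upper one and then up to the row that is reserved for this pair between the two central
squares; it goes right of the upper center by the number of the lower one and then down to the
same row; the two pieces are joined within that row. -/
def upPath (T m : ℕ) (q : Vertex m) (j i : ℕ) : Set (Edge (T * m)) :=
  let X := T * q.1.val
  let Y := T * q.2.val
  let row := Y + squareMargin T + squareSide T + (numCenters T * i + j)
  let colLow := X + centerPos T j - (i + 1)
  let colUp := X + centerPos T i + (j + 1)
  hSegment (T * m) colLow (X + centerPos T j) (Y + centerPos T j) ∪
  vSegment (T * m) colLow (Y + centerPos T j) row ∪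
  hSegment (T * m) colLow colUp row ∪
  vSegment (T * m) colUp row (Y + T + centerPos T i) ∪
  hSegment (T * m) (X + centerPos T i) colUp (Y + T + centerPos T i)

/-- The path from the center with index `i` of the subgrid `q` to the center with index `j` of the
subgrid to its right: the vertical construction turned by a quarter. It goes up from the left
center and then right to the reserved column, and down from the right center and then left to that
column. -/
def rightPath (T m : ℕ) (q : Vertex m) (i j : ℕ) : Set (Edge (T * m)) :=
  let X := T * q.1.val
  let Y := T * q.2.val
  let col := X + squareMargin T + squareSide T + (numCenters T * i + j)
  let rowLeft := Y + centerPos T i + (j + 1)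
  let rowRight := Y + centerPos T j - (i + 1)
  vSegment (T * m) (X + centerPos T i) (Y + centerPos T i) rowLeft ∪
  hSegment (T * m) (X + centerPos T i) col rowLeft ∪
  vSegment (T * m) col rowLeft rowRight ∪
  hSegment (T * m) col (X + T + centerPos T j) rowRight ∪
  vSegment (T * m) (X + T + centerPos T j) rowRight (Y + centerPos T j)

/-- The path between the chosen centers of two adjacent subgrids; such paths are indexed by the
edges of the `m × m` torus. -/
def livePath {T m : ℕ} (c : Centers T m) (P : Edge m) : Set (Edge (T * m)) :=
  if P.2 then upPath T m P.1 (c P.1) (c P.target) else rightPath T m P.1 (c P.1) (c P.target)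

open Classical in
/-- `a` satisfies the Tseitin constraints with charge `0` at the chosen centers and charge `1` at
all other vertices of the large torus. -/
def IsSuggested {T m : ℕ} [NeZero T] [NeZero m] (c : Centers T m)
    (a : Edge (T * m) → ZMod 2) : Prop :=
  ∀ v : Vertex (T * m),
    (∑ e : Edge (T * m) with v ∈ e.ends, a e) = if ∃ q, centerVertex c q = v then 0 else 1

open Classical in
/-- The restriction `ρ` given by the chosen centers `c` and the suggested assignment `a`: a
variable on the path `P` between chosen centers becomes `x_P + a e`, i.e. `x_P` or its negation;
all other variables get their suggested value. (The paths between chosen centers are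
edge-disjoint.) -/
noncomputable def gridRestriction {T m : ℕ} (c : Centers T m) (a : Edge (T * m) → ZMod 2) :
    Subst (T * m) m := fun e =>
  if h : ∃ P : Edge m, e ∈ livePath c P then .inr (h.choose, a e) else .inl (a e)

open Classical in
/-- The probability of an event under a random grid restriction: the center of each subgrid is
chosen uniformly and independently, then a suggested assignment is chosen uniformly among all
solutions for these centers. -/
noncomputable def gridProb (T m : ℕ) [NeZero T] [NeZero m] (A : Subst (T * m) m → Prop) : ℝ :=
  (∑ c : Centers T m,
    (Finset.card {a : Edge (T * m) → ZMod 2 | IsSuggested c a ∧ A (gridRestriction c a)} : ℝ) /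
      (Finset.card {a : Edge (T * m) → ZMod 2 | IsSuggested c a} : ℝ)) /
    (Fintype.card (Centers T m) : ℝ)

end GridSwitching

/-! A deep branch of the common tree is compressed. It makes `t` distinct queries, in rounds of `ℓ +
1` queries to one formula (the union bound over the formulas of the rounds gives the power of `s`),
and each query is made by the first term of its formula that is still live (`exists_isTrace`). To
free "live" from trees and closures, it is expressed through solutions of the Tseitin system that
fail at a single vertex, the root, in the giant component: closure values are forced in all of them
(`closure_eq_of_isBridge`), so a pruned term tree has a 1-leaf exactly when such a solution
satisfies the term (`hasOneLeaf_prune_tree_iff`).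

A queried variable comes from a large edge on a live path, and that edge betrays the index of the
center at one end of the path (`exists_determined_end`). After passing to one of nine colour classes
of subgrids, these ends are pairwise non-adjacent, so all other centers can be held fixed. This
leaves about `t / 72` centers in one class, each with `L = ⌊log₂ Δ⌋` bits that matter to some term
of the trace.

The freedom comes from a change of variables. Take a reference assignment `x₀` on the small torus
with odd sums on the class, and hold `A = a + shift c x₀` fixed instead of `a`. Whether `A` comes
from a suggested assignment does not depend on the centers in the class
(`isSuggested_add_shift_congr`). A large edge `e` owned by `P` has the value `A e + x P + x₀ P` on
the path and `A e` off it; where `x` agrees with `x₀`, the value does not reveal where the center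
is. Hence every bit whose first use is by a term whose witness agrees with `x₀` at that center may
be overwritten at will. Averaging over 512 reference assignments, a sixteenth of the bits are of
this kind (`exists_refAssign`).

The true centers are recovered from the overwritten ones and some advice. For each edge, the indices
of a center that put it on a path form an upper interval or contain at most one point
(`exists_pivot`), so an edge that distinguishes two indices in a dyadic block shows all bits above
the block; the advice adds one bit and the position of the next open bits. Marks that bound the open
bits keep the decoder from accepting wrong terms, and every wrong term leads to a new mark. So `t +
r₀` instructions suffice for `r₀` centers, and the numbers in them add up to at most `L * r₀`
(`exists_instrs`). There are at most `(64/63) ^ (L * r₀) * 2 ^ O(k * t)` advice strings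
(`card_codes_le`) against at least `2 ^ (L * r₀ / 16)` overwritings (`card_mul_two_pow_le`); the
quotient is the bound. -/

set_option linter.unusedSectionVars false

/-! ### Vertex sums modulo 2 on the torus. -/

namespace GridSwitching

/-! ### Vertex degrees and connected components of the torus -/

section Torus

variable {n : ℕ}

lemma one_ne_zero_zmod (hn : 3 ≤ n) : (1 : ZMod n) ≠ 0 := by
  have : Fact (1 < n) := ⟨by omega⟩
  exact one_ne_zero

lemma two_ne_zero_zmod (hn : 3 ≤ n) : (1 + 1 : ZMod n) ≠ 0 := by
  intro h
  have h2 : ((2 : ℕ) : ZMod n) = 0 := by push_cast; rw [← h]; norm_num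
  rw [ZMod.natCast_eq_zero_iff] at h2
  exact absurd (Nat.le_of_dvd (by norm_num) h2) (by omega)

lemma Edge.target_false (v : Vertex n) : Edge.target (v, false) = (v.1 + 1, v.2) := rfl

lemma Edge.target_true (v : Vertex n) : Edge.target (v, true) = (v.1, v.2 + 1) := rfl

lemma Edge.ne_target (hn : 3 ≤ n) (e : Edge n) : e.1 ≠ e.target := by
  obtain ⟨⟨x, y⟩, b⟩ := e
  have := one_ne_zero_zmod hn
  cases b <;> simp [Edge.target, this]

lemma Edge.mem_ends {e : Edge n} {v : Vertex n} : v ∈ e.ends ↔ v = e.1 ∨ v = e.target := by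
  simp [Edge.ends]

/-- Two edges with swapped endpoints would force `1 = 0` or `1 + 1 = 0`, which is excluded from side
length 3 on. -/
lemma Edge.ends_injective (hn : 3 ≤ n) : Function.Injective (Edge.ends : Edge n → _) := by
  rintro ⟨⟨x, y⟩, b⟩ ⟨⟨x', y'⟩, b'⟩ h
  have h1 := one_ne_zero_zmod hn
  have h2 := two_ne_zero_zmod hn
  simp only [Edge.ends, Sym2.eq_iff] at h
  rcases h with ⟨h, h'⟩ | ⟨h, h'⟩
  · obtain ⟨rfl, rfl⟩ := Prod.mk.inj h
    cases b <;> cases b' <;> simp [Edge.target, h1] at h' ⊢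
  · exfalso
    cases b <;> cases b' <;> simp only [Edge.target, Prod.mk.injEq, if_true, if_false,
      Bool.false_eq_true] at h h' <;> obtain ⟨ha, hb⟩ := h <;> obtain ⟨hc, hd⟩ := h'
    · rw [ha, add_assoc] at hc; exact h2 (by simpa using hc)
    · rw [ha] at hc; exact h1 (by simpa using hc)
    · rw [ha] at hc; exact h1 (by simpa using hc)
    · rw [hb, add_assoc] at hd; exact h2 (by simpa using hd)

open Classical in
/-- The sum of the values on the edges at a vertex. -/
noncomputable def deg [NeZero n] (x : Edge n → ZMod 2) (v : Vertex n) : ZMod 2 :=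
  ∑ e : Edge n with v ∈ e.ends, x e

variable [NeZero n]

open Classical in
lemma deg_eq_sum (hn : 3 ≤ n) (x : Edge n → ZMod 2) (v : Vertex n) :
    deg x v = ∑ e : Edge n, ((if e.1 = v then x e else 0) + (if e.target = v then x e else 0)) := by
  rw [deg, Finset.sum_filter]
  refine Finset.sum_congr rfl fun e _ => ?_
  have := Edge.ne_target hn e
  by_cases h1 : e.1 = v
  · subst h1
    simp [Edge.mem_ends, this.symm]
  · by_cases h2 : e.target = v
    · subst h2; simp [Edge.mem_ends, h1]
    · simp [Edge.mem_ends, h1, h2, Ne.symm h1, Ne.symm h2]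

lemma deg_eq (hn : 3 ≤ n) (x : Edge n → ZMod 2) (v : Vertex n) :
    deg x v = x (v, false) + x (v, true) + x ((v.1 - 1, v.2), false) + x ((v.1, v.2 - 1), true) := by
  classical
  have h0 : ∀ f : Edge n → ZMod 2, ∑ e, f e = ∑ u, ∑ b, f (u, b) := fun f => Fintype.sum_prod_type f
  rw [deg_eq_sum hn, Finset.sum_add_distrib, h0, h0]
  have h1 : ∀ u : Vertex n, (∑ b : Bool, if ((u, b) : Edge n).1 = v then x (u, b) else 0) =
      if u = v then x (u, true) + x (u, false) else 0 := by
    intro u; by_cases h : u = v <;> simp [h]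
  have h2 : ∀ u : Vertex n, (∑ b : Bool, if Edge.target ((u, b) : Edge n) = v then x (u, b) else 0) =
      (if u = (v.1, v.2 - 1) then x (u, true) else 0) +
        (if u = (v.1 - 1, v.2) then x (u, false) else 0) := by
    intro u
    have e1 : Edge.target ((u, true) : Edge n) = v ↔ u = (v.1, v.2 - 1) := by
      rw [Edge.target_true, Prod.ext_iff, Prod.ext_iff]; simp [eq_sub_iff_add_eq]
    have e2 : Edge.target ((u, false) : Edge n) = v ↔ u = (v.1 - 1, v.2) := by
      rw [Edge.target_false, Prod.ext_iff, Prod.ext_iff]; simp [eq_sub_iff_add_eq]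
    simp only [Fintype.sum_bool, e1, e2]
  rw [Finset.sum_congr rfl fun u _ => h1 u, Finset.sum_congr rfl fun u _ => h2 u,
    Finset.sum_add_distrib]
  simp only [Finset.sum_ite_eq', Finset.mem_univ, if_true]
  ring

lemma deg_add (x y : Edge n → ZMod 2) (v : Vertex n) : deg (x + y) v = deg x v + deg y v := by
  simp [deg, Finset.sum_add_distrib]

lemma deg_sum {ι : Type*} (s : Finset ι) (x : ι → Edge n → ZMod 2) (v : Vertex n) :
    deg (∑ i ∈ s, x i) v = ∑ i ∈ s, deg (x i) v := by
  simp only [deg, Finset.sum_apply]; exact Finset.sum_comm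

lemma deg_smul (r : ZMod 2) (x : Edge n → ZMod 2) (v : Vertex n) :
    deg (fun e => r * x e) v = r * deg x v := by
  simp [deg, Finset.mul_sum]

lemma sum_deg (hn : 3 ≤ n) (x : Edge n → ZMod 2) (S : Set (Vertex n)) [DecidablePred (· ∈ S)] :
    (∑ v : Vertex n with v ∈ S, deg x v) =
      ∑ e : Edge n, ((if e.1 ∈ S then x e else 0) + (if e.target ∈ S then x e else 0)) := by
  classical
  simp_rw [deg_eq_sum hn]
  rw [Finset.sum_comm]
  refine Finset.sum_congr rfl fun e _ => ?_
  rw [Finset.sum_add_distrib]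
  simp [Finset.sum_ite_eq]

open Classical in
lemma deg_single (hn : 3 ≤ n) (e : Edge n) (v : Vertex n) :
    deg (Pi.single e 1) v = (if v = e.1 then 1 else 0) + (if v = e.target then 1 else 0) := by
  rw [deg_eq_sum hn, Finset.sum_eq_single e]
  · simp [eq_comm]
  · intro b _ hb; simp [Pi.single_eq_of_ne hb]
  · simp

lemma gridMinus_adj_of_notMem (hn : 3 ≤ n) {S : Set (Edge n)} {e : Edge n} (he : e ∉ S) :
    (gridMinus S).Adj e.1 e.target := by
  rw [gridMinus, SimpleGraph.fromEdgeSet_adj]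
  exact ⟨⟨e, he, rfl⟩, Edge.ne_target hn e⟩

lemma gridMinus_insert (hn : 3 ≤ n) (S : Set (Edge n)) (e : Edge n) :
    gridMinus (insert e S) = (gridMinus S).deleteEdges {e.ends} := by
  rw [gridMinus, gridMinus, SimpleGraph.deleteEdges_fromEdgeSet, ← Set.image_singleton,
    ← Set.image_sdiff (Edge.ends_injective hn)]
  congr 2
  ext f; simp [and_comm]

lemma gridMinus_anti {S S' : Set (Edge n)} (h : S ⊆ S') : gridMinus S' ≤ gridMinus S :=
  SimpleGraph.fromEdgeSet_mono (Set.image_mono (Set.compl_subset_compl.2 h))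

lemma mem_supp_iff_of_notMem (hn : 3 ≤ n) {S : Set (Edge n)} (K : (gridMinus S).ConnectedComponent)
    {e : Edge n} (he : e ∉ S) : e.1 ∈ K.supp ↔ e.target ∈ K.supp := by
  have := gridMinus_adj_of_notMem hn he
  simp only [SimpleGraph.ConnectedComponent.mem_supp_iff]
  rw [SimpleGraph.ConnectedComponent.eq.2 this.reachable]

/-- An edge outside `S` has both ends in the component or none, so it is counted an even number of
times. -/
lemma sum_deg_component (hn : 3 ≤ n) {S : Set (Edge n)} (K : (gridMinus S).ConnectedComponent)
    [DecidablePred (· ∈ K.supp)]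
    (x : Edge n → ZMod 2) (hx : ∀ e ∈ S, x e = 0) :
    (∑ v : Vertex n with v ∈ K.supp, deg x v) = 0 := by
  rw [sum_deg hn]
  refine Finset.sum_eq_zero fun e _ => ?_
  by_cases he : e ∈ S
  · simp [hx e he]
  · simp only [mem_supp_iff_of_notMem hn K he]; exact CharTwo.add_self_eq_zero _

/-! ### Solutions and restrictions -/

open Classical in
/-- All vertex sums are odd, except at `w`. -/
def IsSol (w : Vertex n) (x : Edge n → ZMod 2) : Prop :=
  ∀ v, deg x v = if v = w then 0 else 1

/-- `x` extends the partial assignment `β`. -/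
def Ext (x : Edge n → ZMod 2) (β : Restriction n) : Prop := ∀ e b, β e = some b → x e = b

/-- The component of `w` in the torus without `Y` is giant. -/
def Good (w : Vertex n) (Y : Set (Edge n)) : Prop :=
  IsGiant ((gridMinus Y).connectedComponentMk w)

/-- The support of `β` is independent. -/
def Indep (β : Restriction n) : Prop := (gridMinus β.supp).Connected

end Torus

end GridSwitching

/-! ### Solutions with one exceptional vertex, and what they say about closures and pruned trees. -/

namespace GridSwitching

section Torus

variable {n : ℕ} [NeZero n]

/-! ### Giant components -/

lemma Good.mono {w : Vertex n} {Y Y' : Set (Edge n)} (h : Y' ⊆ Y) (hw : Good w Y) : Good w Y' := by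
  refine lt_of_lt_of_le hw ?_
  refine Nat.mul_le_mul_left 2 (Set.ncard_le_ncard ?_ (Set.toFinite _))
  intro v hv
  rw [SimpleGraph.ConnectedComponent.mem_supp_iff, SimpleGraph.ConnectedComponent.eq] at hv ⊢
  exact hv.mono (gridMinus_anti h)

/-- Two components with more than half of the vertices each would meet. -/
lemma isGiant_iff_of_good {w : Vertex n} {Y : Set (Edge n)} (hw : Good w Y)
    (K : (gridMinus Y).ConnectedComponent) : IsGiant K ↔ w ∈ K.supp := by
  constructor
  · intro hK
    set K' := (gridMinus Y).connectedComponentMk w with hK'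
    have : ¬ Disjoint K.supp K'.supp := by
      intro hd
      have h1 := Set.ncard_union_eq hd (Set.toFinite _) (Set.toFinite _)
      have h2 := Set.ncard_le_card (K.supp ∪ K'.supp)
      have h3 : Nat.card (Vertex n) < 2 * K'.supp.ncard := hw
      have h4 : Nat.card (Vertex n) < 2 * K.supp.ncard := hK
      omega
    rw [Set.not_disjoint_iff] at this
    obtain ⟨v, hv, hv'⟩ := this
    rw [SimpleGraph.ConnectedComponent.mem_supp_iff] at hv hv' ⊢
    rw [← hv, hv']
  · intro h
    rw [SimpleGraph.ConnectedComponent.mem_supp_iff] at h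
    rw [← h]; exact hw

lemma Restriction.supp_set (β : Restriction n) (e : Edge n) (b : ZMod 2) :
    (β.set e b).supp = insert e β.supp := by
  ext f
  by_cases h : f = e
  · subst h; simp [Restriction.supp, Restriction.set]
  · simp [Restriction.supp, Restriction.set, h]

lemma ext_set_iff {x : Edge n → ZMod 2} {β : Restriction n} {e : Edge n} (he : β e = none)
    (b : ZMod 2) : Ext x (β.set e b) ↔ Ext x β ∧ x e = b := by
  constructor
  · intro h
    refine ⟨fun f c hf => h f c ?_, h e b (by simp [Restriction.set])⟩
    have : f ≠ e := by rintro rfl; simp [he] at hf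
    simpa [Restriction.set, this] using hf
  · rintro ⟨h, h'⟩ f c hf
    by_cases hfe : f = e
    · subst hfe; simp [Restriction.set] at hf; rw [h', hf]
    · exact h f c (by simpa [Restriction.set, hfe] using hf)

/-- Unset edges do not leave the component, so completing `β` to a total assignment leaves the
parity of the component's charge unchanged. -/
lemma sum_inducedCharge (hn : 3 ≤ n) {β : Restriction n} {x : Edge n → ZMod 2} (hx : Ext x β)
    (K : (gridMinus β.supp).ConnectedComponent) [DecidablePred (· ∈ K.supp)] :
    (∑ v : Vertex n with v ∈ K.supp, inducedCharge β v) =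
      ∑ v : Vertex n with v ∈ K.supp, (1 - deg x v) := by
  have h1 : ∀ v, inducedCharge β v = 1 - deg (fun e => (β e).getD 0) v := fun v => rfl
  have h2 : ∀ v, inducedCharge β v =
      (1 - deg x v) + deg (x + fun e => (β e).getD 0) v := by
    intro v
    rw [h1, deg_add]
    have := CharTwo.add_self_eq_zero (deg (fun e => (β e).getD 0) v)
    linear_combination -this
  rw [Finset.sum_congr rfl fun v _ => h2 v, Finset.sum_add_distrib, sum_deg_component hn K, add_zero]
  intro e he
  obtain ⟨b, hb⟩ := Option.ne_none_iff_exists'.1 he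
  simp only [Pi.add_apply, hb, Option.getD_some, hx e b hb]
  exact CharTwo.add_self_eq_zero _

open Classical in
lemma sum_one_sub_deg {w : Vertex n} {x : Edge n → ZMod 2} (hx : IsSol w x) (S : Set (Vertex n))
    [DecidablePred (· ∈ S)] :
    (∑ v : Vertex n with v ∈ S, (1 - deg x v)) = if w ∈ S then 1 else 0 := by
  have : ∀ v, 1 - deg x v = if v = w then 1 else 0 := by
    intro v; rw [hx v]; split_ifs <;> simp
  rw [Finset.sum_congr rfl fun v _ => this v]
  simp [Finset.sum_ite_eq']

lemma zmod_two_cases (a : ZMod 2) : a = 0 ∨ a = 1 := by revert a; decide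

lemma closure_of_some {β : Restriction n} {e : Edge n} {b : ZMod 2} (h : β e = some b) :
    closure β e = some b := by
  simp [closure, h]

lemma closure_eq_none_iff {β : Restriction n} {e : Edge n} :
    closure β e = none ↔ β e = none ∧ ¬ (gridMinus β.supp).IsBridge e.ends := by
  cases h : β e with
  | some b => simp [closure, h]
  | none =>
    simp only [closure, h, true_and]
    split_ifs <;> simp_all

/-- The closure of an independent restriction gives a bridge its value in every solution that
extends the restriction. -/
lemma closure_eq_of_isBridge (hn : 3 ≤ n) {β : Restriction n} {e : Edge n} (he : β e = none)
    (hb : (gridMinus β.supp).IsBridge e.ends) {w : Vertex n} (hw : Good w (insert e β.supp))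
    {x : Edge n → ZMod 2} (hx : IsSol w x) (hxβ : Ext x β) : closure β e = some (x e) := by
  classical
  simp only [closure, he, hb, if_true]
  rw [← Restriction.supp_set β e 0] at hw
  rcases zmod_two_cases (x e) with h0 | h1
  -- Here `x` extends `β.set e 0`, and its only remaining charge sits at `w`; so the odd component
  -- is the one of `w`, which is the giant one.
  · rw [if_pos, h0]
    refine ⟨⟨_, hw⟩, fun K => ?_⟩
    rw [sum_inducedCharge hn ((ext_set_iff he 0).2 ⟨hxβ, h0⟩), sum_one_sub_deg hx,
      isGiant_iff_of_good hw]
    simp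
  · rw [if_neg, h1]
    rintro ⟨-, hp⟩
    set K := (gridMinus (β.set e 0).supp).connectedComponentMk e.1 with hK
    have hK1 : e.1 ∈ K.supp := rfl
    have hK2 : e.target ∉ K.supp := by
      intro h
      rw [SimpleGraph.ConnectedComponent.mem_supp_iff, SimpleGraph.ConnectedComponent.eq,
        Restriction.supp_set, gridMinus_insert hn] at h
      exact hb h.symm
    -- Flipping `x` at `e` gives an extension of `β.set e 0`. Exactly one end of `e` lies in `K`, so
    -- the parity of `K` becomes the opposite of what `PushesContradiction` demands.
    have hx' : Ext (x + Pi.single e 1) (β.set e 0) := by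
      rw [ext_set_iff he]
      refine ⟨fun f b hf => ?_, by simp [h1]; decide⟩
      have : f ≠ e := by rintro rfl; simp [he] at hf
      simp [this, hxβ f b hf]
    have h2 := hp K
    rw [sum_inducedCharge hn hx', isGiant_iff_of_good hw] at h2
    have h3 : ∀ v, 1 - deg (x + Pi.single e 1) v = (1 - deg x v) - deg (Pi.single e 1) v := by
      intro v; rw [deg_add]; ring
    rw [Finset.sum_congr rfl fun v _ => h3 v, Finset.sum_sub_distrib, sum_one_sub_deg hx,
      sum_deg hn, Finset.sum_eq_single e] at h2
    · by_cases hwK : w ∈ K.supp <;> simp [hwK, hK1, hK2] at h2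
    · intro f _ hf; simp [hf]
    · simp

lemma closure_eq_of_some (hn : 3 ≤ n) {β : Restriction n} {e : Edge n} {w : Vertex n}
    (hw : Good w (insert e β.supp)) {x : Edge n → ZMod 2} (hx : IsSol w x) (hxβ : Ext x β)
    {v : ZMod 2} (hv : closure β e = some v) : x e = v := by
  cases h : β e with
  | some b => rw [closure_of_some h] at hv; rw [hxβ e b h]; exact Option.some.inj hv
  | none =>
    have hb : (gridMinus β.supp).IsBridge e.ends := by
      by_contra hb
      rw [closure_eq_none_iff.2 ⟨h, hb⟩] at hv; simp at hv
    rw [closure_eq_of_isBridge hn h hb hw hx hxβ] at hv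
    exact Option.some.inj hv

lemma Indep.set (hn : 3 ≤ n) {β : Restriction n} (hβ : Indep β) {e : Edge n}
    (he : closure β e = none) (b : ZMod 2) : Indep (β.set e b) := by
  rw [closure_eq_none_iff] at he
  rw [Indep, Restriction.supp_set, gridMinus_insert hn]
  exact SimpleGraph.Connected.connected_delete_edge_of_not_isBridge hβ he.2

/-! ### Existence of solutions -/

/-- The edges of a walk, counted modulo 2, have odd sums only at its two ends. -/
lemma exists_deg_eq_of_reachable (hn : 3 ≤ n) (S : Set (Edge n)) {u v : Vertex n}
    (h : (gridMinus S).Reachable u v) :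
    ∃ y : Edge n → ZMod 2, (∀ e ∈ S, y e = 0) ∧
      ∀ z, deg y z = (Pi.single u 1 : Vertex n → ZMod 2) z + (Pi.single v 1 : Vertex n → ZMod 2) z := by
  classical
  obtain ⟨p⟩ := h
  induction p with
  | nil =>
    refine ⟨0, by simp, fun z => ?_⟩
    rw [CharTwo.add_self_eq_zero]; simp [deg]
  | @cons u v w hadj p ih =>
    obtain ⟨y, hy, hy'⟩ := ih
    rw [gridMinus, SimpleGraph.fromEdgeSet_adj] at hadj
    obtain ⟨⟨e, heS, he⟩, -⟩ := hadj
    refine ⟨y + Pi.single e 1, fun f hf => ?_, fun z => ?_⟩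
    · have : f ≠ e := by rintro rfl; exact heS hf
      simp [this, hy f hf]
    · rw [deg_add, hy', deg_single hn]
      have key : ((if z = e.1 then 1 else 0) + (if z = e.target then 1 else 0) : ZMod 2) =
          (Pi.single u 1 : Vertex n → ZMod 2) z + (Pi.single v 1 : Vertex n → ZMod 2) z := by
        simp only [Edge.ends, Sym2.eq_iff] at he
        simp only [Pi.single_apply]
        rcases he with ⟨h1, h2⟩ | ⟨h1, h2⟩ <;> rw [h1, h2]
        exact add_comm _ _
      rw [key]
      have := CharTwo.add_self_eq_zero ((Pi.single v 1 : Vertex n → ZMod 2) z)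
      linear_combination this

lemma sum_deg_eq_zero (hn : 3 ≤ n) (x : Edge n → ZMod 2) : ∑ v, deg x v = 0 := by
  classical
  have := sum_deg hn x Set.univ
  simp only [Set.mem_univ, Finset.filter_true, if_true] at this
  rw [this]
  exact Finset.sum_eq_zero fun e _ => CharTwo.add_self_eq_zero _

/-- Every vertex sends its demand to the fixed vertex `w` through the remaining connected graph;
there the demands cancel because their total is zero. -/
lemma exists_deg_eq (hn : 3 ≤ n) {β : Restriction n} (hβ : Indep β) (f : Vertex n → ZMod 2)
    (hf : ∑ v, f v = 0) :
    ∃ y : Edge n → ZMod 2, (∀ e ∈ β.supp, y e = 0) ∧ ∀ z, deg y z = f z := by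
  classical
  let w : Vertex n := (0, 0)
  have H : ∀ v : Vertex n, ∃ y : Edge n → ZMod 2, (∀ e ∈ β.supp, y e = 0) ∧
      ∀ z, deg y z = (Pi.single v 1 : Vertex n → ZMod 2) z + (Pi.single w 1 : Vertex n → ZMod 2) z :=
    fun v => exists_deg_eq_of_reachable hn _ (hβ.preconnected v w)
  choose y hy hy' using H
  refine ⟨∑ v, fun e => f v * y v e, fun e he => ?_, fun z => ?_⟩
  · rw [Finset.sum_apply]
    exact Finset.sum_eq_zero fun v _ => by simp [hy v e he]
  · rw [deg_sum]
    simp_rw [deg_smul, hy', mul_add, Finset.sum_add_distrib, ← Finset.sum_mul, hf]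
    simp [Pi.single_apply]

/-- For odd `n` the number of vertices is odd, so exempting one vertex makes the total charge even,
and on a connected graph parity is the only obstruction. -/
lemma exists_isSol (hn : 3 ≤ n) (hodd : Odd n) {β : Restriction n} (hβ : Indep β) (w : Vertex n) :
    ∃ x, IsSol w x ∧ Ext x β := by
  classical
  let g : Edge n → ZMod 2 := fun e => (β e).getD 0
  have hf : ∑ v : Vertex n, ((if v = w then 0 else 1) - deg g v) = 0 := by
    rw [Finset.sum_sub_distrib, sum_deg_eq_zero hn]
    have : ∀ v : Vertex n, (if v = w then 0 else 1 : ZMod 2) = 1 - if v = w then 1 else 0 := by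
      intro v; split_ifs <;> simp
    rw [Finset.sum_congr rfl fun v _ => this v, Finset.sum_sub_distrib]
    have h1 : ((n : ℕ) : ZMod 2) = 1 := by
      rw [ZMod.natCast_eq_one_iff_odd]; exact hodd
    simp [ZMod.card, h1]
  obtain ⟨y, hy, hy'⟩ := exists_deg_eq hn hβ _ hf
  refine ⟨y + g, fun v => ?_, fun e b hb => ?_⟩
  · rw [deg_add, hy']; ring
  · have : e ∈ β.supp := by simp [Restriction.supp, hb]
    simp [hy e this, g, hb]

/-- A small set of edges leaves many vertices in the giant component. -/
lemma exists_good (Y : Set (Edge n)) (hY : 2 * Y.ncard < n) (A : Set (Vertex n)) (hA : A.ncard < n) :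
    ∃ w, w ∉ A ∧ Good w Y := by
  classical
  have hn : 0 < n := NeZero.pos n
  -- columns and rows that meet `Y`
  let bad : Finset (ZMod n) := (Y.toFinset).image fun e => e.1.1
  let badr : Finset (ZMod n) := (Y.toFinset).image fun e => e.1.2
  have hc : Y.toFinset.card = Y.ncard := (Set.ncard_eq_toFinset_card' Y).symm
  have hbad : bad.card ≤ Y.ncard := hc ▸ Finset.card_image_le
  have hbadr : badr.card ≤ Y.ncard := hc ▸ Finset.card_image_le
  obtain ⟨r, hr⟩ : ∃ r, r ∉ badr := by
    by_contra! h
    have : badr = Finset.univ := Finset.eq_univ_iff_forall.2 h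
    rw [this, Finset.card_univ, ZMod.card] at hbadr; omega
  obtain ⟨c, hcb⟩ : ∃ c, c ∉ bad := by
    by_contra! h
    have : bad = Finset.univ := Finset.eq_univ_iff_forall.2 h
    rw [this, Finset.card_univ, ZMod.card] at hbad; omega
  -- A row that avoids `Y` joins all columns that avoid `Y`. Fewer than half of the columns meet
  -- `Y`, so the clean ones fill more than half of the torus; one clean column alone has `n`
  -- vertices, too many for `A`.
  have hrow : ∀ a, ((a, r), false) ∉ Y := by
    intro a ha; exact hr (Finset.mem_image.2 ⟨_, Set.mem_toFinset.2 ha, rfl⟩)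
  have hcol : ∀ a ∉ bad, ∀ b, ((a, b), true) ∉ Y := by
    intro a hab b ha; exact hab (Finset.mem_image.2 ⟨_, Set.mem_toFinset.2 ha, rfl⟩)
  have hstep : ∀ e : Edge n, e ∉ Y → (gridMinus Y).Reachable e.1 e.target := by
    intro e he
    by_cases h : e.1 = e.target
    · rw [← h]
    · refine SimpleGraph.Adj.reachable ?_
      rw [gridMinus, SimpleGraph.fromEdgeSet_adj]; exact ⟨⟨e, he, rfl⟩, h⟩
  have hR : ∀ k : ℕ, ∀ a, (gridMinus Y).Reachable (a, r) (a + (k : ZMod n), r) := by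
    intro k; induction k with
    | zero => intro a; simp
    | succ k ih =>
      intro a
      have := hstep ((a + (k : ZMod n), r), false) (hrow _)
      simp only [Edge.target_false] at this
      rw [Nat.cast_succ, ← add_assoc]; exact (ih a).trans this
  have hC : ∀ k : ℕ, ∀ a ∉ bad, ∀ b, (gridMinus Y).Reachable (a, b) (a, b + (k : ZMod n)) := by
    intro k; induction k with
    | zero => intro a _ b; simp
    | succ k ih =>
      intro a ha b
      have := hstep ((a, b + (k : ZMod n)), true) (hcol a ha _)
      simp only [Edge.target_true] at this
      rw [Nat.cast_succ, ← add_assoc]; exact (ih a ha b).trans this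
  have hR' : ∀ a a', (gridMinus Y).Reachable (a, r) (a', r) := by
    intro a a'
    have := hR (a' - a).val a
    rwa [ZMod.natCast_zmod_val, add_sub_cancel] at this
  have hC' : ∀ a ∉ bad, ∀ b b', (gridMinus Y).Reachable (a, b) (a, b') := by
    intro a ha b b'
    have := hC (b' - b).val a ha b
    rwa [ZMod.natCast_zmod_val, add_sub_cancel] at this
  have hall : ∀ a ∉ bad, ∀ a' ∉ bad, ∀ b b', (gridMinus Y).Reachable (a, b) (a', b') :=
    fun a ha a' ha' b b' => ((hC' a ha b r).trans (hR' a a')).trans (hC' a' ha' r b')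
  obtain ⟨b, hb⟩ : ∃ b, (c, b) ∉ A := by
    by_contra! h
    have h1 : (Set.range fun b : ZMod n => ((c, b) : Vertex n)) ⊆ A := by
      rintro _ ⟨b, rfl⟩; exact h b
    have h2 := Set.ncard_le_ncard h1 (Set.toFinite _)
    rw [← Set.image_univ, Set.ncard_image_of_injective _ (Prod.mk_right_injective c),
      Set.ncard_univ, Nat.card_zmod] at h2
    omega
  refine ⟨(c, b), hb, ?_⟩
  have hsub : ((badᶜ ×ˢ Finset.univ : Finset (Vertex n)) : Set (Vertex n)) ⊆
      ((gridMinus Y).connectedComponentMk (c, b)).supp := by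
    rintro ⟨a, b'⟩ h
    rw [Finset.coe_product, Set.mem_prod] at h
    rw [SimpleGraph.ConnectedComponent.mem_supp_iff, SimpleGraph.ConnectedComponent.eq]
    exact hall a (by simpa using h.1) c hcb _ _
  have hcard := Set.ncard_le_ncard hsub (Set.toFinite _)
  rw [Set.ncard_coe_finset, Finset.card_product, Finset.card_compl, Finset.card_univ, ZMod.card] at hcard
  show Nat.card (Vertex n) < _
  rw [Nat.card_prod, Nat.card_zmod]
  have h1 : n < 2 * (n - bad.card) := by omega
  nlinarith

/-! ### Semantics of restricted trees -/

/-- `x` satisfies all literals of `C`. -/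
def Sat {E : Type*} (x : E → ZMod 2) (C : List (E × ZMod 2)) : Prop := ∀ l ∈ C, x l.1 = l.2

lemma sat_cons {E : Type*} {x : E → ZMod 2} {e : E} {b : ZMod 2} {C : List (E × ZMod 2)} :
    Sat x ((e, b) :: C) ↔ x e = b ∧ Sat x C := by
  simp [Sat]

/-- A value known from the closure is forced in every solution with root `w`, and an unknown
variable is not a bridge, so either answer keeps the support independent. The set `Y` collects all
edges concerned, so that one root serves the whole tree. -/
lemma hasOneLeaf_prune_tree_iff (hn : 3 ≤ n) (hodd : Odd n) {w : Vertex n} {Y : Set (Edge n)}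
    (hw : Good w Y) (C : Term n) (hC : ∀ l ∈ C, l.1 ∈ Y) (β : Restriction n) (hβ : Indep β)
    (hY : β.supp ⊆ Y) :
    (prune (Term.tree C) β).HasOneLeaf ↔ ∃ x, IsSol w x ∧ Ext x β ∧ Sat x C := by
  induction C generalizing β with
  | nil =>
    obtain ⟨x, h1, h2⟩ := exists_isSol hn hodd hβ w
    simp only [Term.tree, prune, DTree.HasOneLeaf, true_iff]
    exact ⟨x, h1, h2, by simp [Sat]⟩
  | cons l C ih =>
    obtain ⟨e, b⟩ := l
    have he : e ∈ Y := hC (e, b) (by simp)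
    have hC' : ∀ l ∈ C, l.1 ∈ Y := fun l hl => hC l (List.mem_cons_of_mem _ hl)
    simp_rw [sat_cons]
    cases hcl : closure β e with
    | some v =>
      have hv : ∀ x, IsSol w x → Ext x β → x e = v := fun x hx hxβ =>
        closure_eq_of_some hn (hw.mono (Set.insert_subset he hY)) hx hxβ hcl
      by_cases hvb : v = b
      · subst hvb
        have h1 : prune (Term.tree ((e, v) :: C)) β = prune (Term.tree C) β := by
          rcases zmod_two_cases v with rfl | rfl <;> simp [Term.tree, prune, hcl]
        rw [h1, ih hC' β hβ hY]
        constructor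
        · rintro ⟨x, h1, h2, h3⟩; exact ⟨x, h1, h2, hv x h1 h2, h3⟩
        · rintro ⟨x, h1, h2, -, h3⟩; exact ⟨x, h1, h2, h3⟩
      · have h1 : prune (Term.tree ((e, b) :: C)) β = .leaf false := by
          rcases zmod_two_cases v with rfl | rfl <;> rcases zmod_two_cases b with rfl | rfl <;>
            simp_all [Term.tree, prune]
        rw [h1]
        simp only [DTree.HasOneLeaf, Bool.false_eq_true, false_iff]
        rintro ⟨x, h1, h2, h3, -⟩
        exact hvb ((hv x h1 h2).symm.trans h3)
    | none =>
      have hne : β e = none := (closure_eq_none_iff.1 hcl).1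
      have h1 : (prune (Term.tree ((e, b) :: C)) β).HasOneLeaf ↔
          (prune (Term.tree C) (β.set e b)).HasOneLeaf := by
        rcases zmod_two_cases b with rfl | rfl <;>
            simp [Term.tree, prune, hcl, DTree.HasOneLeaf]
      rw [h1, ih hC' _ (hβ.set hn hcl b)
        (by rw [Restriction.supp_set]; exact Set.insert_subset he hY)]
      simp_rw [ext_set_iff hne]
      tauto

end Torus

end GridSwitching

/-! ### The first live term is responsible for each query of the canonical tree. -/

namespace GridSwitching

/-! ### Branches of decision trees -/

/-- The branch of `T` given by the queries and answers `l` leads to a node that queries `P`. -/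
def DTree.NodeAt {E L : Type} : DTree E L → List (E × ZMod 2) → E → Prop
  | .leaf _, _, _ => False
  | .node e _ _, [], P => e = P
  | .node e T₀ T₁, (e', b) :: l, P =>
    e = e' ∧ (b = 0 → T₀.NodeAt l P) ∧ (b = 1 → T₁.NodeAt l P)

lemma DTree.exists_branch_of_leftmostPath {E L : Type} (r : ℕ) (T : DTree E L) (η : List E)
    (h : T.leftmostPath r = some η) :
    ∃ l : List (E × ZMod 2), l.map Prod.fst = η ∧ l.length = r ∧
      ∀ i p, l[i]? = some p → T.NodeAt (l.take i) p.1 := by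
  induction r generalizing T η with
  | zero =>
    refine ⟨[], ?_, rfl, by simp⟩
    simp only [leftmostPath, Option.some.injEq] at h
    simp [← h]
  | succ r ih =>
    cases T with
    | leaf b => simp [leftmostPath] at h
    | node e T₀ T₁ =>
      have key : ∀ (b : ZMod 2) (η' : List E), (if b = 0 then T₀ else T₁).leftmostPath r = some η' →
          η = e :: η' → ∃ l : List (E × ZMod 2), l.map Prod.fst = η ∧ l.length = r + 1 ∧
      ∀ i p, l[i]? = some p → (DTree.node e T₀ T₁).NodeAt (l.take i) p.1 := by
        intro b η' h1 h2
        obtain ⟨l, hl1, hl2, hl3⟩ := ih _ _ h1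
        refine ⟨(e, b) :: l, by simp [hl1, h2], by simp [hl2], ?_⟩
        intro i p hp
        cases i with
        | zero => simp at hp; simp [NodeAt, ← hp]
        | succ i =>
          have := hl3 i p (by simpa using hp)
          simp only [List.take_succ_cons, NodeAt, true_and]
          constructor <;> rintro rfl <;> simpa using this
      cases h0 : leftmostPath r T₀ with
      | some η' =>
        simp only [leftmostPath, h0, Option.some.injEq] at h
        exact key 0 η' (by simpa using h0) h.symm
      | none =>
        cases h1 : leftmostPath r T₁ with
        | some η' =>
          simp only [leftmostPath, h0, h1, Option.some.injEq] at h
          exact key 1 η' (by simpa using h1) h.symm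
        | none => simp [leftmostPath, h0, h1] at h

section

variable {n : ℕ} [NeZero n]

/-- The restriction `β` extended by a list of answers. -/
noncomputable def Restriction.sets (β : Restriction n) (l : List (Edge n × ZMod 2)) :
    Restriction n :=
  l.foldl (fun γ p => γ.set p.1 p.2) β

lemma Restriction.sets_nil (β : Restriction n) : β.sets [] = β := rfl

lemma Restriction.sets_cons (β : Restriction n) (p : Edge n × ZMod 2) (l) :
    β.sets (p :: l) = (β.set p.1 p.2).sets l := rfl

lemma Restriction.sets_append (β : Restriction n) (l l' : List (Edge n × ZMod 2)) :
    β.sets (l ++ l') = (β.sets l).sets l' := List.foldl_append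

lemma Restriction.mem_supp_sets (β : Restriction n) (l : List (Edge n × ZMod 2)) (e : Edge n) :
    e ∈ (β.sets l).supp ↔ e ∈ β.supp ∨ e ∈ l.map Prod.fst := by
  induction l generalizing β with
  | nil => simp [Restriction.sets_nil]
  | cons p l ih =>
    rw [Restriction.sets_cons, ih, Restriction.supp_set, Set.mem_insert_iff, List.map_cons,
      List.mem_cons]
    tauto

/-- `β'` extends `β`. -/
def Sub (β β' : Restriction n) : Prop := ∀ e b, β e = some b → β' e = some b

lemma Sub.trans {β β' β'' : Restriction n} (h : Sub β β') (h' : Sub β' β'') : Sub β β'' :=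
  fun e b he => h' e b (h e b he)

lemma Sub.refl (β : Restriction n) : Sub β β := fun _ _ h => h

lemma Sub.supp {β β' : Restriction n} (h : Sub β β') : β.supp ⊆ β'.supp := by
  intro e he
  obtain ⟨b, hb⟩ := Option.ne_none_iff_exists'.1 he
  simp [Restriction.supp, h e b hb]

lemma Sub.ext {β β' : Restriction n} (h : Sub β β') {x : Edge n → ZMod 2} (hx : Ext x β') :
    Ext x β := fun e b he => hx e b (h e b he)

lemma sub_set {β : Restriction n} {e : Edge n} (he : β e = none) (b : ZMod 2) :
    Sub β (β.set e b) := by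
  intro f c hf
  have : f ≠ e := by rintro rfl; simp [he] at hf
  simpa [Restriction.set, this] using hf

/-- Some solution with root `w` extends `β` and satisfies `C`. -/
def Live (w : Vertex n) (β : Restriction n) (C : Term n) : Prop :=
  ∃ x, IsSol w x ∧ Ext x β ∧ Sat x C

/-- While the answers agree with `C`, the term stays live and the next query is one of its
variables. The first answer against `C` kills it, and the rest of the branch runs in `next`; this
splits `l` into `l₁` and `l₂`. -/
lemma nodeAt_attachAtZero (hn : 3 ≤ n) {w : Vertex n} {Y : Set (Edge n)} (hw : Good w Y)
    (next : Restriction n → DTree (Edge n) Bool) (C : Term n) (hC : ∀ l ∈ C, l.1 ∈ Y)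
    (γ : Restriction n) (l : List (Edge n × ZMod 2)) (P : Edge n) (hγ : Indep γ) (hY : γ.supp ⊆ Y)
    (hlive : Live w γ C)
    (hP : (attachAtZero next (prune (Term.tree C) γ) γ).NodeAt l P) :
    (Live w (γ.sets l) C ∧ (∃ b, (P, b) ∈ C) ∧ closure (γ.sets l) P = none ∧ Indep (γ.sets l) ∧
        Sub γ (γ.sets l)) ∨
      ∃ l₁ l₂, l = l₁ ++ l₂ ∧ ¬ Live w (γ.sets l₁) C ∧ Indep (γ.sets l₁) ∧ Sub γ (γ.sets l₁) ∧
        (next (γ.sets l₁)).NodeAt l₂ P := by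
  induction C generalizing γ l with
  | nil => simp [Term.tree, prune, attachAtZero, DTree.NodeAt] at hP
  | cons lit C ih =>
    obtain ⟨e, b⟩ := lit
    have he : e ∈ Y := hC (e, b) (by simp)
    have hC' : ∀ l ∈ C, l.1 ∈ Y := fun l hl => hC l (List.mem_cons_of_mem _ hl)
    cases hcl : closure γ e with
    | some v =>
      have hv : ∀ x, IsSol w x → Ext x γ → x e = v := fun x hx hxβ =>
        closure_eq_of_some hn (hw.mono (Set.insert_subset he hY)) hx hxβ hcl
      obtain ⟨x, hx1, hx2, hx3⟩ := hlive
      rw [sat_cons] at hx3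
      have hvb : v = b := (hv x hx1 hx2).symm.trans hx3.1
      subst hvb
      have h1 : prune (Term.tree ((e, v) :: C)) γ = prune (Term.tree C) γ := by
        rcases zmod_two_cases v with rfl | rfl <;> simp [Term.tree, prune, hcl]
      have h2 : ∀ γ', Sub γ γ' → (Live w γ' ((e, v) :: C) ↔ Live w γ' C) := by
        intro γ' hs
        constructor
        · rintro ⟨x, a, b, c⟩; exact ⟨x, a, b, (sat_cons.1 c).2⟩
        · rintro ⟨x, a, b, c⟩; exact ⟨x, a, b, sat_cons.2 ⟨hv x a (hs.ext b), c⟩⟩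
      rw [h1] at hP
      rcases ih hC' γ l hγ hY ⟨x, hx1, hx2, hx3.2⟩ hP with
        ⟨a1, ⟨b', a2⟩, a3, a4, a5⟩ | ⟨l₁, l₂, a1, a2, a3, a4, a5⟩
      · exact .inl ⟨(h2 _ a5).2 a1, ⟨b', List.mem_cons_of_mem _ a2⟩, a3, a4, a5⟩
      · exact .inr ⟨l₁, l₂, a1, fun h => a2 ((h2 _ a4).1 h), a3, a4, a5⟩
    | none =>
      have hne : γ e = none := (closure_eq_none_iff.1 hcl).1
      have h1 : prune (Term.tree ((e, b) :: C)) γ =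
          .node e (if b = 0 then prune (Term.tree C) (γ.set e 0) else .leaf false)
            (if b = 0 then .leaf false else prune (Term.tree C) (γ.set e 1)) := by
        rcases zmod_two_cases b with rfl | rfl <;> simp [Term.tree, prune, hcl]
      rw [h1, attachAtZero] at hP
      cases l with
      | nil =>
        simp only [DTree.NodeAt] at hP
        subst hP
        exact .inl ⟨hlive, ⟨b, by simp⟩, hcl, hγ, Sub.refl _⟩
      | cons p l =>
        obtain ⟨e', b'⟩ := p
        simp only [DTree.NodeAt] at hP
        obtain ⟨rfl, hP0, hP1⟩ := hP
        by_cases hbb : b' = b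
        · subst hbb
          have hP' : (attachAtZero next (prune (Term.tree C) (γ.set e b')) (γ.set e b')).NodeAt l P := by
            rcases zmod_two_cases b' with rfl | rfl
            · simpa using hP0 rfl
            · simpa using hP1 rfl
          have h2 : ∀ γ', Sub (γ.set e b') γ' → (Live w γ' ((e, b') :: C) ↔ Live w γ' C) := by
            intro γ' hs
            constructor
            · rintro ⟨x, a, b, c⟩; exact ⟨x, a, b, (sat_cons.1 c).2⟩
            · rintro ⟨x, a, b, c⟩
              exact ⟨x, a, b, sat_cons.2 ⟨((ext_set_iff hne b').1 (hs.ext b)).2, c⟩⟩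
          obtain ⟨x, hx1, hx2, hx3⟩ := hlive
          rw [sat_cons] at hx3
          rcases ih hC' (γ.set e b') l (hγ.set hn hcl b')
            (by rw [Restriction.supp_set]; exact Set.insert_subset he hY)
            ⟨x, hx1, (ext_set_iff hne b').2 ⟨hx2, hx3.1⟩, hx3.2⟩ hP' with
            ⟨a1, ⟨b'', a2⟩, a3, a4, a5⟩ | ⟨l₁, l₂, a1, a2, a3, a4, a5⟩
          · exact .inl ⟨(h2 _ a5).2 a1, ⟨b'', List.mem_cons_of_mem _ a2⟩, a3, a4,
              (sub_set hne b').trans a5⟩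
          · exact .inr ⟨(e, b') :: l₁, l₂, by rw [a1]; rfl, fun h => a2 ((h2 _ a4).1 h), a3,
              (sub_set hne b').trans a4, a5⟩
        · refine .inr ⟨[(e, b')], l, rfl, ?_, hγ.set hn hcl b', sub_set hne b', ?_⟩
          · rintro ⟨x, _, a2, a3⟩
            have := ((ext_set_iff hne b').1 a2).2
            exact hbb (this.symm.trans (sat_cons.1 a3).1)
          · show (next (γ.set e b')).NodeAt l P
            rcases zmod_two_cases b' with rfl | rfl
            · have : b ≠ 0 := fun h => hbb h.symm
              simpa [this, attachAtZero] using hP0 rfl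
            · have : b = 0 := by
                rcases zmod_two_cases b with h | h
                · exact h
                · exact absurd h.symm hbb
              simpa [this, attachAtZero] using hP1 rfl

end

/-! ### Substitutions and live terms -/

section

variable {N m : ℕ}

/-- The value of a large edge under a substitution and an assignment to the small edges. -/
def Subst.val (σ : Subst N m) (x : Edge m → ZMod 2) (e : Edge N) : ZMod 2 :=
  match σ e with
  | .inl v => v
  | .inr (P, d) => x P + d

lemma Term.subst_eq_none {σ : Subst N m} {D : Term N} (h : Term.subst σ D = none)
    (x : Edge m → ZMod 2) : ¬ Sat (σ.val x) D := by
  induction D with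
  | nil => simp [Term.subst] at h
  | cons l D ih =>
    obtain ⟨e, b⟩ := l
    rw [sat_cons]
    cases hσ : σ e with
    | inl v =>
      by_cases hv : v = b
      · simp only [Term.subst, hσ, hv, if_true] at h
        exact fun hs => ih h hs.2
      · exact fun hs => hv (by simpa [Subst.val, hσ] using hs.1)
    | inr p =>
      cases hD : Term.subst σ D with
      | none => exact fun hs => ih hD hs.2
      | some D' => simp [Term.subst, hσ, hD] at h

lemma Term.sat_subst {σ : Subst N m} {D : Term N} {D' : Term m} (h : Term.subst σ D = some D')
    (x : Edge m → ZMod 2) : Sat (σ.val x) D ↔ Sat x D' := by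
  induction D generalizing D' with
  | nil => simp only [Term.subst, Option.some.injEq] at h; subst h; simp [Sat]
  | cons l D ih =>
    obtain ⟨e, b⟩ := l
    rw [sat_cons]
    cases hσ : σ e with
    | inl v =>
      by_cases hv : v = b
      · simp only [Term.subst, hσ, hv, if_true] at h
        rw [ih h]
        simp [Subst.val, hσ, hv]
      · simp [Term.subst, hσ, hv] at h
    | inr p =>
      obtain ⟨P, d⟩ := p
      cases hD : Term.subst σ D with
      | none => simp [Term.subst, hσ, hD] at h
      | some D'' =>
        simp only [Term.subst, hσ, hD, Option.some.injEq] at h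
        subst h
        rw [sat_cons, ih hD]
        simp [Subst.val, hσ, eq_sub_iff_add_eq]

lemma Term.exists_of_mem_subst {σ : Subst N m} {D : Term N} {D' : Term m}
    (h : Term.subst σ D = some D') {l : Literal m} (hl : l ∈ D') :
    ∃ e b d, (e, b) ∈ D ∧ σ e = .inr (l.1, d) := by
  induction D generalizing D' with
  | nil => simp only [Term.subst, Option.some.injEq] at h; subst h; simp at hl
  | cons l' D ih =>
    obtain ⟨e, b⟩ := l'
    cases hσ : σ e with
    | inl v =>
      by_cases hv : v = b
      · simp only [Term.subst, hσ, hv, if_true] at h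
        obtain ⟨e', b', d, h1, h2⟩ := ih h hl
        exact ⟨e', b', d, List.mem_cons_of_mem _ h1, h2⟩
      · simp [Term.subst, hσ, hv] at h
    | inr p =>
      obtain ⟨P, d⟩ := p
      cases hD : Term.subst σ D with
      | none => simp [Term.subst, hσ, hD] at h
      | some D'' =>
        simp only [Term.subst, hσ, hD, Option.some.injEq] at h
        subst h
        rcases List.mem_cons.1 hl with rfl | hl
        · exact ⟨e, b, d, by simp, hσ⟩
        · obtain ⟨e', b', d, h1, h2⟩ := ih hD hl
          exact ⟨e', b', d, List.mem_cons_of_mem _ h1, h2⟩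

variable [NeZero m]

/-- The edges that own a variable of `D`. -/
def owners {E : Type*} (own : E → Edge m) (D : List (E × ZMod 2)) : Set (Edge m) :=
  {P | ∃ l ∈ D, own l.1 = P}

/-- The endpoints of the edges that own a variable of `D`. -/
def ownerEnds {E : Type*} (own : E → Edge m) (D : List (E × ZMod 2)) : Set (Vertex m) :=
  {v | ∃ l ∈ D, v ∈ (own l.1).ends}

/-- The solutions that extend `β`, with a root in the giant component and away from the edges
that own a variable of `D`. -/
def Cons {E : Type*} (own : E → Edge m) (D : List (E × ZMod 2)) (β : Restriction m) :
    Set (Edge m → ZMod 2) :=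
  {x | ∃ w, Good w (β.supp ∪ owners own D) ∧ (∀ l ∈ D, w ∉ (own l.1).ends) ∧
    IsSol w x ∧ Ext x β}

lemma Cons.anti {E : Type*} {own : E → Edge m} {D : List (E × ZMod 2)} {β β' : Restriction m}
    (h : Sub β β') : Cons own D β' ⊆ Cons own D β := by
  rintro x ⟨w, h1, h2, h3, h4⟩
  exact ⟨w, h1.mono (Set.union_subset_union_left _ h.supp), h2, h3, h.ext h4⟩

/-- The term `D` can be satisfied under `σ` by a solution that extends `β`. -/
def Alive (own : Edge N → Edge m) (σ : Subst N m) (D : Term N) (β : Restriction m) : Prop :=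
  ∃ x ∈ Cons own D β, Sat (σ.val x) D

/-- A dead term stays dead along the branch, so the terms that the canonical tree has passed never
become the first live one. -/
lemma Alive.anti {own : Edge N → Edge m} {σ : Subst N m} {D : Term N} {β β' : Restriction m}
    (h : Sub β β') (ha : Alive own σ D β') : Alive own σ D β := by
  obtain ⟨x, h1, h2⟩ := ha
  exact ⟨x, Cons.anti h h1, h2⟩

/-- A term after the substitution `σ` and the closure of `π`. -/
noncomputable def Term.process (σ : Subst N m) (π : Restriction m) (D : Term N) :
    Option (Term m) :=
  (Term.subst σ D).bind (Term.subst (closure π).toSubst)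

lemma exists_of_mem_process {σ : Subst N m} {π : Restriction m} {D : Term N} {C : Term m}
    (h : Term.process σ π D = some C) {l : Literal m} (hl : l ∈ C) :
    ∃ e b d, (e, b) ∈ D ∧ σ e = .inr (l.1, d) := by
  rw [Term.process, Option.bind_eq_some_iff] at h
  obtain ⟨D', h1, h2⟩ := h
  obtain ⟨e, b, d, h3, h4⟩ := Term.exists_of_mem_subst h2 hl
  have : e = l.1 := by
    unfold Restriction.toSubst at h4
    cases hc : closure π e with
    | some v => simp [hc] at h4
    | none => simp [hc] at h4; exact h4.1
  subst this
  exact Term.exists_of_mem_subst h1 (l := (l.1, b)) h3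

lemma val_toSubst_eq (hm : 3 ≤ m) {π : Restriction m} {w : Vertex m} {x : Edge m → ZMod 2}
    (hx : IsSol w x) (hxπ : Ext x π) {P : Edge m} (hw : Good w (insert P π.supp)) :
    Subst.val (closure π).toSubst x P = x P := by
  unfold Subst.val Restriction.toSubst
  cases hc : closure π P with
  | some v => simp [closure_eq_of_some hm hw hx hxπ hc]
  | none => simp

/-- For a solution with a good root, a term and its processed form have the same value. -/
lemma sat_process (hm : 3 ≤ m) {own : Edge N → Edge m} {σ : Subst N m}
    (hσ : ∀ e P d, σ e = .inr (P, d) → own e = P) {π : Restriction m} {D : Term N}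
    {w : Vertex m} {Y : Set (Edge m)} (hw : Good w Y) (hπ : π.supp ⊆ Y)
    (hD : ∀ l ∈ D, own l.1 ∈ Y) {x : Edge m → ZMod 2} (hx : IsSol w x) (hxπ : Ext x π) :
    Sat (σ.val x) D ↔ ∃ C, Term.process σ π D = some C ∧ Sat x C := by
  cases h : Term.subst σ D with
  | none => simp [Term.subst_eq_none h, Term.process, h]
  | some D' =>
    rw [Term.sat_subst h]
    have h1 : Sat x D' ↔ Sat (Subst.val (closure π).toSubst x) D' := by
      have : ∀ l ∈ D', Subst.val (closure π).toSubst x l.1 = x l.1 := by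
        intro l hl
        obtain ⟨e, b, d, h3, h4⟩ := Term.exists_of_mem_subst h hl
        refine val_toSubst_eq hm hx hxπ (hw.mono (Set.insert_subset ?_ hπ))
        rw [← hσ e _ d h4]; exact hD _ h3
      exact forall₂_congr fun l hl => by rw [this l hl]
    rw [h1]
    cases h' : Term.subst (closure π).toSubst D' with
    | none => simp [Term.subst_eq_none h', Term.process, h, h']
    | some C => simp [Term.sat_subst h', Term.process, h, h']

lemma ncard_owners_le {E : Type*} (own : E → Edge m) (D : List (E × ZMod 2)) :
    (owners own D).ncard ≤ D.length := by
  classical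
  have : owners own D = ((D.map fun l => own l.1).toFinset : Set (Edge m)) := by
    ext P; simp [owners]
  rw [this, Set.ncard_coe_finset]
  exact (List.toFinset_card_le _).trans (by simp)

lemma ncard_ends_le {E : Type*} (own : E → Edge m) (D : List (E × ZMod 2)) :
    (ownerEnds own D).ncard ≤ 2 * D.length := by
  classical
  have : ownerEnds own D ⊆
      ((D.map fun l => (own l.1).1) ++ (D.map fun l => (own l.1).target)).toFinset := by
    rintro v ⟨l, hl, hv⟩
    rw [Edge.mem_ends] at hv
    simp only [List.coe_toFinset, List.mem_append, List.mem_map, Set.mem_ofPred_eq]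
    rcases hv with rfl | rfl
    · exact .inl ⟨l, hl, rfl⟩
    · exact .inr ⟨l, hl, rfl⟩
  refine (Set.ncard_le_ncard this (Set.toFinite _)).trans ?_
  rw [Set.ncard_coe_finset]
  refine (List.toFinset_card_le _).trans ?_
  simp; omega

/-- `Alive` refers to the unprocessed term and to the owners of all its variables, which the decoder
knows without knowing the centers. The size bound leaves a giant component with a root outside the
at most `2 * k` ends of these owners. -/
lemma alive_iff (hm : 3 ≤ m) (hodd : Odd m) {own : Edge N → Edge m} {σ : Subst N m}
    (hσ : ∀ e P d, σ e = .inr (P, d) → own e = P) {k : ℕ} {D : Term N} (hD : D.length ≤ k)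
    {π β : Restriction m} (hπβ : Sub π β) (hβ : Indep β) (hsize : 2 * (β.supp.ncard + k) < m) :
    Alive own σ D β ↔ ∃ C, Term.process σ π D = some C ∧ (prune (Term.tree C) β).HasOneLeaf := by
  set Y : Set (Edge m) := β.supp ∪ owners own D with hY
  have hDY : ∀ l ∈ D, own l.1 ∈ Y := fun l hl => .inr ⟨l, hl, rfl⟩
  have hCY : ∀ C, Term.process σ π D = some C → ∀ l ∈ C, l.1 ∈ Y := by
    intro C hC l hl
    obtain ⟨e, b, d, h1, h2⟩ := exists_of_mem_process hC hl
    rw [← hσ _ _ _ h2]; exact hDY _ h1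
  constructor
  · rintro ⟨x, ⟨w, h1, h2, h3, h4⟩, h5⟩
    rw [sat_process hm hσ h1 (hπβ.supp.trans Set.subset_union_left) hDY h3 (hπβ.ext h4)] at h5
    obtain ⟨C, hC, hs⟩ := h5
    exact ⟨C, hC, (hasOneLeaf_prune_tree_iff hm hodd h1 C (hCY C hC) β hβ
      Set.subset_union_left).2 ⟨x, h3, h4, hs⟩⟩
  · rintro ⟨C, hC, hs⟩
    have h1 : 2 * Y.ncard < m := by
      have : Y.ncard ≤ _ := Set.ncard_union_le β.supp (owners own D)
      have := ncard_owners_le own D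
      omega
    obtain ⟨w, hwA, hw⟩ := exists_good Y h1 (ownerEnds own D)
      (by have := ncard_ends_le own D; omega)
    obtain ⟨x, h3, h4, h5⟩ := (hasOneLeaf_prune_tree_iff hm hodd hw C (hCY C hC) β hβ
      Set.subset_union_left).1 hs
    refine ⟨x, ⟨w, hw, fun l hl hwl => hwA ⟨l, hl, hwl⟩, h3, h4⟩, ?_⟩
    rw [sat_process hm hσ hw (hπβ.supp.trans Set.subset_union_left) hDY h3 (hπβ.ext h4)]
    exact ⟨C, hC, h5⟩

lemma ncard_supp_sets_le (β : Restriction m) (l : List (Edge m × ZMod 2)) :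
    (β.sets l).supp.ncard ≤ β.supp.ncard + l.length := by
  classical
  have : (β.sets l).supp = β.supp ∪ ((l.map Prod.fst).toFinset : Set (Edge m)) := by
    ext e; rw [Restriction.mem_supp_sets]; simp
  rw [this]
  refine (Set.ncard_union_le _ _).trans ?_
  rw [Set.ncard_coe_finset]
  have := List.toFinset_card_le (l.map Prod.fst)
  rw [List.length_map] at this
  omega

open Classical in
/-- The first live term of `F`. -/
noncomputable def firstAlive (own : Edge N → Edge m) (σ : Subst N m) (F : DNF N)
    (β : Restriction m) : Option (Term N) :=
  F.find? fun D => decide (Alive own σ D β)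

/-- A query of the canonical decision tree is caused by the first live term. -/
lemma nodeAt_cdtFrom (hm : 3 ≤ m) (hodd : Odd m) {own : Edge N → Edge m} {σ : Subst N m}
    (hσ : ∀ e P d, σ e = .inr (P, d) → own e = P) {k : ℕ} (F : DNF N) (hF : F.IsWidth k)
    {π : Restriction m} (β : Restriction m) (hπβ : Sub π β) (hβ : Indep β)
    (l : List (Edge m × ZMod 2)) (P : Edge m) (hsize : 2 * (β.supp.ncard + l.length + k) < m)
    (hP : (cdtFrom (F.filterMap (Term.process σ π)) β).NodeAt l P) :
    Sub β (β.sets l) ∧ Indep (β.sets l) ∧ closure (β.sets l) P = none ∧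
      ∃ D, firstAlive own σ F (β.sets l) = some D ∧ ∃ e b d, (e, b) ∈ D ∧ σ e = .inr (P, d) := by
  induction F generalizing β l with
  | nil => simp [cdtFrom, DTree.NodeAt] at hP
  | cons D F ih =>
    have hDk : D.length ≤ k := hF D (by simp)
    have hF' : DNF.IsWidth k F := fun C hC => hF C (List.mem_cons_of_mem _ hC)
    have hdead : ∀ β' : Restriction m, ¬ Alive own σ D β' →
        firstAlive own σ (D :: F) β' = firstAlive own σ F β' := by
      intro β' h; simp [firstAlive, h]
    cases hC : Term.process σ π D with
    | none =>
      rw [List.filterMap_cons_none hC] at hP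
      obtain ⟨h1, h2, h3, h4⟩ := ih hF' β hπβ hβ l hsize hP
      refine ⟨h1, h2, h3, ?_⟩
      rw [hdead]
      · exact h4
      · rw [alive_iff hm hodd hσ hDk (hπβ.trans h1) h2
          (by have := ncard_supp_sets_le β l; omega)]
        simp [hC]
    | some C =>
      rw [List.filterMap_cons_some hC, cdtFrom] at hP
      have halive : ∀ β', Sub β β' → Indep β' → 2 * (β'.supp.ncard + k) < m →
          (Alive own σ D β' ↔ (prune (Term.tree C) β').HasOneLeaf) := by
        intro β' h1 h2 h3
        rw [alive_iff hm hodd hσ hDk (hπβ.trans h1) h2 h3]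
        simp [hC]
      split_ifs at hP with hone
      · set Y : Set (Edge m) := (β.sets l).supp ∪ owners own D with hY
        have hCY : ∀ l ∈ C, l.1 ∈ Y := by
          intro l hl
          obtain ⟨e, b, d, h1, h2⟩ := exists_of_mem_process hC hl
          rw [← hσ _ _ _ h2]; exact .inr ⟨_, h1, rfl⟩
        have h1 : 2 * Y.ncard < m := by
          have : Y.ncard ≤ _ := Set.ncard_union_le (β.sets l).supp (owners own D)
          have := ncard_owners_le own D
          have := ncard_supp_sets_le β l
          omega
        -- A single root for the whole branch: `Y` contains the final support, hence all earlier
        -- ones.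
        obtain ⟨w, -, hw⟩ := exists_good Y h1 ∅ (by simp; omega)
        have hβY : ∀ l₁ l₂, l = l₁ ++ l₂ → (β.sets l₁).supp ⊆ Y := by
          rintro l₁ l₂ rfl e he
          rw [Restriction.mem_supp_sets] at he
          refine .inl ?_
          rw [Restriction.mem_supp_sets, List.map_append, List.mem_append]
          tauto
        have hβY0 : β.supp ⊆ Y := hβY [] l rfl
        have hlive := fun β' => hasOneLeaf_prune_tree_iff hm hodd hw C hCY β'
        rcases nodeAt_attachAtZero hm hw _ C hCY β l P hβ hβY0 ((hlive β hβ hβY0).1 hone) hP with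
          ⟨a1, ⟨b, a2⟩, a3, a4, a5⟩ | ⟨l₁, l₂, rfl, a2, a3, a4, a5⟩
        · refine ⟨a5, a4, a3, D, ?_, ?_⟩
          · have : Alive own σ D (β.sets l) := by
              rw [halive _ a5 a4 (by have := ncard_supp_sets_le β l; omega)]
              exact (hlive _ a4 (hβY l [] (by simp))).2 a1
            simp [firstAlive, this]
          · exact exists_of_mem_process hC a2
        · have hs := ncard_supp_sets_le β l₁
          rw [List.length_append] at hsize
          obtain ⟨c1, c2, c3, c4⟩ := ih hF' (β.sets l₁) (hπβ.trans a4) a3 l₂ (by omega) a5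
          rw [Restriction.sets_append]
          refine ⟨a4.trans c1, c2, c3, ?_⟩
          rw [hdead]
          · exact c4
          -- If the term were live at the end of the branch, it would have been live at the moment
          -- when `l₁` killed it.
          · intro ha
            have := ha.anti c1
            rw [halive _ a4 a3 (by omega)] at this
            exact a2 ((hlive _ a3 (hβY l₁ l₂ rfl)).1 this)
      · obtain ⟨h1, h2, h3, h4⟩ := ih hF' β hπβ hβ l hsize hP
        refine ⟨h1, h2, h3, ?_⟩
        rw [hdead]
        · exact h4
        · intro ha
          have := ha.anti h1
          rw [halive _ (Sub.refl β) hβ (by omega)] at this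
          exact hone this

lemma not_nodeAt_cdtFrom_one (π : Restriction m) (l : List (Edge m × ZMod 2)) (P : Edge m) :
    ¬ (cdtFrom [[]] π).NodeAt l P := by
  simp [cdtFrom, Term.tree, prune, DTree.HasOneLeaf, attachAtZero, DTree.NodeAt]

lemma nodeAt_cdt (hm : 3 ≤ m) (hodd : Odd m) {own : Edge N → Edge m} {σ : Subst N m}
    (hσ : ∀ e P d, σ e = .inr (P, d) → own e = P) {k : ℕ} (F : DNF N) (hF : F.IsWidth k)
    (π : Restriction m) (hπ : Indep π) (l : List (Edge m × ZMod 2)) (P : Edge m)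
    (hsize : 2 * (π.supp.ncard + l.length + k) < m) (hP : (cdt (F.subst σ) π).NodeAt l P) :
    Indep (π.sets l) ∧ closure (π.sets l) P = none ∧
      ∃ D, firstAlive own σ F (π.sets l) = some D ∧ ∃ e b d, (e, b) ∈ D ∧ σ e = .inr (P, d) := by
  rw [cdt] at hP
  have hone : DNF.subst (closure π).toSubst [[]] = [[]] := by simp [DNF.subst, Term.subst]
  -- A formula that has become `1`, under `σ` or under the closure of `π`, has a canonical tree
  -- without queries.
  by_cases h1 : [] ∈ F.filterMap (Term.subst σ)
  · rw [DNF.subst.eq_def σ, if_pos h1, hone] at hP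
    exact absurd hP (not_nodeAt_cdtFrom_one π l P)
  · rw [DNF.subst.eq_def σ, if_neg h1, DNF.subst] at hP
    split_ifs at hP with h2
    · exact absurd hP (not_nodeAt_cdtFrom_one π l P)
    · rw [List.filterMap_filterMap] at hP
      exact (nodeAt_cdtFrom hm hodd hσ F hF π (Sub.refl π) hπ l P hsize hP).2

end

end GridSwitching

/-! ### From depth of the common tree to a sequence of queries with two answers each. -/

namespace GridSwitching

/-! ### The trace of a deep branch of the common tree -/

section

variable {N m : ℕ} [NeZero m]

/-- A query of the common tree: its variable, the answer in the canonical decision tree of the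
current formula, and the answer in the common tree. -/
abbrev Query (m : ℕ) : Type := Edge m × ZMod 2 × ZMod 2

/-- The restriction after the queries `h`: the answers of the common tree on the completed rounds
of `ℓ + 1` queries, the answers of the canonical decision tree on the current round. -/
noncomputable def roundState (ℓ : ℕ) (β : Restriction m) (h : List (Query m)) : Restriction m :=
  (β.sets ((h.take (h.length / (ℓ + 1) * (ℓ + 1))).map fun q => (q.1, q.2.2))).sets
    ((h.drop (h.length / (ℓ + 1) * (ℓ + 1))).map fun q => (q.1, q.2.1))

lemma roundState_of_lt {ℓ : ℕ} (β : Restriction m) {h : List (Query m)} (hl : h.length < ℓ + 1) :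
    roundState ℓ β h = β.sets (h.map fun q => (q.1, q.2.1)) := by
  simp [roundState, Nat.div_eq_of_lt hl, Restriction.sets_nil]

lemma roundState_append {ℓ : ℕ} (β : Restriction m) {h h' : List (Query m)}
    (hl : h.length = ℓ + 1) :
    roundState ℓ β (h ++ h') = roundState ℓ (β.sets (h.map fun q => (q.1, q.2.2))) h' := by
  have h1 : (h ++ h').length / (ℓ + 1) * (ℓ + 1) = h.length + h'.length / (ℓ + 1) * (ℓ + 1) := by
    rw [List.length_append, hl, Nat.add_div_left _ (Nat.succ_pos ℓ)]; ring
  rw [roundState, h1, List.take_length_add_append, List.drop_length_add_append, List.map_append,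
    Restriction.sets_append, roundState]

lemma mem_supp_roundState (ℓ : ℕ) (β : Restriction m) (h : List (Query m)) (P : Edge m) :
    P ∈ (roundState ℓ β h).supp ↔ P ∈ β.supp ∨ P ∈ h.map Prod.fst := by
  rw [roundState, Restriction.mem_supp_sets, Restriction.mem_supp_sets]
  conv_rhs => rw [← List.take_append_drop (h.length / (ℓ + 1) * (ℓ + 1)) h, List.map_append,
    List.mem_append]
  simp only [List.map_map, Function.comp_def, or_assoc]

lemma le_depth_queryAll (next : Restriction m → DTree (Edge m) Unit) (η : List (Edge m))
    (π : Restriction m) (t : ℕ) (h : t ≤ (queryAll next η π).depth) :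
    t ≤ η.length ∨ ∃ as : List (ZMod 2), as.length = η.length ∧
      t ≤ (next (π.sets (η.zip as))).depth + η.length := by
  induction η generalizing π t with
  | nil => exact .inr ⟨[], rfl, by simpa [queryAll, Restriction.sets_nil] using h⟩
  | cons e η ih =>
    have key : ∀ b : ZMod 2, t - 1 ≤ (queryAll next η (π.set e b)).depth →
        t ≤ (e :: η).length ∨ ∃ as : List (ZMod 2), as.length = (e :: η).length ∧
          t ≤ (next (π.sets ((e :: η).zip as))).depth + (e :: η).length := by
      intro b hb
      rcases ih _ _ hb with h1 | ⟨as, h1, h2⟩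
      · left; simp; omega
      · refine .inr ⟨b :: as, by simp [h1], ?_⟩
        rw [List.zip_cons_cons, Restriction.sets_cons]
        simp; omega
    simp only [queryAll, DTree.depth] at h
    rcases le_total (queryAll next η (π.set e 0)).depth (queryAll next η (π.set e 1)).depth with h' | h'
    · exact key 1 (by rw [max_eq_right h'] at h; omega)
    · exact key 0 (by rw [max_eq_left h'] at h; omega)

lemma Indep.of_supp_eq {β β' : Restriction m} (h : Indep β) (hs : β.supp = β'.supp) : Indep β' := by
  rwa [Indep, ← hs]

/-- The queries `h` and the formula of each round are consistent with the first live terms. -/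
def IsTrace (ℓ : ℕ) (own : Edge N → Edge m) (σ : Subst N m) {s : ℕ} (F : Fin s → DNF N)
    (β : Restriction m) (h : List (Query m)) (fi : ℕ → Fin s) : Prop :=
  ∀ u q, h[u]? = some q → q.1 ∉ (roundState ℓ β (h.take u)).supp ∧
    ∃ D, firstAlive own σ (F (fi (u / (ℓ + 1)))) (roundState ℓ β (h.take u)) = some D ∧
      ∃ e b d, (e, b) ∈ D ∧ σ e = .inr (q.1, d)

/-- Inside a round the states follow the leftmost path of the canonical tree, where the first live
terms are visible; at the end of a round they switch to the answers of the common tree. The same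
formula then stays at the head of the list. -/
lemma exists_isTrace (hm : 3 ≤ m) (hodd : Odd m) {own : Edge N → Edge m} {σ : Subst N m}
    (hσ : ∀ e P d, σ e = .inr (P, d) → own e = P) {k s : ℕ} (ℓ : ℕ) (F : Fin s → DNF N)
    (hF : ∀ i, (F i).IsWidth k) (i₀ : Fin s) (r : ℕ) (is : List (Fin s)) (β : Restriction m)
    (hβ : Indep β) (t : ℕ) (hsize : 2 * (β.supp.ncard + t + k) < m)
    (ht : t ≤ (ccdtAux ℓ r (is.map fun i => (F i).subst σ) β).depth) :
    ∃ (h : List (Query m)) (fi : ℕ → Fin s), h.length = t ∧ IsTrace ℓ own σ F β h fi := by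
  induction r generalizing is β t with
  | zero =>
    simp only [ccdtAux, DTree.depth, nonpos_iff_eq_zero] at ht
    exact ⟨[], fun _ => i₀, ht.symm, by simp [IsTrace]⟩
  | succ r ih =>
    cases is with
    | nil =>
      simp only [ccdtAux, List.map_nil, DTree.depth, nonpos_iff_eq_zero] at ht
      exact ⟨[], fun _ => i₀, ht.symm, by simp [IsTrace]⟩
    | cons i is =>
      rw [List.map_cons] at ht
      cases hη : (cdt ((F i).subst σ) β).leftmostPath (ℓ + 1) with
      | none =>
        simp only [ccdtAux, hη] at ht
        exact ih is β hβ t hsize ht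
      | some η =>
        simp only [ccdtAux, hη] at ht
        obtain ⟨l, hl1, hl2, hl3⟩ := DTree.exists_branch_of_leftmostPath _ _ _ hη
        have hQ : ∀ (u : ℕ) (p : Edge m × ZMod 2), u < t → l[u]? = some p →
            Indep (β.sets (l.take u)) ∧ closure (β.sets (l.take u)) p.1 = none ∧
              ∃ D, firstAlive own σ (F i) (β.sets (l.take u)) = some D ∧
                ∃ e b d, (e, b) ∈ D ∧ σ e = .inr (p.1, d) := by
          intro u p hu hp
          refine nodeAt_cdt hm hodd hσ (F i) (hF i) β hβ _ _ ?_ (hl3 u p hp)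
          rw [List.length_take]; omega
        -- the first round
        have hround : ∀ (h₁ : List (Query m)), h₁.map (fun q => (q.1, q.2.1)) = l →
            ∀ u q, u < t → h₁[u]? = some q → q.1 ∉ (roundState ℓ β (h₁.take u)).supp ∧
              ∃ D, firstAlive own σ (F i) (roundState ℓ β (h₁.take u)) = some D ∧
                ∃ e b d, (e, b) ∈ D ∧ σ e = .inr (q.1, d) := by
          intro h₁ hh u q hu hq
          have hlen : h₁.length = ℓ + 1 := by rw [← hl2, ← hh, List.length_map]
          have hu' : u < ℓ + 1 := hlen ▸ (List.getElem?_eq_some_iff.1 hq).1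
          have hp : l[u]? = some (q.1, q.2.1) := by rw [← hh, List.getElem?_map, hq]; rfl
          obtain ⟨h1, h2, h3⟩ := hQ u _ hu hp
          have : roundState ℓ β (h₁.take u) = β.sets (l.take u) := by
            rw [roundState_of_lt _ (by rw [List.length_take]; omega), List.map_take, hh]
          rw [this]
          refine ⟨?_, h3⟩
          have := (closure_eq_none_iff.1 h2).1
          simp [Restriction.supp, this]
        have hηlen : η.length = ℓ + 1 := by rw [← hl1, List.length_map, hl2]
        -- If one round is enough, an initial piece of the canonical path is the whole trace; the
        -- answers of the common tree are never read, so `0` stands for them.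
        have hshort : t ≤ ℓ + 1 → ∃ (h : List (Query m)) (fi : ℕ → Fin s), h.length = t ∧
            IsTrace ℓ own σ F β h fi := by
          intro htl
          refine ⟨(l.map fun p => (p.1, p.2, 0)).take t, fun _ => i, ?_, ?_⟩
          · rw [List.length_take, List.length_map, hl2]; omega
          · intro u q hq
            have hu : u < t := by
              have := (List.getElem?_eq_some_iff.1 hq).1
              rw [List.length_take] at this; omega
            rw [List.take_take, min_eq_left hu.le]
            refine hround _ (by simp [Function.comp_def]) u q hu ?_
            rwa [List.getElem?_take_of_lt hu] at hq
        by_cases htl : t ≤ ℓ + 1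
        · exact hshort htl
        rcases le_depth_queryAll _ _ _ _ ht with h1 | ⟨as, has, hd⟩
        · exact hshort (by omega)
        set h₁ : List (Query m) := List.zipWith (fun p a => (p.1, p.2, a)) l as with hh₁
        have hlen₁ : h₁.length = ℓ + 1 := by simp [hh₁, hl2, has, hηlen]
        have hz : h₁.map (fun q => (q.1, q.2.1)) = l := by
          rw [hh₁, List.map_zipWith]
          have := List.map_fst_zip (l₁ := l) (l₂ := as) (by omega)
          rwa [List.zip, List.map_zipWith] at this
        have hp : h₁.map (fun q => (q.1, q.2.2)) = η.zip as := by
          rw [hh₁, List.map_zipWith, ← hl1, List.zip_map_left, List.map_zip_eq_zipWith]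
          rfl
        rw [← hp] at hd
        -- Independence depends only on the support, so it passes from the answers of the canonical
        -- tree to those of the common tree.
        have hsupp : (β.sets (h₁.map fun q => (q.1, q.2.2))).supp = (β.sets l).supp := by
          ext e
          rw [Restriction.mem_supp_sets, Restriction.mem_supp_sets, ← hz]
          simp only [List.map_map, Function.comp_def]
        have hind : Indep (β.sets l) := by
          have hget : l[ℓ]? = some l[ℓ] := List.getElem?_eq_getElem _
          obtain ⟨c1, c2, -⟩ := hQ ℓ _ (by omega) hget
          have := c1.set hm c2 (l[ℓ]).2
          have hl' : l = l.take ℓ ++ [l[ℓ]] := by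
            have := List.take_append_getElem (l := l) (i := ℓ) (by omega)
            rw [this, List.take_of_length_le (by omega)]
          rw [hl', Restriction.sets_append]
          exact this
        have hcard := ncard_supp_sets_le β l
        obtain ⟨h', fi, hlen', htr⟩ := ih (i :: is) (β.sets (h₁.map fun q => (q.1, q.2.2)))
          (hind.of_supp_eq hsupp.symm) (t - (ℓ + 1)) (by rw [hsupp]; omega)
          (by simp only [List.map_cons]; omega)
        -- Round `0` belongs to the formula `i`; the rounds of the recursive trace move up by one.
        refine ⟨h₁ ++ h', fun j => if j = 0 then i else fi (j - 1), ?_, ?_⟩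
        · rw [List.length_append]; omega
        · intro u q hq
          by_cases hu : u < ℓ + 1
          · rw [List.getElem?_append_left (by omega)] at hq
            rw [List.take_append_of_le_length (by omega), Nat.div_eq_of_lt hu]
            exact hround h₁ hz u q (by omega) hq
          · obtain ⟨u', rfl⟩ := Nat.exists_eq_add_of_le (not_lt.1 hu)
            rw [List.getElem?_append_right (by omega), hlen₁, Nat.add_sub_cancel_left] at hq
            have h2 := htr u' q hq
            have h3 : (ℓ + 1 + u') / (ℓ + 1) = u' / (ℓ + 1) + 1 := by
              rw [Nat.add_div_left _ (Nat.succ_pos ℓ)]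
            have h4 : (h₁ ++ h').take (ℓ + 1 + u') = h₁ ++ h'.take u' := by
              rw [← hlen₁, List.take_length_add_append]
            rw [h3, h4, roundState_append _ hlen₁]
            exact h2

lemma supp_empty : (Restriction.empty m).supp = ∅ := by
  ext e; simp [Restriction.supp, Restriction.empty]

lemma indep_empty (hm : 3 ≤ m) : Indep (Restriction.empty m) := by
  obtain ⟨w, -, hw⟩ := exists_good (∅ : Set (Edge m)) (by simp; omega) ∅ (by simp; omega)
  rw [Indep, supp_empty, SimpleGraph.connected_iff_exists_forall_reachable]
  have hstep : ∀ e : Edge m, (gridMinus (∅ : Set (Edge m))).Reachable e.1 e.target := fun e =>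
    (gridMinus_adj_of_notMem hm (by simp)).reachable
  have hR : ∀ k : ℕ, ∀ a b : ZMod m, (gridMinus (∅ : Set (Edge m))).Reachable (a, b) (a + (k : ZMod m), b) := by
    intro k; induction k with
    | zero => intro a b; simp
    | succ k ih =>
      intro a b
      have := hstep ((a + (k : ZMod m), b), false)
      simp only [Edge.target_false] at this
      rw [Nat.cast_succ, ← add_assoc]; exact (ih a b).trans this
  have hC : ∀ k : ℕ, ∀ a b : ZMod m, (gridMinus (∅ : Set (Edge m))).Reachable (a, b) (a, b + (k : ZMod m)) := by
    intro k; induction k with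
    | zero => intro a b; simp
    | succ k ih =>
      intro a b
      have := hstep ((a, b + (k : ZMod m)), true)
      simp only [Edge.target_true] at this
      rw [Nat.cast_succ, ← add_assoc]; exact (ih a b).trans this
  refine ⟨(0, 0), fun ⟨a, b⟩ => ?_⟩
  have h1 := hR a.val 0 0
  have h2 := hC b.val a 0
  rw [ZMod.natCast_zmod_val, zero_add] at h1 h2
  exact h1.trans h2

lemma exists_isTrace_ccdt (hm : 3 ≤ m) (hodd : Odd m) {own : Edge N → Edge m} {σ : Subst N m}
    (hσ : ∀ e P d, σ e = .inr (P, d) → own e = P) {k s : ℕ} (ℓ : ℕ) (F : Fin s → DNF N)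
    (hF : ∀ i, (F i).IsWidth k) (i₀ : Fin s) (t : ℕ) (hsize : 2 * (t + k) < m)
    (ht : t ≤ (ccdt ℓ (List.ofFn fun i => (F i).subst σ)).depth) :
    ∃ (h : List (Query m)) (fi : ℕ → Fin s), h.length = t ∧
      IsTrace ℓ own σ F (Restriction.empty m) h fi := by
  refine exists_isTrace hm hodd hσ ℓ F hF i₀ (s + Fintype.card (Edge m)) (List.finRange s) _
    (indep_empty hm) t ?_ ?_
  · rw [supp_empty]; simpa using hsize
  · rw [ccdt, List.length_ofFn, List.ofFn_eq_map] at ht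
    exact ht

end

end GridSwitching

/-! ### Dyadic blocks of indices, the abstract decoder and its invariant. -/

namespace GridSwitching

/-! ### Bits of center indices -/

section Bits

variable {L o : ℕ}

/-- The index `i` lies in the window of length `2 ^ L` that starts at `o`. -/
def InWindow (L o i : ℕ) : Prop := o ≤ i ∧ i < o + 2 ^ L

/-- The offsets of `i` and `i'` have the same bits from position `j` on. -/
def SameAbove (o j i i' : ℕ) : Prop := ∀ d, j ≤ d → (i - o).testBit d = (i' - o).testBit d

lemma SameAbove.refl (o j i : ℕ) : SameAbove o j i i := fun _ _ => rfl

lemma SameAbove.symm {j i i' : ℕ} (h : SameAbove o j i i') : SameAbove o j i' i :=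
  fun d hd => (h d hd).symm

lemma SameAbove.trans {j i i' i'' : ℕ} (h : SameAbove o j i i') (h' : SameAbove o j i' i'') :
    SameAbove o j i i'' := fun d hd => (h d hd).trans (h' d hd)

lemma SameAbove.mono {j j' i i' : ℕ} (hj : j ≤ j') (h : SameAbove o j i i') : SameAbove o j' i i' :=
  fun d hd => h d (hj.trans hd)

/-- In this form it is clear that the indices of a window that agree from bit `j` on form an
interval. -/
lemma sameAbove_iff_div {j i i' : ℕ} :
    SameAbove o j i i' ↔ (i - o) / 2 ^ j = (i' - o) / 2 ^ j := by
  constructor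
  · intro h
    refine Nat.eq_of_testBit_eq fun d => ?_
    rw [Nat.testBit_div_two_pow, Nat.testBit_div_two_pow]
    exact h _ (by omega)
  · intro h d hd
    obtain ⟨d', rfl⟩ := Nat.exists_eq_add_of_le hd
    rw [add_comm, ← Nat.testBit_div_two_pow, ← Nat.testBit_div_two_pow, h]

lemma eq_of_sameAbove_zero {i i' : ℕ} (hi : InWindow L o i) (hi' : InWindow L o i')
    (h : SameAbove o 0 i i') : i = i' := by
  have := Nat.eq_of_testBit_eq fun d => h d (Nat.zero_le d)
  have := hi.1; have := hi'.1
  omega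

lemma InWindow.testBit {i d : ℕ} (hi : InWindow L o i) (hd : L ≤ d) : (i - o).testBit d = false := by
  refine Nat.testBit_lt_two_pow (lt_of_lt_of_le ?_ (Nat.pow_le_pow_right (by norm_num) hd))
  have := hi.1; have := hi.2
  omega

/-- The index in the window with the given bits. -/
def ofBitsAt (L o : ℕ) (f : ℕ → Bool) : ℕ := o + Nat.ofBits fun d : Fin L => f d

lemma inWindow_ofBitsAt (f : ℕ → Bool) : InWindow L o (ofBitsAt L o f) :=
  ⟨Nat.le_add_right _ _, Nat.add_lt_add_left (Nat.ofBits_lt_two_pow _) _⟩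

lemma testBit_ofBitsAt (f : ℕ → Bool) (d : ℕ) :
    (ofBitsAt L o f - o).testBit d = (decide (d < L) && f d) := by
  rw [ofBitsAt, Nat.add_sub_cancel_left]
  by_cases h : d < L
  · simp [Nat.testBit_ofBits_lt _ _ h, h]
  · simp [Nat.testBit_ofBits_ge _ _ (not_lt.1 h), h]

lemma ofBitsAt_congr {f g : ℕ → Bool} (h : ∀ d < L, f d = g d) : ofBitsAt L o f = ofBitsAt L o g := by
  rw [ofBitsAt, ofBitsAt]; congr 2; funext d; exact h d d.2

lemma ofBitsAt_testBit {i : ℕ} (hi : InWindow L o i) :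
    ofBitsAt L o (fun d => (i - o).testBit d) = i := by
  rw [ofBitsAt, Nat.ofBits_testBit, Nat.mod_eq_of_lt (by have := hi.1; have := hi.2; omega)]
  have := hi.1; omega

end Bits

/-! ### The encoding -/

/-- The data known to the decoder. `mem e i` says that the edge `e` lies on a live path when the
vertex `rv e` has the center with index `i`; `cons` are the consistent assignments after a
history, `fml u` is the formula of stage `u`, and `pv e` is the index where `mem e` changes. -/
structure Coding (V X E : Type) where
  L : ℕ
  o : ℕ
  t : ℕ
  own : E → X
  rv : E → Option V
  mem : E → ℕ → Prop
  pv : E → ℕ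
  base : E → ZMod 2
  ref : X → ZMod 2
  cons : List (E × ZMod 2) → List (X × ZMod 2 × ZMod 2) → Set (X → ZMod 2)
  fml : ℕ → List (List (E × ZMod 2))

namespace Coding

variable {V X E : Type} (S : Coding V X E)

/-- `mem e` is not constant on the block of `i` at height `j`. -/
def NC (e : E) (i j : ℕ) : Prop :=
  ∃ i' i'', InWindow S.L S.o i' ∧ InWindow S.L S.o i'' ∧ SameAbove S.o j i i' ∧
    SameAbove S.o j i i'' ∧ S.mem e i' ∧ ¬ S.mem e i''

open Classical in
/-- The value of `e` for the indices `c` and the assignment `x`. -/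
noncomputable def val (c : V → ℕ) (x : X → ZMod 2) (e : E) : ZMod 2 :=
  S.base e + if S.mem e (((S.rv e).map c).getD 0) then x (S.own e) + S.ref (S.own e) else 0

/-- `x` agrees with the reference assignment on all edges at `q`. -/
def Agree (x : X → ZMod 2) (q : V) : Prop := ∀ e, S.rv e = some q → x (S.own e) = S.ref (S.own e)

/-- The pivots determine the blocks on which `mem` changes. -/
def IsPivot : Prop :=
  ∀ e, (∀ i, InWindow S.L S.o i → (S.mem e i ↔ S.pv e ≤ i)) ∨
    (∀ i, InWindow S.L S.o i → S.mem e i → i = S.pv e)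

variable {S}

lemma NC.mono {e : E} {i j j' : ℕ} (hj : j ≤ j') (h : S.NC e i j) : S.NC e i j' := by
  obtain ⟨i', i'', h1, h2, h3, h4, h5⟩ := h
  exact ⟨i', i'', h1, h2, h3.mono hj, h4.mono hj, h5⟩

lemma NC.of_sameAbove {e : E} {i i₁ j : ℕ} (hs : SameAbove S.o j i₁ i) (h : S.NC e i j) :
    S.NC e i₁ j := by
  obtain ⟨i', i'', h1, h2, h3, h4, h5⟩ := h
  exact ⟨i', i'', h1, h2, hs.trans h3, hs.trans h4, h5⟩

lemma NC.ne_zero {e : E} {i j : ℕ} (h : S.NC e i j) : j ≠ 0 := by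
  rintro rfl
  obtain ⟨i', i'', h1, h2, h3, h4, h5, h6⟩ := h
  have := eq_of_sameAbove_zero h1 h2 (h3.symm.trans h4)
  subst this
  exact h6 h5

/-- A block is an interval, so a threshold or an isolated point that makes `mem e` vary inside the
block differs from the block's indices only in the bits below `j`. This is how the decoder learns
the high bits of an index from an edge alone. -/
lemma NC.sameAbove_pv (hS : S.IsPivot) {e : E} {i j : ℕ} (h : S.NC e i j) :
    SameAbove S.o j i (S.pv e) := by
  obtain ⟨i', i'', h1, h2, h3, h4, h5, h6⟩ := h
  rcases hS e with hp | hp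
  · have h7 := (hp i' h1).1 h5
    have h8 : i'' < S.pv e := not_le.1 fun h => h6 ((hp i'' h2).2 h)
    rw [sameAbove_iff_div] at h3 h4 ⊢
    apply le_antisymm
    · rw [h4]; exact Nat.div_le_div_right (by omega)
    · rw [h3]; exact Nat.div_le_div_right (by omega)
  · rw [← hp i' h1 h5]; exact h3

/-- The state of the decoder: the current indices, the marks and the history. -/
structure State (V X : Type) where
  ch : V → ℕ
  mrk : V → Option ℕ
  h : List (X × ZMod 2 × ZMod 2)

/-- One piece of advice. -/
abbrev Instr (k L : ℕ) : Type :=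
  (Bool × Fin k × ZMod 2 × ZMod 2 × (Fin k → Bool) × (Fin k → Bool)) ×
    ((Fin k → Fin (L + 1)) × (Fin k → Fin (L + 1)))

/-- The total size of the numbers in an instruction. -/
def Instr.cost {k L : ℕ} (I : Instr k L) : ℕ :=
  ∑ a, (I.2.1 a : ℕ) + ∑ a, (I.2.2 a : ℕ)

variable (S)

/-- The current indices satisfy `D` in some consistent way that respects the marks. -/
def Accepts (st : State V X) (D : List (E × ZMod 2)) : Prop :=
  ∃ x ∈ S.cons D st.h, Sat (S.val st.ch x) D ∧
    ∀ l ∈ D, ∀ q j, S.rv l.1 = some q → st.mrk q = some j → S.NC l.1 (st.ch q) j →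
      x (S.own l.1) = S.ref (S.own l.1)

open Classical in
/-- The first accepted term. -/
noncomputable def current (st : State V X) : Option (List (E × ZMod 2)) :=
  (S.fml st.h.length).find? fun D => decide (S.Accepts st D)

open Classical in
/-- The active literal of `D` that concerns `q`. -/
noncomputable def pick {k : ℕ} (D : List (E × ZMod 2)) (act : Fin k → Bool) (q : V) :
    Option (Fin k × E) :=
  if h : ∃ p : Fin k × E, act p.1 = true ∧ (D[(p.1 : ℕ)]?).map Prod.fst = some p.2 ∧
    S.rv p.2 = some q then some h.choose else none

/-- The index learned from the pivot of `e`, the bit `b` at position `d₀`, and the low bits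
of `i`. -/
def learn (i : ℕ) (e : E) (d₀ : ℕ) (b : Bool) : ℕ :=
  ofBitsAt S.L S.o fun d =>
    if d < d₀ then (i - S.o).testBit d else if d = d₀ then b else (S.pv e - S.o).testBit d

open Classical in
/-- The state after an instruction. -/
noncomputable def step {k : ℕ} (st : State V X) (I : Instr k S.L) : State V X :=
  if st.h.length < S.t then
    match S.current st with
    | none => st
    | some D =>
      match (D[(I.1.2.1 : ℕ)]?).map Prod.fst with
      | none => st
      | some e =>
        if I.1.1 then
          { ch := fun q =>
              match S.pick D I.1.2.2.2.2.1 q with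
              | none => st.ch q
              | some p => S.learn (st.ch q) p.2 ((st.mrk q).getD S.L - I.2.1 p.1)
                  (I.1.2.2.2.2.2 p.1)
            mrk := fun q =>
              match S.pick D I.1.2.2.2.2.1 q with
              | none => st.mrk q
              | some p => some ((st.mrk q).getD S.L - I.2.1 p.1 - I.2.2 p.1)
            h := st.h ++ [(S.own e, I.1.2.2.1, I.1.2.2.2.1)] }
        else
          match S.rv e with
          | none => st
          | some q => { st with mrk := Function.update st.mrk q (some (S.L - I.2.1 I.1.2.1)) }
  else st

/-- The term `D` can be satisfied for the indices `c` after the history `h`. -/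
def Satisfiable (c : V → ℕ) (h : List (X × ZMod 2 × ZMod 2)) (D : List (E × ZMod 2)) : Prop :=
  ∃ x ∈ S.cons D h, Sat (S.val c x) D

open Classical in
/-- The indices `c` have a trace with the queries `h`, terms `D` and witnesses `x`. -/
structure Run (c : V → ℕ) (R : Finset V) (h : List (X × ZMod 2 × ZMod 2))
    (D : ℕ → List (E × ZMod 2)) (x : ℕ → X → ZMod 2) : Prop where
  length : h.length = S.t
  first : ∀ u < S.t, ((S.fml u).find? fun D => decide (S.Satisfiable c (h.take u) D)) = some (D u)
  cons : ∀ u < S.t, x u ∈ S.cons (D u) (h.take u)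
  sat : ∀ u < S.t, Sat (S.val c (x u)) (D u)
  query : ∀ u < S.t, ∃ l ∈ D u, ∃ p, h[u]? = some (S.own l.1, p)
  window : ∀ q ∈ R, InWindow S.L S.o (c q)

/-- Bit `d` of the index of `q` matters for the term `D u`. -/
def Needed (c : V → ℕ) (D : ℕ → List (E × ZMod 2)) (q : V) (d u : ℕ) : Prop :=
  ∃ l ∈ D u, S.rv l.1 = some q ∧ S.NC l.1 (c q) (d + 1)

/-- Stage `u` is the first where bit `d` of the index of `q` matters. -/
def FirstAt (c : V → ℕ) (D : ℕ → List (E × ZMod 2)) (q : V) (d u : ℕ) : Prop :=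
  u < S.t ∧ S.Needed c D q d u ∧ ∀ u' < u, ¬ S.Needed c D q d u'

/-- Bit `d` of the index of `q` is gained at stage `u` or later. -/
def Pend (c : V → ℕ) (R : Finset V) (D : ℕ → List (E × ZMod 2)) (x : ℕ → X → ZMod 2) (u : ℕ)
    (q : V) (d : ℕ) : Prop :=
  q ∈ R ∧ d < S.L ∧ ∃ u', u ≤ u' ∧ S.FirstAt c D q d u' ∧ S.Agree (x u') q

open Classical in
/-- The indices with the bits gained at stage `u` or later replaced by those of `A`. -/
noncomputable def filled (c : V → ℕ) (R : Finset V) (D : ℕ → List (E × ZMod 2))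
    (x : ℕ → X → ZMod 2) (A : V → ℕ → Bool) (u : ℕ) (q : V) : ℕ :=
  if q ∈ R then
    ofBitsAt S.L S.o fun d => if S.Pend c R D x u q d then A q d else (c q - S.o).testBit d
  else c q

open Classical in
/-- A bound for the bits gained at stage `u` or later. -/
noncomputable def mark (c : V → ℕ) (R : Finset V) (D : ℕ → List (E × ZMod 2))
    (x : ℕ → X → ZMod 2) (u : ℕ) (q : V) : ℕ :=
  ((Finset.range S.L).filter fun d => S.Pend c R D x u q d).sup fun d => d + 1

variable {S} {c : V → ℕ} {R : Finset V} {h : List (X × ZMod 2 × ZMod 2)}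
  {D : ℕ → List (E × ZMod 2)} {x : ℕ → X → ZMod 2} {A : V → ℕ → Bool}

lemma Pend.lt_mark {u d : ℕ} {q : V} (hp : S.Pend c R D x u q d) : d + 1 ≤ S.mark c R D x u q := by
  classical
  exact Finset.le_sup (f := fun d => d + 1) (Finset.mem_filter.2 ⟨Finset.mem_range.2 hp.2.1, hp⟩)

lemma mark_le {u n : ℕ} {q : V} (hn : ∀ d, S.Pend c R D x u q d → d < n) :
    S.mark c R D x u q ≤ n := by
  classical
  exact Finset.sup_le fun d hd => hn d (Finset.mem_filter.1 hd).2

lemma mark_le_L (u : ℕ) (q : V) : S.mark c R D x u q ≤ S.L := mark_le fun _ h => h.2.1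

lemma mark_cases (u : ℕ) (q : V) : S.mark c R D x u q = 0 ∨
    ∃ d, S.Pend c R D x u q d ∧ S.mark c R D x u q = d + 1 := by
  classical
  classical
  rcases Finset.eq_empty_or_nonempty ((Finset.range S.L).filter fun d => S.Pend c R D x u q d) with
    h | h
  · left; rw [mark, h, Finset.sup_empty]; rfl
  · right
    obtain ⟨d, hd, h'⟩ := Finset.exists_mem_eq_sup _ h fun d => d + 1
    exact ⟨d, (Finset.mem_filter.1 hd).2, h'⟩

lemma inWindow_filled {u : ℕ} {q : V} (hq : q ∈ R) :
    InWindow S.L S.o (S.filled c R D x A u q) := by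
  rw [filled, if_pos hq]; exact inWindow_ofBitsAt _

open Classical in
lemma testBit_filled (hr : S.Run c R h D x) {u : ℕ} {q : V} (hq : q ∈ R) (d : ℕ) :
    (S.filled c R D x A u q - S.o).testBit d =
      if S.Pend c R D x u q d then A q d else (c q - S.o).testBit d := by
  rw [filled, if_pos hq, testBit_ofBitsAt]
  by_cases hd : d < S.L
  · simp [hd]
  · have : ¬ S.Pend c R D x u q d := fun h => hd h.2.1
    simp [hd, this, (hr.window q hq).testBit (not_lt.1 hd)]

lemma sameAbove_filled (hr : S.Run c R h D x) {u : ℕ} {q : V} (hq : q ∈ R) :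
    SameAbove S.o (S.mark c R D x u q) (S.filled c R D x A u q) (c q) := by
  intro d hd
  rw [testBit_filled hr hq, if_neg]
  intro hp
  have := hp.lt_mark
  omega

lemma filled_eq_of_forall (hr : S.Run c R h D x) {u : ℕ} {q : V}
    (hp : ∀ d, ¬ S.Pend c R D x u q d) : S.filled c R D x A u q = c q := by
  rw [filled]
  split_ifs with hq
  · simp only [hp, if_false]; exact ofBitsAt_testBit (hr.window q hq)
  · rfl

lemma filled_end (hr : S.Run c R h D x) : S.filled c R D x A S.t = c := by
  funext q
  refine filled_eq_of_forall hr ?_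
  rintro d ⟨-, -, u', h1, h2, -⟩
  exact absurd h2.1 (by omega)

/-- If `mem e` changes on the block that is still open, the witness agrees with the reference. -/
lemma agree_of_nc {u : ℕ} {q : V} {l : E × ZMod 2} (hl : l ∈ D u)
    (hlq : S.rv l.1 = some q) (hnc : S.NC l.1 (c q) (S.mark c R D x u q)) : S.Agree (x u) q := by
  rcases mark_cases (S := S) (c := c) (R := R) (D := D) (x := x) u q with h0 | ⟨d, hp, hd⟩
  · exact absurd h0 hnc.ne_zero
  · rw [hd] at hnc
    obtain ⟨-, -, u', h1, h2, h3⟩ := hp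
    have : u' = u := by
      refine le_antisymm (not_lt.1 fun hlt => h2.2.2 u hlt ⟨l, hl, hlq, hnc⟩) h1
    rwa [this] at h3

/-- The overwritten index and the true one lie in the same block of height `mark`. -/
lemma nc_of_mem_ne (hr : S.Run c R h D x) {u : ℕ} {q : V} (hq : q ∈ R) {e : E}
    (hne : ¬ (S.mem e (S.filled c R D x A u q) ↔ S.mem e (c q))) :
    S.NC e (c q) (S.mark c R D x u q) := by
  have h1 := sameAbove_filled (A := A) hr (u := u) hq
  have h2 := inWindow_filled (S := S) (c := c) (D := D) (x := x) (A := A) (u := u) hq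
  have h3 := hr.window q hq
  by_cases hm : S.mem e (c q)
  · exact ⟨_, _, h3, h2, SameAbove.refl _ _ _, h1.symm, hm, fun h => hne ⟨fun _ => hm, fun _ => h⟩⟩
  · refine ⟨_, _, h2, h3, h1.symm, SameAbove.refl _ _ _, ?_, hm⟩
    by_contra h
    exact hne ⟨fun h' => absurd h' h, fun h' => absurd h' hm⟩

/-- On a path the value contains `x + ref`, which vanishes where the two agree; then it does not
matter whether the edge is on the path. All freedom in the encoding comes from this. -/
lemma val_eq_of_agree {c c' : V → ℕ} {x : X → ZMod 2} {e : E}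
    (h : ∀ q, S.rv e = some q → ¬ (S.mem e (c q) ↔ S.mem e (c' q)) → x (S.own e) = S.ref (S.own e)) :
    S.val c x e = S.val c' x e := by
  rw [val, val]
  cases hq : S.rv e with
  | none => rfl
  | some q =>
    simp only [Option.map_some, Option.getD_some]
    by_cases hm : S.mem e (c q) ↔ S.mem e (c' q)
    · by_cases h1 : S.mem e (c q)
      · rw [if_pos h1, if_pos (hm.1 h1)]
      · rw [if_neg h1, if_neg fun h2 => h1 (hm.2 h2)]
    · rw [h q hq hm, CharTwo.add_self_eq_zero]; simp

/-- The state of the decoder at stage `u` when the vertices of `M` are marked. -/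
structure Inv (S : Coding V X E) (c : V → ℕ) (R : Finset V) (h : List (X × ZMod 2 × ZMod 2))
    (D : ℕ → List (E × ZMod 2)) (x : ℕ → X → ZMod 2) (A : V → ℕ → Bool) (u : ℕ) (M : Finset V)
    (st : State V X) : Prop where
  ch : st.ch = S.filled c R D x A u
  h : st.h = h.take u
  mk_mem : ∀ q ∈ M, st.mrk q = some (S.mark c R D x u q)
  mk_notMem : ∀ q ∉ M, st.mrk q = none
  sub : M ⊆ R

/-- Overwriting the open bits can change membership only for edges that vary on the block of height
`mark`, and for those `agree_of_nc` makes the true witness agree with the reference. The true term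
is therefore never rejected. -/
lemma Inv.accepts (hr : S.Run c R h D x) {u : ℕ} (hu : u < S.t) {M : Finset V} {st : State V X}
    (hi : Inv S c R h D x A u M st) : S.Accepts st (D u) := by
  refine ⟨x u, by rw [hi.h]; exact hr.cons u hu, ?_, ?_⟩
  · intro l hl
    rw [← hr.sat u hu l hl, hi.ch]
    refine val_eq_of_agree fun q hq hne => ?_
    by_cases hqR : q ∈ R
    · exact agree_of_nc hl hq (nc_of_mem_ne hr hqR hne) l.1 hq
    · rw [filled, if_neg hqR] at hne; exact absurd Iff.rfl hne
  · intro l hl q j hq hj hnc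
    by_cases hqM : q ∈ M
    · rw [hi.mk_mem q hqM, Option.some.injEq] at hj
      subst hj
      rw [hi.ch] at hnc
      exact agree_of_nc hl hq
        (hnc.of_sameAbove (sameAbove_filled hr (hi.sub hqM)).symm) l.1 hq
    · rw [hi.mk_notMem q hqM] at hj; simp at hj

/-- At a marked vertex the acceptance test demands agreement with the reference wherever the current
index and the true one could differ. If all relevant vertices are marked, the accepting witness
therefore also works for the true indices. -/
lemma Inv.satisfiable_of_accepts (hr : S.Run c R h D x) {u : ℕ} {M : Finset V}
    {st : State V X} (hi : Inv S c R h D x A u M st) {D' : List (E × ZMod 2)}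
    (ha : S.Accepts st D')
    (hD' : ∀ l ∈ D', ∀ q, S.rv l.1 = some q → q ∈ R → q ∈ M) :
    S.Satisfiable c (h.take u) D' := by
  obtain ⟨y, hy, hs, hm⟩ := ha
  rw [hi.h] at hy
  refine ⟨y, hy, fun l hl => ?_⟩
  rw [← hs l hl, hi.ch]
  refine val_eq_of_agree fun q hq hne => ?_
  by_cases hqR : q ∈ R
  · have hqM := hD' l hl q hq hqR
    refine hm l hl q _ hq (hi.mk_mem q hqM) ?_
    rw [hi.ch]
    refine (nc_of_mem_ne (A := A) (u := u) hr hqR fun h => hne h.symm).of_sameAbove ?_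
    exact sameAbove_filled hr hqR
  · rw [filled, if_neg hqR] at hne; exact absurd Iff.rfl hne

end Coding

/-- If the decoder's test `p'` admits the right term, then its first find is that term or one that
the true test `p` refuses. -/
lemma exists_find?_eq {α : Type*} {p p' : α → Bool} {xs : List α} {a : α}
    (h : xs.find? p = some a) (ha : p' a = true) :
    ∃ b, xs.find? p' = some b ∧ (b = a ∨ p b = false) := by
  induction xs with
  | nil => simp at h
  | cons y ys ih =>
    rw [List.find?_cons] at h
    cases hy : p' y with
    | true =>
      refine ⟨y, by simp [hy], ?_⟩
      cases hp : p y with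
      | true => rw [hp] at h; left; simpa using h
      | false => exact .inr rfl
    | false =>
      cases hp : p y with
      | true =>
        rw [hp] at h
        simp only [Option.some.injEq] at h
        subst h; rw [ha] at hy; simp at hy
      | false =>
        rw [hp] at h
        obtain ⟨b, hb⟩ := ih h
        exact ⟨b, by simpa [hy] using hb.1, hb.2⟩

end GridSwitching

/-! ### Writing the advice: one instruction at a time, paid from a potential. -/

namespace GridSwitching

namespace Coding

variable {V X E : Type} {S : Coding V X E} {c : V → ℕ} {R : Finset V}
  {h : List (X × ZMod 2 × ZMod 2)} {D : ℕ → List (E × ZMod 2)} {x : ℕ → X → ZMod 2}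
  {A : V → ℕ → Bool}

open Classical in
/-- The numbers that may still be told about `q`. -/
noncomputable def pot (S : Coding V X E) (c : V → ℕ) (R : Finset V) (D : ℕ → List (E × ZMod 2))
    (x : ℕ → X → ZMod 2) (u : ℕ) (M : Finset V) (q : V) : ℕ :=
  if q ∈ M then S.mark c R D x u q else S.L

lemma Inv.getD_mrk {u : ℕ} {M : Finset V} {st : State V X} (hi : Inv S c R h D x A u M st) (q : V) :
    (st.mrk q).getD S.L = pot S c R D x u M q := by
  rw [pot]
  split_ifs with hq
  · rw [hi.mk_mem q hq]; rfl
  · rw [hi.mk_notMem q hq]; rfl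

lemma Inv.length (hr : S.Run c R h D x) {u : ℕ} (hu : u ≤ S.t) {M : Finset V} {st : State V X}
    (hi : Inv S c R h D x A u M st) : st.h.length = u := by
  rw [hi.h, List.length_take, hr.length]; omega

/-- An accepted term that is not truly satisfiable must involve an unmarked vertex of `R`. The
advice names its literal and tells the mark by its distance from `L`; this distance is the drop of
the potential. -/
lemma exists_mark_step [DecidableEq V] (hr : S.Run c R h D x) {k : ℕ} {u : ℕ} (hu : u < S.t)
    (hk : ∀ D' ∈ S.fml u, D'.length ≤ k) {M : Finset V} {st : State V X}
    (hi : Inv S c R h D x A u M st) (hcur : S.current st ≠ some (D u)) :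
    ∃ q ∈ R, q ∉ M ∧ ∃ I : Instr k S.L, I.cost + S.mark c R D x u q ≤ S.L ∧
      Inv S c R h D x A u (insert q M) (S.step st I) := by
  classical
  have hlen := hi.length hr hu.le
  obtain ⟨b, hb, hb'⟩ := exists_find?_eq (hr.first u hu)
    (p' := fun D => decide (S.Accepts st D)) (by simpa using hi.accepts hr hu)
  have hcb : S.current st = some b := by rw [current, hlen]; exact hb
  have hsat : ¬ S.Satisfiable c (h.take u) b := by
    rcases hb' with rfl | hb'
    · exact absurd hcb hcur
    · simpa using hb'
  have hacc : S.Accepts st b := by simpa using List.find?_some hb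
  have : ∃ l ∈ b, ∃ q, S.rv l.1 = some q ∧ q ∈ R ∧ q ∉ M := by
    by_contra! hcon
    exact hsat (hi.satisfiable_of_accepts hr hacc hcon)
  obtain ⟨l, hl, q, hq, hqR, hqM⟩ := this
  obtain ⟨a, ha, hal⟩ := List.getElem_of_mem hl
  have hak : a < k := ha.trans_le (hk b (List.mem_of_find?_eq_some hb))
  have hm := mark_le_L (S := S) (c := c) (R := R) (D := D) (x := x) u q
  let v : Fin (S.L + 1) := ⟨S.L - S.mark c R D x u q, by omega⟩
  let I : Instr k S.L := ((false, ⟨a, hak⟩, 0, 0, fun _ => false, fun _ => false),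
    (fun a' => if a' = ⟨a, hak⟩ then v else 0, fun _ => 0))
  refine ⟨q, hqR, hqM, I, ?_, ?_⟩
  · have h1 : I.cost = S.L - S.mark c R D x u q := by
      simp only [Instr.cost, I]
      rw [Finset.sum_eq_single (⟨a, hak⟩ : Fin k)]
      · simp [v]
      · intro b _ hb; simp [hb]
      · simp
    omega
  · have hstep : S.step st I =
        ⟨st.ch, Function.update st.mrk q (some (S.mark c R D x u q)), st.h⟩ := by
      have h1 : (b[a]?).map Prod.fst = some l.1 := by
        rw [List.getElem?_eq_getElem ha, hal]; rfl
      have h2 : S.L - (S.L - S.mark c R D x u q) = S.mark c R D x u q := by omega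
      simp only [step, hlen, hu, if_true, hcb, I, h1, hq, Bool.false_eq_true, if_false, v, h2]
      congr!
    rw [hstep]
    refine ⟨hi.ch, hi.h, ?_, ?_, ?_⟩
    · intro q' hq'
      by_cases hqq : q' = q
      · subst hqq; simp
      · simp only [Function.update_of_ne hqq]
        exact hi.mk_mem q' (by simpa [hqq] using hq')
    · intro q' hq'
      rw [Finset.mem_insert, not_or] at hq'
      simp only [Function.update_of_ne hq'.1]
      exact hi.mk_notMem q' hq'.2
    · intro q' hq'
      rcases Finset.mem_insert.1 hq' with rfl | hq'
      · exact hqR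
      · exact hi.sub hq'

lemma pend_succ_of_pend {u d : ℕ} {q : V} (hp : S.Pend c R D x u q d)
    (hn : ¬ (S.FirstAt c D q d u ∧ S.Agree (x u) q)) : S.Pend c R D x (u + 1) q d := by
  obtain ⟨h1, h2, u', h3, h4, h5⟩ := hp
  refine ⟨h1, h2, u', ?_, h4, h5⟩
  rcases h3.eq_or_lt with rfl | h
  · exact absurd ⟨h4, h5⟩ hn
  · exact h

lemma Pend.of_succ {u d : ℕ} {q : V} (hp : S.Pend c R D x (u + 1) q d) : S.Pend c R D x u q d := by
  obtain ⟨h1, h2, u', h3, h4, h5⟩ := hp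
  exact ⟨h1, h2, u', by omega, h4, h5⟩

/-- The right term has been found, and the bits first used by it with agreement can be restored. For
each vertex concerned a literal shows the bits above the lowest restored one, and the advice gives
that bit and its height. -/
lemma exists_real_step [DecidableEq V] (hS : S.IsPivot) (hr : S.Run c R h D x) {k : ℕ} {u : ℕ}
    (hu : u < S.t) (hk : (D u).length ≤ k) {M : Finset V} {st : State V X}
    (hi : Inv S c R h D x A u M st) (hcur : S.current st = some (D u)) :
    ∃ M' : Finset V, M ⊆ M' ∧ ∃ I : Instr k S.L,
      I.cost + ∑ q ∈ R, pot S c R D x (u + 1) M' q ≤ ∑ q ∈ R, pot S c R D x u M q ∧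
      Inv S c R h D x A (u + 1) M' (S.step st I) := by
  classical
  have hlen := hi.length hr hu.le
  obtain ⟨l₀, hl₀, ⟨ζ, π⟩, hquery⟩ := hr.query u hu
  obtain ⟨a₀, ha₀, hal₀⟩ := List.getElem_of_mem hl₀
  have ha₀k : a₀ < k := ha₀.trans_le hk
  -- `Qs` will consist of the vertices that regain bits now, and `n q` is the lowest regained bit;
  -- it must be told, as the pivot settles only the bits above it.
  let P : V → ℕ → Prop := fun q d => d < S.L ∧ S.FirstAt c D q d u ∧ S.Agree (x u) q
  let Qs : Finset V := R.filter fun q => ∃ d, P q d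
  have hQ : ∀ q, ∃ (n : ℕ) (a : Fin k) (e : E), q ∈ Qs → P q n ∧ (∀ d < n, ¬ P q d) ∧
      ((D u)[(a : ℕ)]?).map Prod.fst = some e ∧ S.rv e = some q ∧ S.NC e (c q) (n + 1) := by
    intro q
    by_cases hq : q ∈ Qs
    · have hex : ∃ d, P q d := (Finset.mem_filter.1 hq).2
      have hn := Nat.find_spec hex
      obtain ⟨l, hl, hlq, hnc⟩ := hn.2.1.2.1
      obtain ⟨a, ha, hal⟩ := List.getElem_of_mem hl
      refine ⟨Nat.find hex, ⟨a, ha.trans_le hk⟩, l.1, fun _ => ⟨hn, fun d hd => Nat.find_min hex hd,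
        ?_, hlq, hnc⟩⟩
      simp [List.getElem?_eq_getElem ha, hal]
    · exact ⟨0, ⟨a₀, ha₀k⟩, l₀.1, fun h => absurd h hq⟩
  choose n a e hdat using hQ
  have hinj : ∀ q ∈ Qs, ∀ q' ∈ Qs, a q = a q' → q = q' := by
    intro q hq q' hq' haa
    obtain ⟨-, -, h1, h2, -⟩ := hdat q hq
    obtain ⟨-, -, h1', h2', -⟩ := hdat q' hq'
    rw [haa, h1', Option.some.injEq] at h1
    rw [h1, h2] at h2'
    exact Option.some.inj h2'
  have hQR : ∀ q ∈ Qs, q ∈ R := fun q hq => (Finset.mem_filter.1 hq).1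
  -- the bits that stay open
  have F1 : ∀ q ∉ Qs, ∀ d, S.Pend c R D x u q d ↔ S.Pend c R D x (u + 1) q d := by
    refine fun q hq d => ⟨fun hp => pend_succ_of_pend hp fun hn => hq ?_, Pend.of_succ⟩
    exact Finset.mem_filter.2 ⟨hp.1, d, hp.2.1, hn⟩
  -- `Needed` is monotone in the bit, so all bits from `n q` on are already used at stage `u` and
  -- cannot have their first use later.
  have F2 : ∀ q ∈ Qs, ∀ d, S.Pend c R D x (u + 1) q d → d < n q := by
    rintro q hq d ⟨-, -, u', h3, h4, -⟩
    by_contra hlt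
    obtain ⟨-, -, h1, h2, h5⟩ := hdat q hq
    obtain ⟨l, hl, hlq, hnc⟩ := (hdat q hq).1.2.1.2.1
    exact h4.2.2 u (by omega) ⟨l, hl, hlq, hnc.mono (by omega)⟩
  have F3 : ∀ q ∈ Qs, ∀ d < n q, (S.Pend c R D x u q d ↔ S.Pend c R D x (u + 1) q d) := by
    refine fun q hq d hd => ⟨fun hp => pend_succ_of_pend hp fun hn => ?_, Pend.of_succ⟩
    exact (hdat q hq).2.1 d hd ⟨hp.2.1, hn⟩
  have F4 : ∀ q ∈ Qs, n q + 1 ≤ S.mark c R D x u q := fun q hq =>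
    Pend.lt_mark ⟨hQR q hq, (hdat q hq).1.1, u, le_rfl, (hdat q hq).1.2⟩
  have F5 : ∀ q ∈ Qs, S.mark c R D x (u + 1) q ≤ n q := fun q hq => mark_le (F2 q hq)
  have Fmark : ∀ q ∉ Qs, S.mark c R D x (u + 1) q = S.mark c R D x u q := by
    intro q hq
    simp only [mark, F1 q hq]
  have Ffill : ∀ q ∉ Qs, S.filled c R D x A (u + 1) q = S.filled c R D x A u q := by
    intro q hq
    rw [filled, filled]
    split_ifs
    · refine ofBitsAt_congr fun d _ => ?_
      by_cases hp : S.Pend c R D x (u + 1) q d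
      · rw [if_pos hp, if_pos ((F1 q hq d).2 hp)]
      · rw [if_neg hp, if_neg fun h => hp ((F1 q hq d).1 h)]
    · rfl
  have hcurL : ∀ q, pot S c R D x u M q ≤ S.L := by
    intro q; rw [pot]; split_ifs
    · exact mark_le_L u q
    · exact le_rfl
  have hncur : ∀ q ∈ Qs, n q < pot S c R D x u M q := by
    intro q hq; rw [pot]; split_ifs
    · exact F4 q hq
    · exact (hdat q hq).1.1
  -- the instruction
  let act : Fin k → Bool := fun a' => decide (∃ q ∈ Qs, a q = a')
  let bit : Fin k → Bool := fun a' => decide (∃ q ∈ Qs, a q = a' ∧ (c q - S.o).testBit (n q) = true)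
  -- `v₁` leads from the present bound down to `n q`, and `v₂` from there to the new mark; together
  -- they equal the loss of potential. By `hinj` at most one vertex contributes to each position.
  let v₁ : Fin k → ℕ := fun a' => ∑ q ∈ Qs, if a q = a' then pot S c R D x u M q - n q else 0
  let v₂ : Fin k → ℕ := fun a' => ∑ q ∈ Qs, if a q = a' then n q - S.mark c R D x (u + 1) q else 0
  have hsel : ∀ (f : V → ℕ), ∀ q ∈ Qs, (∑ q' ∈ Qs, if a q' = a q then f q' else 0) = f q := by
    intro f q hq
    rw [Finset.sum_eq_single q]
    · simp
    · intro q' hq' hne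
      rw [if_neg fun h => hne (hinj q' hq' q hq h)]
    · exact fun h => absurd hq h
  have hswap : ∀ (f : V → ℕ), (∑ a', ∑ q ∈ Qs, if a q = a' then f q else 0) = ∑ q ∈ Qs, f q := by
    intro f
    rw [Finset.sum_comm]
    exact Finset.sum_congr rfl fun q _ => by simp
  have hbit : ∀ q ∈ Qs, bit (a q) = (c q - S.o).testBit (n q) := by
    intro q hq
    by_cases hb : (c q - S.o).testBit (n q) = true
    · rw [hb]; simp only [bit, decide_eq_true_eq]; exact ⟨q, hq, rfl, hb⟩
    · rw [Bool.eq_false_iff.2 hb]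
      simp only [bit, decide_eq_false_iff_not]
      rintro ⟨q', hq', haa, hb'⟩
      rw [hinj q' hq' q hq haa] at hb'
      exact hb hb'
  -- The minima only provide elements of `Fin (L + 1)`; by `hv₁` and `hv₂` they do not alter the
  -- numbers that are read.
  let I : Instr k S.L := ((true, ⟨a₀, ha₀k⟩, ζ, π, act, bit),
    (fun a' => ⟨min (v₁ a') S.L, by omega⟩, fun a' => ⟨min (v₂ a') S.L, by omega⟩))
  have hpick : ∀ q ∈ Qs, S.pick (D u) act q = some (a q, e q) := by
    intro q hq
    have hex : ∃ p : Fin k × E, act p.1 = true ∧ ((D u)[(p.1 : ℕ)]?).map Prod.fst = some p.2 ∧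
        S.rv p.2 = some q :=
      ⟨(a q, e q), by simp only [act, decide_eq_true_eq]; exact ⟨q, hq, rfl⟩, (hdat q hq).2.2.1,
        (hdat q hq).2.2.2.1⟩
    rw [pick, dif_pos hex]
    obtain ⟨h1, h2, h3⟩ := hex.choose_spec
    generalize hex.choose = p at h1 h2 h3 ⊢
    simp only [act, decide_eq_true_eq] at h1
    obtain ⟨q', hq', haa⟩ := h1
    rw [← haa, (hdat q' hq').2.2.1, Option.some.injEq] at h2
    rw [← h2, (hdat q' hq').2.2.2.1, Option.some.injEq] at h3
    subst h3
    rw [Option.some.injEq]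
    exact Prod.ext haa.symm h2.symm
  have hpick' : ∀ q ∉ Qs, S.pick (D u) act q = none := by
    intro q hq
    rw [pick, dif_neg]
    rintro ⟨p, h1, h2, h3⟩
    simp only [act, decide_eq_true_eq] at h1
    obtain ⟨q', hq', haa⟩ := h1
    rw [← haa, (hdat q' hq').2.2.1, Option.some.injEq] at h2
    rw [← h2, (hdat q' hq').2.2.2.1, Option.some.injEq] at h3
    subst h3
    exact hq hq'
  have hv₁ : ∀ q ∈ Qs, min (v₁ (a q)) S.L = pot S c R D x u M q - n q := by
    intro q hq
    have h1 : v₁ (a q) = _ := hsel (fun q => pot S c R D x u M q - n q) q hq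
    rw [h1]; have := hcurL q; omega
  have hv₂ : ∀ q ∈ Qs, min (v₂ (a q)) S.L = n q - S.mark c R D x (u + 1) q := by
    intro q hq
    have h1 : v₂ (a q) = _ := hsel (fun q => n q - S.mark c R D x (u + 1) q) q hq
    rw [h1]; have := (hdat q hq).1.1; omega
  have hstep : S.step st I =
      { ch := fun q => match S.pick (D u) act q with
          | none => st.ch q
          | some p => S.learn (st.ch q) p.2 ((st.mrk q).getD S.L - min (v₁ p.1) S.L) (bit p.1)
        mrk := fun q => match S.pick (D u) act q with
          | none => st.mrk q
          | some p => some ((st.mrk q).getD S.L - min (v₁ p.1) S.L - min (v₂ p.1) S.L)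
        h := st.h ++ [(S.own l₀.1, ζ, π)] } := by
    have h1 : ((D u)[a₀]?).map Prod.fst = some l₀.1 := by
      rw [List.getElem?_eq_getElem ha₀, hal₀]; rfl
    simp only [step, hlen, hu, if_true, hcur, I, h1]
  refine ⟨M ∪ Qs, Finset.subset_union_left, I, ?_, ?_⟩
  · have hc1 : I.cost ≤ ∑ q ∈ Qs, (pot S c R D x u M q - S.mark c R D x (u + 1) q) := by
      have h1 : I.cost ≤ ∑ a', v₁ a' + ∑ a', v₂ a' :=
        add_le_add (Finset.sum_le_sum fun a' _ => min_le_left _ _)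
          (Finset.sum_le_sum fun a' _ => min_le_left _ _)
      have h2 : ∑ a', v₁ a' = ∑ q ∈ Qs, (pot S c R D x u M q - n q) := hswap _
      have h3 : ∑ a', v₂ a' = ∑ q ∈ Qs, (n q - S.mark c R D x (u + 1) q) := hswap _
      refine h1.trans ?_
      rw [h2, h3, ← Finset.sum_add_distrib]
      refine Finset.sum_le_sum fun q hq => ?_
      have := hncur q hq; have := F5 q hq
      omega
    have hc2 : ∑ q ∈ Qs, (pot S c R D x u M q - S.mark c R D x (u + 1) q) =
        ∑ q ∈ R, if q ∈ Qs then (pot S c R D x u M q - S.mark c R D x (u + 1) q) else 0 := by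
      rw [← Finset.sum_filter]
      congr 1
      ext q; simp only [Finset.mem_filter]
      exact ⟨fun h => ⟨hQR q h, h⟩, fun h => h.2⟩
    rw [hc2] at hc1
    refine (add_le_add_left hc1 _).trans ?_
    rw [← Finset.sum_add_distrib]
    refine Finset.sum_le_sum fun q _ => ?_
    by_cases hq : q ∈ Qs
    · have := hncur q hq; have := F5 q hq
      rw [if_pos hq]
      conv_lhs => rw [pot.eq_def S c R D x (u + 1), if_pos (Finset.mem_union_right _ hq)]
      omega
    · rw [if_neg hq, zero_add]
      by_cases hqM : q ∈ M
      · rw [pot, pot, if_pos hqM, if_pos (Finset.mem_union_left _ hqM), Fmark q hq]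
      · rw [pot, pot, if_neg hqM, if_neg (by simp [hq, hqM])]
  · rw [hstep]
    refine ⟨?_, ?_, ?_, ?_, Finset.union_subset hi.sub fun q hq => hQR q hq⟩
    · funext q
      by_cases hq : q ∈ Qs
      · simp only [hpick q hq, hi.getD_mrk, hv₁ q hq, hbit q hq]
        have h1 : pot S c R D x u M q - (pot S c R D x u M q - n q) = n q := by
          have := hncur q hq; omega
        rw [h1, filled, if_pos (hQR q hq), learn]
        refine ofBitsAt_congr fun d _ => ?_
        -- Below `n q` the open bits stay open, bit `n q` is told, and the bits above it are those
        -- of the pivot.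
        rcases lt_trichotomy d (n q) with hd | rfl | hd
        · simp only [if_pos hd, hi.ch, testBit_filled hr (hQR q hq), F3 q hq d hd]
        · simp only [lt_irrefl, if_false, if_true]
          rw [if_neg fun hp => lt_irrefl _ (F2 q hq _ hp)]
        · rw [if_neg (by omega), if_neg (by omega), if_neg fun hp => by have := F2 q hq _ hp; omega]
          exact ((hdat q hq).2.2.2.2.sameAbove_pv hS d hd).symm
      · simp only [hpick' q hq, hi.ch, Ffill q hq]
    · simp only [hi.h, List.take_add_one, hquery]; rfl
    · intro q hq
      by_cases hqQ : q ∈ Qs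
      · simp only [hpick q hqQ, hi.getD_mrk, hv₁ q hqQ, hv₂ q hqQ]
        have := hncur q hqQ; have := F5 q hqQ
        congr 1; omega
      · simp only [hpick' q hqQ, Fmark q hqQ]
        exact hi.mk_mem q (by simpa [hqQ] using hq)
    · intro q hq
      rw [Finset.mem_union, not_or] at hq
      simp only [hpick' q hq.2]
      exact hi.mk_notMem q hq.1

/-- Each instruction advances the stage or marks a new vertex, which bounds their number by `N`; the
costs telescope along the potential. -/
lemma exists_instrs [DecidableEq V] (hS : S.IsPivot) (hr : S.Run c R h D x) {k : ℕ}
    (hk : ∀ u < S.t, ∀ D' ∈ S.fml u, D'.length ≤ k) (N u : ℕ) (hu : u ≤ S.t) (M : Finset V)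
    (st : State V X) (hi : Inv S c R h D x A u M st) (hN : (S.t - u) + (R.card - M.card) = N) :
    ∃ Is : List (Instr k S.L), Is.length ≤ N ∧
      (Is.map Instr.cost).sum ≤ ∑ q ∈ R, pot S c R D x u M q ∧
      (Is.foldl S.step st).ch = c ∧ (Is.foldl S.step st).h.length = S.t := by
  induction N using Nat.strong_induction_on generalizing u M st with
  | _ N ih =>
    by_cases hut : u = S.t
    · subst hut
      refine ⟨[], by simp, by simp, ?_, hi.length hr le_rfl⟩
      rw [List.foldl_nil, hi.ch, filled_end hr]
    have hu' : u < S.t := lt_of_le_of_ne hu hut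
    have hDk : (D u).length ≤ k := hk u hu' _ (List.mem_of_find?_eq_some (hr.first u hu'))
    by_cases hcur : S.current st = some (D u)
    · obtain ⟨M', hMM', I, hI, hi'⟩ := exists_real_step hS hr hu' hDk hi hcur
      have h1 := Finset.card_le_card hMM'
      obtain ⟨Is, h2, h3, h4, h5⟩ := ih ((S.t - (u + 1)) + (R.card - M'.card)) (by omega) (u + 1) hu'
        M' _ hi' rfl
      refine ⟨I :: Is, by simp only [List.length_cons]; omega, ?_, h4, h5⟩
      rw [List.map_cons, List.sum_cons]
      omega
    · obtain ⟨q, hqR, hqM, I, hI, hi'⟩ := exists_mark_step hr hu' (hk u hu') hi hcur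
      have h1 := Finset.card_insert_of_notMem hqM
      have h1' := Finset.card_le_card hi'.sub
      obtain ⟨Is, h2, h3, h4, h5⟩ := ih ((S.t - u) + (R.card - (insert q M).card)) (by omega) u hu
        _ _ hi' rfl
      refine ⟨I :: Is, by simp only [List.length_cons]; omega, ?_, h4, h5⟩
      rw [List.map_cons, List.sum_cons]
      have hsplit : ∀ M' : Finset V, ∑ q ∈ R, pot S c R D x u M' q =
          pot S c R D x u M' q + ∑ q ∈ R.erase q, pot S c R D x u M' q := fun M' =>
        (Finset.add_sum_erase R _ hqR).symm
      have h6 : ∑ q' ∈ R.erase q, pot S c R D x u (insert q M) q' =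
          ∑ q' ∈ R.erase q, pot S c R D x u M q' := by
        refine Finset.sum_congr rfl fun q' hq' => ?_
        have hne := Finset.ne_of_mem_erase hq'
        by_cases hqM' : q' ∈ M <;> simp [pot, hne, hqM']
      have h7 : pot S c R D x u (insert q M) q = S.mark c R D x u q := by simp [pot]
      have h8 : pot S c R D x u M q = S.L := by simp [pot, hqM]
      rw [hsplit] at h3 ⊢
      omega

end Coding

end GridSwitching

/-! ### Counting advice strings and comparing them with overwritings. -/

namespace GridSwitching

namespace Coding

variable {V X E : Type}

/-! ### Counting the codes -/

lemma sum_pow_fin_le (L : ℕ) : ∑ d : Fin (L + 1), (63 / 64 : ℝ) ^ (d : ℕ) ≤ 64 := by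
  rw [Fin.sum_univ_eq_sum_range (fun d => (63 / 64 : ℝ) ^ d), geom_sum_eq (by norm_num)]
  have : (0 : ℝ) ≤ (63 / 64) ^ (L + 1) := by positivity
  rw [div_le_iff_of_neg (by norm_num)]
  linarith

lemma sum_prod_pow_le (k L : ℕ) :
    ∑ v : Fin k → Fin (L + 1), (63 / 64 : ℝ) ^ (∑ a, (v a : ℕ)) ≤ 64 ^ k := by
  have h := Finset.prod_univ_sum (fun _ : Fin k => (Finset.univ : Finset (Fin (L + 1))))
    (fun _ d => (63 / 64 : ℝ) ^ (d : ℕ))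
  rw [Fintype.piFinset_univ] at h
  simp_rw [← Finset.prod_pow_eq_pow_sum]
  rw [← h, Finset.prod_const, Finset.card_univ, Fintype.card_fin]
  exact pow_le_pow_left₀ (Finset.sum_nonneg fun _ _ => by positivity) (sum_pow_fin_le L) k

/-- Each vector of numbers contributes `64 ^ k = 2 ^ (6 * k)`, as the full geometric series sums to
`64`; the remaining data have at most `2 ^ (6 * k)` values. -/
lemma sum_instr_le (k L : ℕ) : ∑ I : Instr k L, (63 / 64 : ℝ) ^ I.cost ≤ 2 ^ (18 * k) := by
  rw [Fintype.sum_prod_type]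
  simp only [Instr.cost, pow_add]
  rw [Finset.sum_const, Finset.card_univ]
  have h1 : ∑ v : (Fin k → Fin (L + 1)) × (Fin k → Fin (L + 1)),
      (63 / 64 : ℝ) ^ (∑ a, (v.1 a : ℕ)) * (63 / 64 : ℝ) ^ (∑ a, (v.2 a : ℕ)) ≤ 64 ^ k * 64 ^ k := by
    rw [Fintype.sum_prod_type]
    simp only
    rw [← Finset.sum_mul_sum]
    have h0 := sum_prod_pow_le k L
    exact mul_le_mul h0 h0 (Finset.sum_nonneg fun _ _ => by positivity) (by positivity)
  have h2 : Fintype.card (Bool × Fin k × ZMod 2 × ZMod 2 × (Fin k → Bool) × (Fin k → Bool)) ≤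
      2 ^ (6 * k) := by
    simp only [Fintype.card_prod, Fintype.card_bool, Fintype.card_fin, ZMod.card, Fintype.card_fun]
    rcases Nat.eq_zero_or_pos k with rfl | hk
    · simp
    · have h3 : k ≤ 2 ^ k := Nat.lt_two_pow_self.le
      have h4 : 8 ≤ 2 ^ (3 * k) := by
        calc 8 = 2 ^ 3 := by norm_num
          _ ≤ _ := Nat.pow_le_pow_right (by norm_num) (by omega)
      calc 2 * (k * (2 * (2 * (2 ^ k * 2 ^ k)))) = 8 * k * (2 ^ k * 2 ^ k) := by ring
        _ ≤ 2 ^ (3 * k) * 2 ^ k * (2 ^ k * 2 ^ k) := by gcongr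
        _ = 2 ^ (6 * k) := by ring
  rw [nsmul_eq_mul]
  calc _ ≤ (2 ^ (6 * k) : ℝ) * (64 ^ k * 64 ^ k) := by
        refine mul_le_mul (by exact_mod_cast h2) h1
          (Finset.sum_nonneg fun _ _ => by positivity) (by positivity)
    _ = 2 ^ (18 * k) := by
        have : (64 : ℝ) ^ k = 2 ^ (6 * k) := by rw [pow_mul]; norm_num
        rw [this]; ring

/-- The lists of `N` instructions with total cost at most `B`. -/
abbrev Codes (k L N B : ℕ) : Type := {f : Fin N → Instr k L // ∑ i, (f i).cost ≤ B}

/-- An exponential weight: each code of total cost at most `B` weighs at least `(63/64) ^ B`, and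
the total weight of all lists factorizes over the instructions. -/
lemma card_codes_le (k L N B : ℕ) :
    (Fintype.card (Codes k L N B) : ℝ) ≤ (64 / 63 : ℝ) ^ B * 2 ^ (18 * k * N) := by
  have h := Finset.prod_univ_sum (fun _ : Fin N => (Finset.univ : Finset (Instr k L)))
    (fun _ I => (63 / 64 : ℝ) ^ I.cost)
  rw [Fintype.piFinset_univ, Finset.prod_const, Finset.card_univ, Fintype.card_fin] at h
  simp_rw [Finset.prod_pow_eq_pow_sum] at h
  have h1 : (Fintype.card (Codes k L N B) : ℝ) * (63 / 64) ^ B ≤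
      ∑ f : Fin N → Instr k L, (63 / 64 : ℝ) ^ (∑ i, (f i).cost) := by
    rw [Fintype.card_subtype, ← nsmul_eq_mul]
    refine (Finset.card_nsmul_le_sum _ (fun f : Fin N → Instr k L =>
      (63 / 64 : ℝ) ^ (∑ i, (f i).cost)) _ ?_).trans
      (Finset.sum_le_sum_of_subset_of_nonneg (Finset.subset_univ _) fun _ _ _ => by positivity)
    intro f hf
    exact pow_le_pow_of_le_one (by norm_num) (by norm_num) (Finset.mem_filter.1 hf).2
  have h2 : (∑ I : Instr k L, (63 / 64 : ℝ) ^ I.cost) ^ N ≤ 2 ^ (18 * k * N) := by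
    rw [pow_mul]
    exact pow_le_pow_left₀ (Finset.sum_nonneg fun _ _ => by positivity) (sum_instr_le k L) N
  rw [← h] at h1
  have h3 : (64 / 63 : ℝ) ^ B * (63 / 64) ^ B = 1 := by rw [← mul_pow]; norm_num
  have h4 : (0 : ℝ) < (64 / 63) ^ B := by positivity
  calc (Fintype.card (Codes k L N B) : ℝ)
      = (64 / 63) ^ B * (Fintype.card (Codes k L N B) * (63 / 64) ^ B) := by
        linear_combination (-(Fintype.card (Codes k L N B) : ℝ)) * h3
    _ ≤ _ := mul_le_mul_of_nonneg_left (h1.trans h2) h4.le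

/-- After the last query the state is frozen, so advice can be padded to a common length. -/
lemma foldl_step_of_length {S : Coding V X E} {k : ℕ} (st : State V X) (h : st.h.length = S.t)
    (Is : List (Instr k S.L)) : Is.foldl S.step st = st := by
  induction Is with
  | nil => rfl
  | cons I Is ih =>
    have : S.step st I = st := by simp [step, h]
    rw [List.foldl_cons, this, ih]

/-- The result of decoding. -/
noncomputable def decode (S : Coding V X E) {k N : ℕ} (c' : V → ℕ) (f : Fin N → Instr k S.L) :
    V → ℕ :=
  ((List.ofFn f).foldl S.step ⟨c', fun _ => none, []⟩).ch

lemma exists_code {S : Coding V X E} (hS : S.IsPivot) {c : V → ℕ} {R : Finset V}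
    {h : List (X × ZMod 2 × ZMod 2)} {D : ℕ → List (E × ZMod 2)} {x : ℕ → X → ZMod 2}
    (hr : S.Run c R h D x) {k r₀ : ℕ} (hk0 : 0 < k)
    (hk : ∀ u < S.t, ∀ D' ∈ S.fml u, D'.length ≤ k) (hR : R.card ≤ r₀) (A : V → ℕ → Bool) :
    ∃ f : Codes k S.L (S.t + r₀) (S.L * r₀), S.decode (S.filled c R D x A 0) f.1 = c := by
  classical
  -- Initially nothing is marked, so every vertex of `R` has potential `L`.
  have hi : Inv S c R h D x A 0 ∅ ⟨S.filled c R D x A 0, fun _ => none, []⟩ :=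
    ⟨rfl, by simp, by simp, by simp, by simp⟩
  obtain ⟨Is, h1, h2, h3, h4⟩ := exists_instrs hS hr hk _ 0 (Nat.zero_le _) ∅ _ hi rfl
  simp only [Finset.card_empty, tsub_zero] at h1
  have h2' : (Is.map Instr.cost).sum ≤ S.L * r₀ := by
    refine h2.trans ?_
    simp only [pot, Finset.notMem_empty, if_false, Finset.sum_const, smul_eq_mul]
    rw [mul_comm]; exact Nat.mul_le_mul_left _ hR
  let I₀ : Instr k S.L := ((false, ⟨0, hk0⟩, 0, 0, fun _ => false, fun _ => false),
    (fun _ => 0, fun _ => 0))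
  have hI₀ : I₀.cost = 0 := by simp [Instr.cost, I₀]
  let Js := Is ++ List.replicate (S.t + r₀ - Is.length) I₀
  have hJlen : Js.length = S.t + r₀ := by simp only [Js, List.length_append, List.length_replicate]; omega
  let f : Fin (S.t + r₀) → Instr k S.L := fun i => Js[(i : ℕ)]'(by rw [hJlen]; exact i.2)
  have hf : List.ofFn f = Js := by
    apply List.ext_getElem
    · simp [hJlen]
    · intro i hi1 hi2; simp [f]
  refine ⟨⟨f, ?_⟩, ?_⟩
  · rw [← List.sum_ofFn]
    have : (List.ofFn fun i => (f i).cost) = Js.map Instr.cost := by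
      rw [← hf, List.map_ofFn]; rfl
    rw [this]
    simp only [Js, List.map_append, List.sum_append, List.map_replicate, hI₀, List.sum_replicate]
    simpa using h2'
  · simp only [decode, hf, Js]
    rw [List.foldl_append, foldl_step_of_length _ h4, h3]

/-- Indices with many gained bits are rare. -/
theorem card_mul_two_pow_le [Fintype V] [DecidableEq V] {S : Coding V X E} (hS : S.IsPivot)
    {Δ k r₀ g : ℕ} (hΔ : S.o + 2 ^ S.L ≤ Δ) (hk0 : 0 < k)
    (hk : ∀ u < S.t, ∀ D' ∈ S.fml u, D'.length ≤ k) (𝒢 : Finset (V → Fin Δ))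
    (h𝒢 : ∀ c ∈ 𝒢, ∃ (R : Finset V) (h : List (X × ZMod 2 × ZMod 2)) (D : ℕ → List (E × ZMod 2))
      (x : ℕ → X → ZMod 2), R.card ≤ r₀ ∧ S.Run (fun q => (c q : ℕ)) R h D x ∧
      ∃ G : Finset (V × ℕ), (∀ p ∈ G, S.Pend (fun q => (c q : ℕ)) R D x 0 p.1 p.2) ∧ g ≤ G.card) :
    𝒢.card * 2 ^ g ≤ Δ ^ Fintype.card V * Fintype.card (Codes k S.L (S.t + r₀) (S.L * r₀)) := by
  classical
  let T := {c // c ∈ 𝒢}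
  have hT : ∀ c : T, ∃ (R : Finset V) (h : List (X × ZMod 2 × ZMod 2)) (D : ℕ → List (E × ZMod 2))
      (x : ℕ → X → ZMod 2), R.card ≤ r₀ ∧ S.Run (fun q => (c.1 q : ℕ)) R h D x ∧
      ∃ G : Finset (V × ℕ), (∀ p ∈ G, S.Pend (fun q => (c.1 q : ℕ)) R D x 0 p.1 p.2) ∧
        g ≤ G.card := fun c => h𝒢 c.1 c.2
  choose R h D x hR hr G hG hg using hT
  let A : Finset (V × ℕ) → V → ℕ → Bool := fun B q d => decide ((q, d) ∈ B)
  choose f hf using fun (c : T) (B : Finset (V × ℕ)) =>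
    exists_code hS (hr c) hk0 hk (hR c) (A B)
  have hlt : ∀ (c : T) (B : Finset (V × ℕ)) (q : V),
      S.filled (fun q => (c.1 q : ℕ)) (R c) (D c) (x c) (A B) 0 q < Δ := by
    intro c B q
    by_cases hq : q ∈ R c
    · exact (inWindow_filled hq).2.trans_le hΔ
    · rw [filled, if_neg hq]; exact (c.1 q).2
  -- Pairs of good indices and a set `B` of gained bits to be written as ones. Decoding the image
  -- returns the indices, hence the positions of the gained bits, and then `B` is read off from the
  -- overwritten indices.
  let Φ : (Σ _ : T, Finset (V × ℕ)) → (V → Fin Δ) × Codes k S.L (S.t + r₀) (S.L * r₀) :=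
    fun p => (fun q => ⟨_, hlt p.1 p.2 q⟩, f p.1 p.2)
  let s : Finset (Σ _ : T, Finset (V × ℕ)) := Finset.univ.sigma fun c => (G c).powerset
  have hinj : Set.InjOn Φ s := by
    rintro ⟨c, B⟩ hc ⟨c', B'⟩ hc' heq
    simp only [s, Finset.coe_sigma, Set.mem_sigma_iff, Finset.coe_univ, Set.mem_univ, true_and,
      Finset.coe_powerset, Set.mem_preimage, Set.mem_powerset_iff, Finset.coe_subset] at hc hc'
    have h1 : S.filled (fun q => (c.1 q : ℕ)) (R c) (D c) (x c) (A B) 0 =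
        S.filled (fun q => (c'.1 q : ℕ)) (R c') (D c') (x c') (A B') 0 := by
      funext q
      have := congrFun (congrArg Prod.fst heq) q
      exact congrArg Fin.val this
    have h2 : f c B = f c' B' := congrArg Prod.snd heq
    have h3 := hf c B
    rw [h1, h2, hf c' B'] at h3
    have hcc : c = c' := by
      apply Subtype.ext
      funext q
      exact Fin.ext (congrFun h3 q).symm
    subst hcc
    have hBB : B = B' := by
      ext ⟨q, d⟩
      by_cases hqd : (q, d) ∈ G c
      · have hp := hG c _ hqd
        have hb := testBit_filled (A := A B) (u := 0) (hr c) hp.1 d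
        have hb' := testBit_filled (A := A B') (u := 0) (hr c) hp.1 d
        rw [if_pos hp] at hb hb'
        rw [h1, hb'] at hb
        simp only [A, decide_eq_decide] at hb
        exact hb.symm
      · exact ⟨fun h => absurd (hc h) hqd, fun h => absurd (hc' h) hqd⟩
    rw [hBB]
  have hcard := Finset.card_le_card_of_injOn (t := Finset.univ) Φ (fun _ _ => Finset.mem_univ _) hinj
  rw [Finset.card_univ, Fintype.card_prod, Fintype.card_fun, Fintype.card_fin,
    Finset.card_sigma] at hcard
  refine le_trans ?_ hcard
  have : ∀ c : T, 2 ^ g ≤ ((G c).powerset).card := by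
    intro c
    rw [Finset.card_powerset]
    exact Nat.pow_le_pow_right (by norm_num) (hg c)
  calc 𝒢.card * 2 ^ g = ∑ _c : T, 2 ^ g := by simp [T]
    _ ≤ _ := Finset.sum_le_sum fun c _ => this c

end Coding

end GridSwitching

/-! ### Offsets and blocks: the geometry of the paths. -/

namespace GridSwitching

/-! ### Coordinates of the large torus -/

section Coordinates

variable {T m : ℕ} [NeZero T] [NeZero m]

/-- The offset of the center with index `i` from the corner of the central square. -/
def pos (T i : ℕ) : ℕ := 3 * numCenters T * i + 3 * numCenters T / 2

/-- The offset of the row or column that is reserved for the pair `(i, j)`. -/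
def slot (T i j : ℕ) : ℕ := squareSide T + (numCenters T * i + j)

lemma centerPos_eq (T i : ℕ) : centerPos T i = squareMargin T + pos T i := by
  rw [centerPos, pos, add_assoc]

/-- All the room in the construction comes from this: `3 * Δ` times `Δ` fits into the central
square, and `Δ * Δ` slots fit between two squares. -/
lemma four_mul_sq_le (T : ℕ) : 4 * (numCenters T * numCenters T) ≤ T := by
  have h1 : 2 * numCenters T ≤ Nat.sqrt T := by rw [numCenters]; omega
  have h2 := Nat.sqrt_le T
  nlinarith

lemma le_pos {i : ℕ} : numCenters T ≤ pos T i := by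
  rw [pos]
  have : numCenters T ≤ 3 * numCenters T / 2 := by omega
  exact this.trans (Nat.le_add_left _ _)

lemma pos_lt {i : ℕ} (hi : i < numCenters T) : pos T i + numCenters T < squareSide T := by
  have h := four_mul_sq_le T
  rw [pos, squareSide]
  have h1 : numCenters T * i + numCenters T ≤ numCenters T * numCenters T := by
    calc numCenters T * i + numCenters T = numCenters T * (i + 1) := by ring
      _ ≤ _ := Nat.mul_le_mul_left _ hi
  have h2 : 3 * numCenters T * i = 3 * (numCenters T * i) := by ring
  have h3 : 3 * (numCenters T * numCenters T) ≤ 3 * T / 4 := by omega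
  rw [h2]
  omega

lemma pos_sep {i j : ℕ} (h : i < j) : pos T i + 3 * numCenters T ≤ pos T j := by
  rw [pos, pos]
  have : 3 * numCenters T * i + 3 * numCenters T ≤ 3 * numCenters T * j := by
    calc 3 * numCenters T * i + 3 * numCenters T = 3 * numCenters T * (i + 1) := by ring
      _ ≤ _ := Nat.mul_le_mul_left _ h
  omega

lemma pos_sep' (i j : ℕ) : i = j ∨ pos T i + 3 * numCenters T ≤ pos T j ∨
    pos T j + 3 * numCenters T ≤ pos T i := by
  rcases lt_trichotomy i j with h | h | h
  · exact .inr (.inl (pos_sep h))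
  · exact .inl h
  · exact .inr (.inr (pos_sep h))

lemma side_le_slot (i j : ℕ) : squareSide T ≤ slot T i j := Nat.le_add_right _ _

lemma slot_lt {i j : ℕ} (hi : i < numCenters T) (hj : j < numCenters T) : slot T i j < T := by
  have h := four_mul_sq_le T
  rw [slot, squareSide]
  have h1 : numCenters T * i + numCenters T ≤ numCenters T * numCenters T := by
    calc numCenters T * i + numCenters T = numCenters T * (i + 1) := by ring
      _ ≤ _ := Nat.mul_le_mul_left _ hi
  omega

/-- A slot is a two-digit number in base `Δ`. -/
lemma slot_inj {i j i' j' : ℕ} (hj : j < numCenters T) (hj' : j' < numCenters T)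
    (h : slot T i j = slot T i' j') : i = i' ∧ j = j' := by
  have h1 : numCenters T * i + j = numCenters T * i' + j' := by simpa [slot] using h
  have h2 : i = i' := by
    rcases lt_trichotomy i i' with h | h | h
    · have : numCenters T * (i + 1) ≤ numCenters T * i' := Nat.mul_le_mul_left _ h
      rw [mul_add] at this; omega
    · exact h
    · have : numCenters T * (i' + 1) ≤ numCenters T * i := Nat.mul_le_mul_left _ h
      rw [mul_add] at this; omega
  subst h2
  exact ⟨rfl, by omega⟩

/-- The coordinate at offset `r` from the corner of the central square of block `a`. -/
def crd (T : ℕ) {m : ℕ} (a : ZMod m) (r : ℕ) : ZMod (T * m) :=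
  ((T * a.val + squareMargin T + r : ℕ) : ZMod (T * m))

/-- This includes the wrap-around from the last block to the first one. -/
lemma crd_add (a : ZMod m) (r : ℕ) : crd T a (T + r) = crd T (a + 1) r := by
  rw [crd, crd, ZMod.natCast_eq_natCast_iff]
  have h1 : T * (a.val + 1) ≡ T * (a + 1).val [MOD T * m] := by
    have : (a + 1).val ≡ a.val + 1 [MOD m] := by
      rw [← ZMod.natCast_eq_natCast_iff]; simp
    exact (Nat.ModEq.mul_left' T this).symm
  have h2 := (h1.add_right (squareMargin T)).add_right r
  convert h2 using 1
  ring

lemma crd_inj {a b : ZMod m} {r s : ℕ} (hr : r < T) (hs : s < T) (h : crd T a r = crd T b s) :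
    a = b ∧ r = s := by
  rw [crd, crd, ZMod.natCast_eq_natCast_iff] at h
  have h1 : T * a.val + r ≡ T * b.val + s [MOD T * m] := by
    have h2 : ∀ u w, u + squareMargin T + w = u + w + squareMargin T := fun u w => by ring
    rw [h2, h2] at h
    exact Nat.ModEq.add_right_cancel' _ h
  have hlt : ∀ (c : ZMod m) (w : ℕ), w < T → T * c.val + w < T * m := by
    intro c w hw
    have : T * (c.val + 1) ≤ T * m := Nat.mul_le_mul_left _ (ZMod.val_lt c)
    rw [mul_add] at this; omega
  have h3 := Nat.ModEq.eq_of_lt_of_lt h1 (hlt a r hr) (hlt b s hs)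
  have hT : 0 < T := NeZero.pos T
  have h4 : a.val = b.val := by
    have := congrArg (· / T) h3
    simpa [Nat.mul_add_div hT, Nat.div_eq_of_lt hr, Nat.div_eq_of_lt hs] using this
  refine ⟨ZMod.val_injective m h4, ?_⟩
  rw [h4] at h3; omega

/-- The block of a coordinate. -/
def blk {T m : ℕ} (z : ZMod (T * m)) : ZMod m := (((z - (squareMargin T : ℕ)).val / T : ℕ) : ZMod m)

/-- The offset of a coordinate in its block. -/
def off {T m : ℕ} (z : ZMod (T * m)) : ℕ := (z - (squareMargin T : ℕ)).val % T

lemma off_lt (z : ZMod (T * m)) : off z < T := Nat.mod_lt _ (NeZero.pos T)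

lemma crd_blk_off (z : ZMod (T * m)) : crd T (blk z) (off z) = z := by
  set w := z - ((squareMargin T : ℕ) : ZMod (T * m)) with hw
  have h1 : w.val / T < m := by
    have := ZMod.val_lt w
    exact Nat.div_lt_of_lt_mul this
  have h2 : (blk z).val = w.val / T := by
    rw [blk, ZMod.val_natCast_of_lt h1]
  have h3 : T * (w.val / T) + squareMargin T + w.val % T = w.val + squareMargin T := by
    have := Nat.div_add_mod w.val T
    omega
  rw [crd, h2, off, ← hw, h3, Nat.cast_add, ZMod.natCast_zmod_val, hw]
  ring

lemma eq_crd_iff {z : ZMod (T * m)} {a : ZMod m} {r : ℕ} (hr : r < T) :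
    z = crd T a r ↔ blk z = a ∧ off z = r := by
  constructor
  · intro h
    exact crd_inj (off_lt z) hr ((crd_blk_off z).trans h)
  · rintro ⟨rfl, rfl⟩; exact (crd_blk_off z).symm

lemma exists_crd_lt {z : ZMod (T * m)} {a : ZMod m} {r₁ r₂ : ℕ} (h : r₂ ≤ T) :
    (∃ r, r₁ ≤ r ∧ r < r₂ ∧ z = crd T a r) ↔ blk z = a ∧ r₁ ≤ off z ∧ off z < r₂ := by
  constructor
  · rintro ⟨r, h1, h2, h3⟩
    obtain ⟨h4, h5⟩ := (eq_crd_iff (by omega)).1 h3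
    exact ⟨h4, by omega, by omega⟩
  · rintro ⟨h1, h2, h3⟩
    exact ⟨off z, h2, h3, by rw [← h1, crd_blk_off]⟩

lemma exists_crd_cross {z : ZMod (T * m)} {a : ZMod m} {r₁ s : ℕ} (h : r₁ ≤ T) (hs : s ≤ T) :
    (∃ r, r₁ ≤ r ∧ r < T + s ∧ z = crd T a r) ↔
      (blk z = a ∧ r₁ ≤ off z) ∨ (blk z = a + 1 ∧ off z < s) := by
  constructor
  · rintro ⟨r, h1, h2, h3⟩
    by_cases hr : r < T
    · obtain ⟨h4, h5⟩ := (eq_crd_iff hr).1 h3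
      exact .inl ⟨h4, by omega⟩
    · obtain ⟨r', rfl⟩ := Nat.exists_eq_add_of_le (not_lt.1 hr)
      rw [crd_add] at h3
      obtain ⟨h4, h5⟩ := (eq_crd_iff (by omega)).1 h3
      exact .inr ⟨h4, by omega⟩
  · have := off_lt z
    rintro (⟨h1, h2⟩ | ⟨h1, h2⟩)
    · exact ⟨off z, h2, by omega, by rw [← h1, crd_blk_off]⟩
    · exact ⟨T + off z, by omega, by omega, by rw [crd_add, ← h1, crd_blk_off]⟩

/-- The horizontal segment in block column `a`, from offset `r₁` to `r₂`, at offset `s` in block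
row `b`. -/
def hSeg (T : ℕ) {m : ℕ} (a b : ZMod m) (r₁ r₂ s : ℕ) : Set (Edge (T * m)) :=
  hSegment (T * m) (T * a.val + squareMargin T + r₁) (T * a.val + squareMargin T + r₂)
    (T * b.val + squareMargin T + s)

/-- The vertical segment in block row `b`, from offset `s₁` to `s₂`, at offset `r` in block
column `a`. -/
def vSeg (T : ℕ) {m : ℕ} (a b : ZMod m) (r s₁ s₂ : ℕ) : Set (Edge (T * m)) :=
  vSegment (T * m) (T * a.val + squareMargin T + r) (T * b.val + squareMargin T + s₁)
    (T * b.val + squareMargin T + s₂)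

lemma mem_hSeg {a b : ZMod m} {r₁ r₂ s : ℕ} {e : Edge (T * m)} :
    e ∈ hSeg T a b r₁ r₂ s ↔ e.2 = false ∧ e.1.2 = crd T b s ∧
      ∃ r, min r₁ r₂ ≤ r ∧ r < max r₁ r₂ ∧ e.1.1 = crd T a r := by
  obtain ⟨⟨x, y⟩, d⟩ := e
  simp only [hSeg, hSegment, Set.mem_ofPred_eq, Prod.mk.injEq]
  constructor
  · rintro ⟨z, h1, h2, ⟨h3, h4⟩, h5⟩
    refine ⟨h5, h4, z - (T * a.val + squareMargin T), by omega, by omega, ?_⟩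
    rw [h3, crd]; congr 1; omega
  · rintro ⟨h1, h2, r, h3, h4, h5⟩
    exact ⟨T * a.val + squareMargin T + r, by omega, by omega, ⟨h5, h2⟩, h1⟩

lemma mem_vSeg {a b : ZMod m} {r s₁ s₂ : ℕ} {e : Edge (T * m)} :
    e ∈ vSeg T a b r s₁ s₂ ↔ e.2 = true ∧ e.1.1 = crd T a r ∧
      ∃ s, min s₁ s₂ ≤ s ∧ s < max s₁ s₂ ∧ e.1.2 = crd T b s := by
  obtain ⟨⟨x, y⟩, d⟩ := e
  simp only [vSeg, vSegment, Set.mem_ofPred_eq, Prod.mk.injEq]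
  constructor
  · rintro ⟨z, h1, h2, ⟨h3, h4⟩, h5⟩
    refine ⟨h5, h3, z - (T * b.val + squareMargin T), by omega, by omega, ?_⟩
    rw [h4, crd]; congr 1; omega
  · rintro ⟨h1, h2, s, h3, h4, h5⟩
    exact ⟨T * b.val + squareMargin T + s, by omega, by omega, ⟨h2, h5⟩, h1⟩

lemma mem_hSeg_lt {a b : ZMod m} {r₁ r₂ s : ℕ} {e : Edge (T * m)} (h₁ : r₁ < T) (h₂ : r₂ < T)
    (hs : s < T) :
    e ∈ hSeg T a b r₁ r₂ s ↔ e.2 = false ∧ (blk e.1.2 = b ∧ off e.1.2 = s) ∧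
      blk e.1.1 = a ∧ min r₁ r₂ ≤ off e.1.1 ∧ off e.1.1 < max r₁ r₂ := by
  rw [mem_hSeg, eq_crd_iff hs, exists_crd_lt (by omega)]

lemma mem_vSeg_lt {a b : ZMod m} {r s₁ s₂ : ℕ} {e : Edge (T * m)} (h₁ : s₁ < T) (h₂ : s₂ < T)
    (hr : r < T) :
    e ∈ vSeg T a b r s₁ s₂ ↔ e.2 = true ∧ (blk e.1.1 = a ∧ off e.1.1 = r) ∧
      blk e.1.2 = b ∧ min s₁ s₂ ≤ off e.1.2 ∧ off e.1.2 < max s₁ s₂ := by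
  rw [mem_vSeg, eq_crd_iff hr, exists_crd_lt (by omega)]

lemma mem_hSeg_cross {a b : ZMod m} {r₁ r₂ s : ℕ} {e : Edge (T * m)} (h₁ : r₁ < T) (h₂ : r₂ < T)
    (hs : s < T) :
    e ∈ hSeg T a b r₁ (T + r₂) s ↔ e.2 = false ∧ (blk e.1.2 = b ∧ off e.1.2 = s) ∧
      ((blk e.1.1 = a ∧ r₁ ≤ off e.1.1) ∨ (blk e.1.1 = a + 1 ∧ off e.1.1 < r₂)) := by
  rw [mem_hSeg, eq_crd_iff hs, min_eq_left (by omega), max_eq_right (by omega),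
    exists_crd_cross h₁.le h₂.le]

lemma mem_vSeg_cross {a b : ZMod m} {r s₁ s₂ : ℕ} {e : Edge (T * m)} (h₁ : s₁ < T) (h₂ : s₂ < T)
    (hr : r < T) :
    e ∈ vSeg T a b r s₁ (T + s₂) ↔ e.2 = true ∧ (blk e.1.1 = a ∧ off e.1.1 = r) ∧
      ((blk e.1.2 = b ∧ s₁ ≤ off e.1.2) ∨ (blk e.1.2 = b + 1 ∧ off e.1.2 < s₂)) := by
  rw [mem_vSeg, eq_crd_iff hr, min_eq_left (by omega), max_eq_right (by omega),
    exists_crd_cross h₁.le h₂.le]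

/-! ### The paths in coordinates -/

lemma upPath_eq (q : Vertex m) {i j : ℕ} (hi : i < numCenters T) :
    upPath T m q j i =
      hSeg T q.1 q.2 (pos T j - (i + 1)) (pos T j) (pos T j) ∪
      vSeg T q.1 q.2 (pos T j - (i + 1)) (pos T j) (slot T i j) ∪
      hSeg T q.1 q.2 (pos T j - (i + 1)) (pos T i + (j + 1)) (slot T i j) ∪
      vSeg T q.1 q.2 (pos T i + (j + 1)) (slot T i j) (T + pos T i) ∪
      hSeg T q.1 (q.2 + 1) (pos T i) (pos T i + (j + 1)) (pos T i) := by
  have hj := le_pos (T := T) (i := j)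
  -- The truncated subtraction is harmless: `i + 1 ≤ Δ ≤ pos T j`.
  have h1 : ∀ x, x + pos T j - (i + 1) = x + (pos T j - (i + 1)) := by
    intro x; omega
  have h2 : ∀ x, x + pos T i + (j + 1) = x + (pos T i + (j + 1)) := by
    intro x; omega
  have h3 : ∀ x i, x + centerPos T i = x + squareMargin T + pos T i := by
    intro x i; rw [centerPos_eq]; omega
  have h4 : ∀ x, x + squareMargin T + squareSide T + (numCenters T * i + j) =
      x + squareMargin T + slot T i j := by
    intro x; rw [slot]; omega
  have h5 : ∀ x, x + T + centerPos T i = x + squareMargin T + (T + pos T i) := by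
    intro x; rw [centerPos_eq]; omega
  have h6 : ∀ x₁ x₂, hSegment (T * m) x₁ x₂ (T * q.2.val + squareMargin T + (T + pos T i)) =
      hSegment (T * m) x₁ x₂ (T * (q.2 + 1).val + squareMargin T + pos T i) := by
    intro x₁ x₂
    have := crd_add (T := T) q.2 (pos T i)
    rw [crd, crd] at this
    simp only [hSegment, this]
  simp only [upPath, h1, h2, h4, h5, h6, h3]
  rfl

lemma rightPath_eq (q : Vertex m) {i j : ℕ} (hi : i < numCenters T) :
    rightPath T m q i j =
      vSeg T q.1 q.2 (pos T i) (pos T i) (pos T i + (j + 1)) ∪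
      hSeg T q.1 q.2 (pos T i) (slot T i j) (pos T i + (j + 1)) ∪
      vSeg T q.1 q.2 (slot T i j) (pos T i + (j + 1)) (pos T j - (i + 1)) ∪
      hSeg T q.1 q.2 (slot T i j) (T + pos T j) (pos T j - (i + 1)) ∪
      vSeg T (q.1 + 1) q.2 (pos T j) (pos T j - (i + 1)) (pos T j) := by
  have hj := le_pos (T := T) (i := j)
  have h1 : ∀ x, x + pos T j - (i + 1) = x + (pos T j - (i + 1)) := by
    intro x; omega
  have h2 : ∀ x, x + pos T i + (j + 1) = x + (pos T i + (j + 1)) := by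
    intro x; omega
  have h3 : ∀ x i, x + centerPos T i = x + squareMargin T + pos T i := by
    intro x i; rw [centerPos_eq]; omega
  have h4 : ∀ x, x + squareMargin T + squareSide T + (numCenters T * i + j) =
      x + squareMargin T + slot T i j := by
    intro x; rw [slot]; omega
  have h5 : ∀ x, x + T + centerPos T j = x + squareMargin T + (T + pos T j) := by
    intro x; rw [centerPos_eq]; omega
  have h6 : ∀ x₁ x₂, vSegment (T * m) (T * q.1.val + squareMargin T + (T + pos T j)) x₁ x₂ =
      vSegment (T * m) (T * (q.1 + 1).val + squareMargin T + pos T j) x₁ x₂ := by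
    intro x₁ x₂
    have := crd_add (T := T) q.1 (pos T j)
    rw [crd, crd] at this
    simp only [vSegment, this]
  simp only [rightPath, h1, h2, h4, h5, h6, h3]
  rfl

lemma mem_upPath (q : Vertex m) {i j : ℕ} (hi : i < numCenters T) (hj : j < numCenters T)
    (e : Edge (T * m)) : e ∈ upPath T m q j i ↔
      ((((e.2 = false ∧ (blk e.1.2 = q.2 ∧ off e.1.2 = pos T j) ∧ blk e.1.1 = q.1 ∧
            pos T j ≤ off e.1.1 + (i + 1) ∧ off e.1.1 < pos T j) ∨
          (e.2 = true ∧ (blk e.1.1 = q.1 ∧ off e.1.1 + (i + 1) = pos T j) ∧ blk e.1.2 = q.2 ∧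
            pos T j ≤ off e.1.2 ∧ off e.1.2 < slot T i j)) ∨
          (e.2 = false ∧ (blk e.1.2 = q.2 ∧ off e.1.2 = slot T i j) ∧ blk e.1.1 = q.1 ∧
            min (pos T j - (i + 1)) (pos T i + (j + 1)) ≤ off e.1.1 ∧
            off e.1.1 < max (pos T j - (i + 1)) (pos T i + (j + 1)))) ∨
          (e.2 = true ∧ (blk e.1.1 = q.1 ∧ off e.1.1 = pos T i + (j + 1)) ∧
            ((blk e.1.2 = q.2 ∧ slot T i j ≤ off e.1.2) ∨
            (blk e.1.2 = q.2 + 1 ∧ off e.1.2 < pos T i)))) ∨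
          (e.2 = false ∧ (blk e.1.2 = q.2 + 1 ∧ off e.1.2 = pos T i) ∧ blk e.1.1 = q.1 ∧
            pos T i ≤ off e.1.1 ∧ off e.1.1 < pos T i + (j + 1)) := by
  have h1 := le_pos (T := T) (i := j)
  have h2 := pos_lt hi
  have h3 := pos_lt hj
  have h4 := slot_lt hi hj
  have h5 := side_le_slot (T := T) i j
  have e1 : off e.1.1 = pos T j - (i + 1) ↔ off e.1.1 + (i + 1) = pos T j := by omega
  have e2 : pos T j - (i + 1) ≤ off e.1.1 ↔ pos T j ≤ off e.1.1 + (i + 1) := by omega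
  rw [upPath_eq q hi, Set.mem_union, Set.mem_union, Set.mem_union, Set.mem_union,
    mem_hSeg_lt (by omega) (by omega) (by omega), mem_vSeg_lt (by omega) (by omega) (by omega),
    mem_hSeg_lt (by omega) (by omega) (by omega), mem_vSeg_cross (by omega) (by omega) (by omega),
    mem_hSeg_lt (by omega) (by omega) (by omega),
    min_eq_left (by omega : pos T j - (i + 1) ≤ pos T j),
    max_eq_right (by omega : pos T j - (i + 1) ≤ pos T j),
    min_eq_left (by omega : pos T j ≤ slot T i j), max_eq_right (by omega : pos T j ≤ slot T i j),
    min_eq_left (by omega : pos T i ≤ pos T i + (j + 1)),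
    max_eq_right (by omega : pos T i ≤ pos T i + (j + 1)), e1, e2]

lemma mem_rightPath (q : Vertex m) {i j : ℕ} (hi : i < numCenters T) (hj : j < numCenters T)
    (e : Edge (T * m)) : e ∈ rightPath T m q i j ↔
      ((((e.2 = true ∧ (blk e.1.1 = q.1 ∧ off e.1.1 = pos T i) ∧ blk e.1.2 = q.2 ∧
            pos T i ≤ off e.1.2 ∧ off e.1.2 < pos T i + (j + 1)) ∨
          (e.2 = false ∧ (blk e.1.2 = q.2 ∧ off e.1.2 = pos T i + (j + 1)) ∧ blk e.1.1 = q.1 ∧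
            pos T i ≤ off e.1.1 ∧ off e.1.1 < slot T i j)) ∨
          (e.2 = true ∧ (blk e.1.1 = q.1 ∧ off e.1.1 = slot T i j) ∧ blk e.1.2 = q.2 ∧
            min (pos T i + (j + 1)) (pos T j - (i + 1)) ≤ off e.1.2 ∧
            off e.1.2 < max (pos T i + (j + 1)) (pos T j - (i + 1)))) ∨
          (e.2 = false ∧ (blk e.1.2 = q.2 ∧ off e.1.2 + (i + 1) = pos T j) ∧
            ((blk e.1.1 = q.1 ∧ slot T i j ≤ off e.1.1) ∨
            (blk e.1.1 = q.1 + 1 ∧ off e.1.1 < pos T j)))) ∨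
          (e.2 = true ∧ (blk e.1.1 = q.1 + 1 ∧ off e.1.1 = pos T j) ∧ blk e.1.2 = q.2 ∧
            pos T j ≤ off e.1.2 + (i + 1) ∧ off e.1.2 < pos T j) := by
  have h1 := le_pos (T := T) (i := j)
  have h2 := pos_lt hi
  have h3 := pos_lt hj
  have h4 := slot_lt hi hj
  have h5 := side_le_slot (T := T) i j
  have e1 : off e.1.2 = pos T j - (i + 1) ↔ off e.1.2 + (i + 1) = pos T j := by omega
  have e2 : pos T j - (i + 1) ≤ off e.1.2 ↔ pos T j ≤ off e.1.2 + (i + 1) := by omega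
  rw [rightPath_eq q hi, Set.mem_union, Set.mem_union, Set.mem_union, Set.mem_union,
    mem_vSeg_lt (by omega) (by omega) (by omega), mem_hSeg_lt (by omega) (by omega) (by omega),
    mem_vSeg_lt (by omega) (by omega) (by omega), mem_hSeg_cross (by omega) (by omega) (by omega),
    mem_vSeg_lt (by omega) (by omega) (by omega),
    min_eq_left (by omega : pos T i ≤ pos T i + (j + 1)),
    max_eq_right (by omega : pos T i ≤ pos T i + (j + 1)),
    min_eq_left (by omega : pos T i ≤ slot T i j), max_eq_right (by omega : pos T i ≤ slot T i j),
    min_eq_left (by omega : pos T j - (i + 1) ≤ pos T j),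
    max_eq_right (by omega : pos T j - (i + 1) ≤ pos T j), e1, e2]

end Coordinates

end GridSwitching

/-! ### Which path an edge can belong to, how this depends on the two centers, and the ends of a
path. -/

namespace GridSwitching

section Owner

variable {T m : ℕ} [NeZero T] [NeZero m]

/-! ### The owner of an edge -/

open Classical in
/-- The only index whose paths can contain the edge `e`. -/
noncomputable def owner (e : Edge (T * m)) : Edge m :=
  if e.2 = false then
    if squareSide T ≤ off e.1.2 then ((blk e.1.1, blk e.1.2), true)
    else if squareSide T ≤ off e.1.1 then ((blk e.1.1, blk e.1.2), false)
    else if ∃ i, off e.1.2 = pos T i then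
      if off e.1.1 < off e.1.2 then ((blk e.1.1, blk e.1.2), true)
      else ((blk e.1.1, blk e.1.2 - 1), true)
    else if ∃ i, pos T i < off e.1.2 ∧ off e.1.2 ≤ pos T i + numCenters T then
      ((blk e.1.1, blk e.1.2), false)
    else ((blk e.1.1 - 1, blk e.1.2), false)
  else
    if squareSide T ≤ off e.1.1 then ((blk e.1.1, blk e.1.2), false)
    else if squareSide T ≤ off e.1.2 then ((blk e.1.1, blk e.1.2), true)
    else if ∃ i, off e.1.1 = pos T i then
      if off e.1.1 ≤ off e.1.2 then ((blk e.1.1, blk e.1.2), false)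
      else ((blk e.1.1 - 1, blk e.1.2), false)
    else if ∃ i, pos T i < off e.1.1 ∧ off e.1.1 ≤ pos T i + numCenters T then
      ((blk e.1.1, blk e.1.2 - 1), true)
    else ((blk e.1.1, blk e.1.2), true)

/-- Beside each center there are lanes of width `Δ` on both sides, and consecutive centers are `3 *
Δ` apart, so lanes meet neither each other nor another center's line. The next two lemmas have the
same reason. -/
lemma not_exists_eq_pos_of_gt {i v : ℕ} (h₁ : pos T i < v) (h₂ : v ≤ pos T i + numCenters T) :
    ¬ ∃ i', v = pos T i' := by
  rintro ⟨i', h⟩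
  rcases pos_sep' (T := T) i i' with rfl | h | h <;> omega

lemma not_exists_eq_pos_of_lt {i j v : ℕ} (hi : i < numCenters T) (h : v + (i + 1) = pos T j) :
    ¬ ∃ i', v = pos T i' := by
  rintro ⟨i', h⟩
  rcases pos_sep' (T := T) j i' with rfl | h | h <;> omega

lemma not_exists_gt_pos {i j v : ℕ} (hi : i < numCenters T) (h : v + (i + 1) = pos T j) :
    ¬ ∃ i', pos T i' < v ∧ v ≤ pos T i' + numCenters T := by
  rintro ⟨i', h⟩
  rcases pos_sep' (T := T) j i' with rfl | h | h <;> omega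

/-- The offsets tell on which kind of segment the edge lies: a slot, a center's own line, the lane
after a center or the lane before one. Besides the direction of the edge this settles the direction
of the path and the block where it starts, whatever the centers are. -/
lemma owner_of_mem_upPath {q : Vertex m} {i j : ℕ} (hi : i < numCenters T) (hj : j < numCenters T)
    {e : Edge (T * m)} (he : e ∈ upPath T m q j i) : owner e = (q, true) := by
  rw [mem_upPath q hi hj] at he
  have h2 := pos_lt hi
  have h3 := pos_lt hj
  have h5 := side_le_slot (T := T) i j
  obtain ⟨⟨x, y⟩, d⟩ := e
  obtain ⟨q1, q2⟩ := q
  dsimp only at he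
  rcases he with (((⟨rfl, ⟨rfl, ha⟩, rfl, hb, hc⟩ | ⟨rfl, ⟨rfl, ha⟩, rfl, hb, hc⟩) |
    ⟨rfl, ⟨rfl, ha⟩, rfl, hb, hc⟩) | ⟨rfl, ⟨rfl, ha⟩, (⟨rfl, hb⟩ | ⟨hb, hc⟩)⟩) |
    ⟨rfl, ⟨hd, ha⟩, rfl, hb, hc⟩
  · simp only [owner, if_true]
    rw [if_neg (by omega), if_neg (by omega), if_pos ⟨j, ha⟩, if_pos (by omega)]
  · simp only [owner, Bool.true_eq_false, if_false]
    rw [if_neg (by omega)]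
    split_ifs with h1 h4 h6 h7
    · rfl
    · exact absurd h4 (not_exists_eq_pos_of_lt hi ha)
    · exact absurd h4 (not_exists_eq_pos_of_lt hi ha)
    · exact absurd h7 (not_exists_gt_pos hi ha)
    · rfl
  · simp only [owner, if_true]
    rw [if_pos (by omega)]
  · simp only [owner, Bool.true_eq_false, if_false]
    rw [if_neg (by omega), if_pos (by omega)]
  · simp only [owner, Bool.true_eq_false, if_false]
    rw [if_neg (by omega), if_neg (by omega),
      if_neg (not_exists_eq_pos_of_gt (i := i) (by omega) (by omega)), if_pos ⟨i, by omega, by omega⟩,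
      hb, add_sub_cancel_right]
  · simp only [owner, if_true]
    rw [if_neg (by omega), if_neg (by omega), if_pos ⟨i, ha⟩, if_neg (by omega), hd,
      add_sub_cancel_right]

lemma owner_of_mem_rightPath {q : Vertex m} {i j : ℕ} (hi : i < numCenters T)
    (hj : j < numCenters T) {e : Edge (T * m)} (he : e ∈ rightPath T m q i j) :
    owner e = (q, false) := by
  rw [mem_rightPath q hi hj] at he
  have h2 := pos_lt hi
  have h3 := pos_lt hj
  have h5 := side_le_slot (T := T) i j
  obtain ⟨⟨x, y⟩, d⟩ := e
  obtain ⟨q1, q2⟩ := q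
  dsimp only at he
  rcases he with (((⟨rfl, ⟨rfl, ha⟩, rfl, hb, hc⟩ | ⟨rfl, ⟨rfl, ha⟩, rfl, hb, hc⟩) |
    ⟨rfl, ⟨rfl, ha⟩, rfl, hb, hc⟩) | ⟨rfl, ⟨rfl, ha⟩, (⟨rfl, hb⟩ | ⟨hb, hc⟩)⟩) |
    ⟨rfl, ⟨hd, ha⟩, rfl, hb, hc⟩
  · simp only [owner, Bool.true_eq_false, if_false]
    rw [if_neg (by omega), if_neg (by omega), if_pos ⟨i, ha⟩, if_pos (by omega)]
  · simp only [owner, if_true]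
    rw [if_neg (by omega)]
    split_ifs with h1 h4 h6 h7
    · rfl
    · exact absurd h4 (not_exists_eq_pos_of_gt (i := i) (by omega) (by omega))
    · exact absurd h4 (not_exists_eq_pos_of_gt (i := i) (by omega) (by omega))
    · rfl
    · exact absurd ⟨i, by omega, by omega⟩ h7
  · simp only [owner, Bool.true_eq_false, if_false]
    rw [if_pos (by omega)]
  · simp only [owner, if_true]
    rw [if_neg (by omega), if_pos (by omega)]
  · simp only [owner, if_true]
    rw [if_neg (by omega), if_neg (by omega), if_neg (not_exists_eq_pos_of_lt hi ha),
      if_neg (not_exists_gt_pos hi ha), hb, add_sub_cancel_right]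
  · simp only [owner, Bool.true_eq_false, if_false]
    rw [if_neg (by omega), if_neg (by omega), if_pos ⟨j, ha⟩, if_neg (by omega), hd,
      add_sub_cancel_right]

lemma owner_of_mem_livePath {c : Centers T m} {P : Edge m} {e : Edge (T * m)}
    (he : e ∈ livePath c P) : owner e = P := by
  obtain ⟨q, d⟩ := P
  cases d with
  | false => exact owner_of_mem_rightPath (c _).2 (c _).2 (by simpa [livePath] using he)
  | true => exact owner_of_mem_upPath (c _).2 (c _).2 (by simpa [livePath] using he)

/-! ### The dependence of a path on the indices of its ends -/

/-- The pairs of indices are a half-line in a row or column, or at most one pair. -/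
def IsHalfLine (Δ : ℕ) (p : ℕ → ℕ → Prop) : Prop :=
  ∃ j₀ i₀, (∀ j < Δ, ∀ i < Δ, p j i ↔ j = j₀ ∧ i₀ ≤ i) ∨
    (∀ j < Δ, ∀ i < Δ, p j i ↔ i = i₀ ∧ j₀ ≤ j) ∨ (∀ j < Δ, ∀ i < Δ, p j i → j = j₀ ∧ i = i₀)

/-- Only the segments at the two centers can share an edge for several pairs: their line fixes one
index and their length grows with the other. The other three segments run in a lane or a slot that
encodes both indices. -/
lemma isHalfLine_upPath (hm : 3 ≤ m) (q : Vertex m) (e : Edge (T * m)) :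
    IsHalfLine (numCenters T) fun j i => e ∈ upPath T m q j i := by
  have h1 : ∀ z : ZMod m, z + 1 ≠ z := fun z h => one_ne_zero_zmod hm (by simpa using h)
  by_cases hex : ∃ j i, j < numCenters T ∧ i < numCenters T ∧ e ∈ upPath T m q j i
  swap
  · exact ⟨0, 0, .inr (.inr fun j hj i hi he => absurd ⟨j, i, hj, hi, he⟩ hex)⟩
  obtain ⟨j₁, i₁, hj₁, hi₁, he⟩ := hex
  rw [mem_upPath q hi₁ hj₁] at he
  have hp1 := pos_lt hi₁
  have hp2 := pos_lt hj₁
  have hs1 := side_le_slot (T := T) i₁ j₁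
  rcases he with (((⟨hd, ⟨hy, ha⟩, hx, hb, hc⟩ | ⟨hd, ⟨hx, ha⟩, hy, hb, hc⟩) |
    ⟨hd, ⟨hy, ha⟩, hx, hb, hc⟩) | ⟨hd, ⟨hx, ha⟩, hb⟩) | ⟨hd, ⟨hy, ha⟩, hx, hb, hc⟩
  · refine ⟨j₁, pos T j₁ - off e.1.1 - 1, .inl fun j hj i hi => ?_⟩
    beta_reduce
    rw [mem_upPath q hi hj]
    have hs := side_le_slot (T := T) i j
    simp only [hd, hy, hx, true_and, Bool.false_eq_true, false_and, or_false, (h1 _).symm]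
    rcases pos_sep' (T := T) j j₁ with rfl | h | h <;> constructor <;> intro h' <;>
      first | omega | (obtain ⟨rfl, _⟩ := h'; omega)
  · refine ⟨j₁, i₁, .inr (.inr fun j hj i hi h => ?_)⟩
    beta_reduce at h
    rw [mem_upPath q hi hj] at h
    simp only [hd, Bool.true_eq_false, false_and, or_false, false_or, true_and] at h
    rcases h with h | h
    · have := h.1.2
      rcases pos_sep' (T := T) j j₁ with rfl | h | h <;> omega
    · have := h.1.2
      rcases pos_sep' (T := T) i j₁ with rfl | h | h <;> omega
  · refine ⟨j₁, i₁, .inr (.inr fun j hj i hi h => ?_)⟩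
    beta_reduce at h
    rw [mem_upPath q hi hj] at h
    have hp1 := pos_lt hi
    have hp2 := pos_lt hj
    simp only [hd, Bool.false_eq_true, false_and, or_false, true_and] at h
    rcases h with (h | h) | h
    · omega
    · have := slot_inj hj hj₁ (h.1.2.symm.trans ha)
      exact ⟨this.2, this.1⟩
    · omega
  · refine ⟨j₁, i₁, .inr (.inr fun j hj i hi h => ?_)⟩
    beta_reduce at h
    rw [mem_upPath q hi hj] at h
    simp only [hd, Bool.true_eq_false, false_and, or_false, false_or, true_and] at h
    rcases h with h | h
    · have := h.1.2
      rcases pos_sep' (T := T) j i₁ with rfl | h | h <;> omega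
    · have := h.1.2
      rcases pos_sep' (T := T) i i₁ with rfl | h | h <;> omega
  · refine ⟨off e.1.1 - pos T i₁, i₁, .inr (.inl fun j hj i hi => ?_)⟩
    beta_reduce
    rw [mem_upPath q hi hj]
    have hs := side_le_slot (T := T) i j
    have := pos_lt hi
    simp only [hd, hy, hx, true_and, Bool.false_eq_true, false_and, or_false, false_or, h1]
    rcases pos_sep' (T := T) i i₁ with rfl | h | h <;> constructor <;> intro h' <;>
      first | omega | (obtain ⟨rfl, _⟩ := h'; omega)

lemma isHalfLine_rightPath (hm : 3 ≤ m) (q : Vertex m) (e : Edge (T * m)) :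
    IsHalfLine (numCenters T) fun i j => e ∈ rightPath T m q i j := by
  have h1 : ∀ z : ZMod m, z + 1 ≠ z := fun z h => one_ne_zero_zmod hm (by simpa using h)
  by_cases hex : ∃ i j, i < numCenters T ∧ j < numCenters T ∧ e ∈ rightPath T m q i j
  swap
  · exact ⟨0, 0, .inr (.inr fun j hj i hi he => absurd ⟨j, i, hj, hi, he⟩ hex)⟩
  obtain ⟨i₁, j₁, hi₁, hj₁, he⟩ := hex
  rw [mem_rightPath q hi₁ hj₁] at he
  have hp1 := pos_lt hi₁
  have hp2 := pos_lt hj₁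
  have hs1 := side_le_slot (T := T) i₁ j₁
  rcases he with (((⟨hd, ⟨hy, ha⟩, hx, hb, hc⟩ | ⟨hd, ⟨hx, ha⟩, hy, hb, hc⟩) |
    ⟨hd, ⟨hy, ha⟩, hx, hb, hc⟩) | ⟨hd, ⟨hx, ha⟩, hb⟩) | ⟨hd, ⟨hy, ha⟩, hx, hb, hc⟩
  · refine ⟨i₁, off e.1.2 - pos T i₁, .inl fun i hi j hj => ?_⟩
    beta_reduce
    rw [mem_rightPath q hi hj]
    have hs := side_le_slot (T := T) i j
    simp only [hd, hy, hx, true_and, Bool.true_eq_false, false_and, or_false, (h1 _).symm]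
    rcases pos_sep' (T := T) i i₁ with rfl | h | h <;> constructor <;> intro h' <;>
      first | omega | (obtain ⟨rfl, _⟩ := h'; omega)
  · refine ⟨i₁, j₁, .inr (.inr fun i hi j hj h => ?_)⟩
    beta_reduce at h
    rw [mem_rightPath q hi hj] at h
    simp only [hd, Bool.false_eq_true, false_and, or_false, false_or, true_and] at h
    rcases h with h | h
    · have := h.1.2
      rcases pos_sep' (T := T) i i₁ with rfl | h | h <;> omega
    · have := h.1.2
      rcases pos_sep' (T := T) j i₁ with rfl | h | h <;> omega
  · refine ⟨i₁, j₁, .inr (.inr fun i hi j hj h => ?_)⟩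
    beta_reduce at h
    rw [mem_rightPath q hi hj] at h
    have hp1 := pos_lt hi
    have hp2 := pos_lt hj
    simp only [hd, Bool.true_eq_false, false_and, or_false, true_and] at h
    rcases h with (h | h) | h
    · omega
    · have := slot_inj hj hj₁ (h.1.2.symm.trans ha)
      exact ⟨this.1, this.2⟩
    · omega
  · refine ⟨i₁, j₁, .inr (.inr fun i hi j hj h => ?_)⟩
    beta_reduce at h
    rw [mem_rightPath q hi hj] at h
    simp only [hd, Bool.false_eq_true, false_and, or_false, false_or, true_and] at h
    rcases h with h | h
    · have := h.1.2
      rcases pos_sep' (T := T) i j₁ with rfl | h | h <;> omega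
    · have := h.1.2
      rcases pos_sep' (T := T) j j₁ with rfl | h | h <;> omega
  · refine ⟨pos T j₁ - off e.1.2 - 1, j₁, .inr (.inl fun i hi j hj => ?_)⟩
    beta_reduce
    rw [mem_rightPath q hi hj]
    have hs := side_le_slot (T := T) i j
    have := pos_lt hj
    simp only [hd, hy, hx, true_and, Bool.true_eq_false, false_and, or_false, false_or, h1]
    rcases pos_sep' (T := T) j j₁ with rfl | h | h <;> constructor <;> intro h' <;>
      first | omega | (obtain ⟨rfl, _⟩ := h'; omega)

end Owner

/-! ### Degrees of paths -/

section Degrees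

variable {n : ℕ} [NeZero n]

open Classical in
/-- The indicator function of a set of edges. -/
noncomputable def ind {E : Type*} (A : Set E) (e : E) : ZMod 2 := if e ∈ A then 1 else 0

lemma ind_union {E : Type*} {A B : Set E} (h : Disjoint A B) : ind (A ∪ B) = ind A + ind B := by
  funext e
  have := fun hA : e ∈ A => Set.disjoint_left.1 h hA
  by_cases hA : e ∈ A <;> by_cases hB : e ∈ B <;> simp_all [ind]

lemma natCast_injOn_Ico {x₁ x₂ : ℕ} (h : x₂ ≤ x₁ + n) {x x' : ℕ} (h1 : x₁ ≤ x) (h2 : x < x₂)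
    (h1' : x₁ ≤ x') (h2' : x' < x₂) (hxx : (x : ZMod n) = x') : x = x' := by
  rw [ZMod.natCast_eq_natCast_iff] at hxx
  wlog hle : x ≤ x' generalizing x x'
  · exact (this h1' h2' h1 h2 hxx.symm (by omega)).symm
  have h3 := (Nat.modEq_iff_dvd' hle).1 hxx
  have h4 := Nat.eq_zero_of_dvd_of_lt h3 (by omega)
  omega

lemma sum_Ico_telescope {α : Type*} [DecidableEq α] (f : ℕ → α) (v : α) {a b : ℕ} (hab : a ≤ b) :
    ∑ x ∈ Finset.Ico a b, ((if v = f x then 1 else 0) + (if v = f (x + 1) then 1 else 0) : ZMod 2) =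
      (if v = f a then 1 else 0) + (if v = f b then 1 else 0) := by
  induction b, hab using Nat.le_induction with
  | base => rw [Finset.Ico_self, Finset.sum_empty, CharTwo.add_self_eq_zero]
  | succ b hab ih =>
    rw [Finset.sum_Ico_succ_top hab, ih]
    have := CharTwo.add_self_eq_zero (if v = f b then 1 else 0 : ZMod 2)
    linear_combination this

open Classical in
lemma deg_ind_of_param (hn : 3 ≤ n) (A : Set (Edge n)) (g : ℕ → Edge n) (f : ℕ → Vertex n)
    {a b : ℕ} (hab : a ≤ b) (hA : ∀ e, e ∈ A ↔ ∃ x, a ≤ x ∧ x < b ∧ e = g x)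
    (hg : ∀ x x', a ≤ x → x < b → a ≤ x' → x' < b → g x = g x' → x = x')
    (hf : ∀ x, (g x).1 = f x ∧ (g x).target = f (x + 1)) (v : Vertex n) :
    deg (ind A) v = (if v = f a then 1 else 0) + (if v = f b then 1 else 0) := by
  have h1 : ind A = ∑ x ∈ Finset.Ico a b, Pi.single (g x) (1 : ZMod 2) := by
    funext e
    rw [Finset.sum_apply]
    by_cases he : e ∈ A
    · obtain ⟨x, hx1, hx2, rfl⟩ := (hA e).1 he
      rw [Finset.sum_eq_single x]
      · simp [ind, he]
      · intro x' hx' hne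
        rw [Finset.mem_Ico] at hx'
        exact Pi.single_eq_of_ne (fun h => hne (hg x x' hx1 hx2 hx'.1 hx'.2 h).symm) _
      · intro h; exact absurd (Finset.mem_Ico.2 ⟨hx1, hx2⟩) h
    · rw [Finset.sum_eq_zero]
      · simp [ind, he]
      · intro x hx
        rw [Finset.mem_Ico] at hx
        exact Pi.single_eq_of_ne (fun h => he ((hA e).2 ⟨x, hx.1, hx.2, h⟩)) _
  rw [h1, deg_sum, ← sum_Ico_telescope f v hab]
  refine Finset.sum_congr rfl fun x _ => ?_
  rw [deg_single hn, (hf x).1, (hf x).2]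

open Classical in
lemma deg_hSegment (hn : 3 ≤ n) {x₁ x₂ : ℕ} (y : ℕ) (h₁ : x₂ ≤ x₁ + n) (h₂ : x₁ ≤ x₂ + n)
    (v : Vertex n) : deg (ind (hSegment n x₁ x₂ y)) v =
      (if v = ((x₁ : ZMod n), (y : ZMod n)) then 1 else 0) +
        (if v = ((x₂ : ZMod n), (y : ZMod n)) then 1 else 0) := by
  wlog hle : x₁ ≤ x₂ generalizing x₁ x₂
  · have := this h₂ h₁ (by omega)
    rw [add_comm, ← this]
    simp only [hSegment, min_comm, max_comm]
  refine deg_ind_of_param hn _ (fun x => (((x : ZMod n), (y : ZMod n)), false))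
    (fun x => ((x : ZMod n), (y : ZMod n))) hle ?_ ?_ ?_ v
  · intro e; simp only [hSegment, min_eq_left hle, max_eq_right hle, Set.mem_ofPred_eq]
  · intro x x' a1 a2 a3 a4 h
    simp only [Prod.mk.injEq] at h
    exact natCast_injOn_Ico h₁ a1 a2 a3 a4 h.1.1
  · intro x; exact ⟨rfl, by simp [Edge.target]⟩

open Classical in
lemma deg_vSegment (hn : 3 ≤ n) (x : ℕ) {y₁ y₂ : ℕ} (h₁ : y₂ ≤ y₁ + n) (h₂ : y₁ ≤ y₂ + n)
    (v : Vertex n) : deg (ind (vSegment n x y₁ y₂)) v =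
      (if v = ((x : ZMod n), (y₁ : ZMod n)) then 1 else 0) +
        (if v = ((x : ZMod n), (y₂ : ZMod n)) then 1 else 0) := by
  wlog hle : y₁ ≤ y₂ generalizing y₁ y₂
  · have := this h₂ h₁ (by omega)
    rw [add_comm, ← this]
    simp only [vSegment, min_comm, max_comm]
  refine deg_ind_of_param hn _ (fun y => (((x : ZMod n), (y : ZMod n)), true))
    (fun y => ((x : ZMod n), (y : ZMod n))) hle ?_ ?_ ?_ v
  · intro e; simp only [vSegment, min_eq_left hle, max_eq_right hle, Set.mem_ofPred_eq]
  · intro x x' a1 a2 a3 a4 h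
    simp only [Prod.mk.injEq] at h
    exact natCast_injOn_Ico h₁ a1 a2 a3 a4 h.1.2
  · intro x; exact ⟨rfl, by simp [Edge.target]⟩

end Degrees

section PathDegrees

variable {T m : ℕ} [NeZero T] [NeZero m]

lemma three_mul_le (hm : 3 ≤ m) : 3 * T ≤ T * m := by
  rw [mul_comm]; exact Nat.mul_le_mul_left T hm

open Classical in
lemma deg_hSeg (hm : 3 ≤ m) (a b : ZMod m) {r₁ r₂ s : ℕ} (h₁ : r₁ ≤ 2 * T) (h₂ : r₂ ≤ 2 * T)
    (v : Vertex (T * m)) : deg (ind (hSeg T a b r₁ r₂ s)) v =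
      (if v = (crd T a r₁, crd T b s) then 1 else 0) +
        (if v = (crd T a r₂, crd T b s) then 1 else 0) := by
  have h := three_mul_le (T := T) hm
  have := NeZero.pos T
  exact deg_hSegment (by omega) _ (by omega) (by omega) v

open Classical in
lemma deg_vSeg (hm : 3 ≤ m) (a b : ZMod m) {r s₁ s₂ : ℕ} (h₁ : s₁ ≤ 2 * T) (h₂ : s₂ ≤ 2 * T)
    (v : Vertex (T * m)) : deg (ind (vSeg T a b r s₁ s₂)) v =
      (if v = (crd T a r, crd T b s₁) then 1 else 0) +
        (if v = (crd T a r, crd T b s₂) then 1 else 0) := by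
  have h := three_mul_le (T := T) hm
  have := NeZero.pos T
  exact deg_vSegment (by omega) _ (by omega) (by omega) v

open Classical in
-- The joints of the five segments cancel in pairs. Disjointness of the segments is needed so that
-- the indicator of the union is the sum of the indicators.
lemma deg_upPath (hm : 3 ≤ m) (q : Vertex m) {i j : ℕ} (hi : i < numCenters T)
    (hj : j < numCenters T) (v : Vertex (T * m)) : deg (ind (upPath T m q j i)) v =
      (if v = (crd T q.1 (pos T j), crd T q.2 (pos T j)) then 1 else 0) +
        (if v = (crd T q.1 (pos T i), crd T (q.2 + 1) (pos T i)) then 1 else 0) := by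
  have h1 := le_pos (T := T) (i := j)
  have h2 := pos_lt hi
  have h3 := pos_lt hj
  have h4 := slot_lt hi hj
  have h5 := side_le_slot (T := T) i j
  have h6 : ∀ z : ZMod m, z + 1 ≠ z := fun z h => one_ne_zero_zmod hm (by simpa using h)
  rw [upPath_eq q hi, ind_union, ind_union, ind_union, ind_union]
  · simp only [deg_add]
    rw [deg_hSeg hm _ _ (by omega) (by omega), deg_vSeg hm _ _ (by omega) (by omega),
      deg_hSeg hm _ _ (by omega) (by omega), deg_vSeg hm _ _ (by omega) (by omega),
      deg_hSeg hm _ _ (by omega) (by omega), crd_add]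
    have hz : ∀ z : ZMod 2, z + z = 0 := CharTwo.add_self_eq_zero
    linear_combination hz (if v = (crd T q.1 (pos T j - (i + 1)), crd T q.2 (pos T j)) then 1 else 0) +
      hz (if v = (crd T q.1 (pos T j - (i + 1)), crd T q.2 (slot T i j)) then 1 else 0) +
      hz (if v = (crd T q.1 (pos T i + (j + 1)), crd T q.2 (slot T i j)) then 1 else 0) +
      hz (if v = (crd T q.1 (pos T i + (j + 1)), crd T (q.2 + 1) (pos T i)) then 1 else 0)
  all_goals
    rw [Set.disjoint_left]
    intro e he he'
    try simp only [Set.mem_union] at he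
    simp only [mem_hSeg, mem_vSeg, eq_crd_iff (show pos T j < T by omega),
      eq_crd_iff (show slot T i j < T by omega), eq_crd_iff (show pos T i < T by omega),
      eq_crd_iff (show pos T j - (i + 1) < T by omega),
      eq_crd_iff (show pos T i + (j + 1) < T by omega)] at he he'
  · exact absurd (he.1.symm.trans he'.1) (by simp)
  · rcases he with he | he
    · have := he.2.1.2; have := he'.2.1.2; omega
    · exact absurd (he.1.symm.trans he'.1) (by simp)
  · rcases he with (he | he) | he
    · exact absurd (he.1.symm.trans he'.1) (by simp)
    · have := he.2.1.2; have := he'.2.1.2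
      rcases pos_sep' (T := T) i j with rfl | h | h <;> omega
    · exact absurd (he.1.symm.trans he'.1) (by simp)
  · rcases he with ((he | he) | he) | he
    · exact h6 _ (he'.2.1.1.symm.trans he.2.1.1)
    · exact absurd (he.1.symm.trans he'.1) (by simp)
    · exact h6 _ (he'.2.1.1.symm.trans he.2.1.1)
    · exact absurd (he.1.symm.trans he'.1) (by simp)

open Classical in
lemma deg_rightPath (hm : 3 ≤ m) (q : Vertex m) {i j : ℕ} (hi : i < numCenters T)
    (hj : j < numCenters T) (v : Vertex (T * m)) : deg (ind (rightPath T m q i j)) v =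
      (if v = (crd T q.1 (pos T i), crd T q.2 (pos T i)) then 1 else 0) +
        (if v = (crd T (q.1 + 1) (pos T j), crd T q.2 (pos T j)) then 1 else 0) := by
  have h1 := le_pos (T := T) (i := j)
  have h2 := pos_lt hi
  have h3 := pos_lt hj
  have h4 := slot_lt hi hj
  have h5 := side_le_slot (T := T) i j
  have h6 : ∀ z : ZMod m, z + 1 ≠ z := fun z h => one_ne_zero_zmod hm (by simpa using h)
  rw [rightPath_eq q hi, ind_union, ind_union, ind_union, ind_union]
  · simp only [deg_add]
    rw [deg_vSeg hm _ _ (by omega) (by omega), deg_hSeg hm _ _ (by omega) (by omega),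
      deg_vSeg hm _ _ (by omega) (by omega), deg_hSeg hm _ _ (by omega) (by omega),
      deg_vSeg hm _ _ (by omega) (by omega), crd_add]
    have hz : ∀ z : ZMod 2, z + z = 0 := CharTwo.add_self_eq_zero
    linear_combination hz (if v = (crd T q.1 (pos T i), crd T q.2 (pos T i + (j + 1))) then 1 else 0) +
      hz (if v = (crd T q.1 (slot T i j), crd T q.2 (pos T i + (j + 1))) then 1 else 0) +
      hz (if v = (crd T q.1 (slot T i j), crd T q.2 (pos T j - (i + 1))) then 1 else 0) +
      hz (if v = (crd T (q.1 + 1) (pos T j), crd T q.2 (pos T j - (i + 1))) then 1 else 0)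
  all_goals
    rw [Set.disjoint_left]
    intro e he he'
    try simp only [Set.mem_union] at he
    simp only [mem_hSeg, mem_vSeg, eq_crd_iff (show pos T j < T by omega),
      eq_crd_iff (show slot T i j < T by omega), eq_crd_iff (show pos T i < T by omega),
      eq_crd_iff (show pos T j - (i + 1) < T by omega),
      eq_crd_iff (show pos T i + (j + 1) < T by omega)] at he he'
  · exact absurd (he.1.symm.trans he'.1) (by simp)
  · rcases he with he | he
    · have := he.2.1.2; have := he'.2.1.2; omega
    · exact absurd (he.1.symm.trans he'.1) (by simp)
  · rcases he with (he | he) | he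
    · exact absurd (he.1.symm.trans he'.1) (by simp)
    · have := he.2.1.2; have := he'.2.1.2
      rcases pos_sep' (T := T) i j with rfl | h | h <;> omega
    · exact absurd (he.1.symm.trans he'.1) (by simp)
  · rcases he with ((he | he) | he) | he
    · exact h6 _ (he'.2.1.1.symm.trans he.2.1.1)
    · exact absurd (he.1.symm.trans he'.1) (by simp)
    · exact h6 _ (he'.2.1.1.symm.trans he.2.1.1)
    · exact absurd (he.1.symm.trans he'.1) (by simp)

lemma centerVertex_eq (c : Centers T m) (q : Vertex m) :
    centerVertex c q = (crd T q.1 (pos T (c q)), crd T q.2 (pos T (c q))) := by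
  simp only [centerVertex, crd, centerPos_eq, add_assoc]

lemma centerVertex_injective (c : Centers T m) : Function.Injective (centerVertex c) := by
  intro q q' h
  have hT : ∀ q, pos T (c q) < T := by
    intro q
    have h1 := pos_lt (c q).2
    have h2 := slot_lt (c q).2 (c q).2
    have h3 := side_le_slot (T := T) (c q) (c q)
    omega
  rw [centerVertex_eq, centerVertex_eq, Prod.mk.injEq] at h
  exact Prod.ext (crd_inj (hT q) (hT q') h.1).1 (crd_inj (hT q) (hT q') h.2).1

open Classical in
lemma deg_livePath (hm : 3 ≤ m) (c : Centers T m) (P : Edge m) (v : Vertex (T * m)) :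
    deg (ind (livePath c P)) v = (if v = centerVertex c P.1 then 1 else 0) +
      (if v = centerVertex c P.target then 1 else 0) := by
  obtain ⟨q, d⟩ := P
  cases d with
  | false =>
    have := deg_rightPath hm q (c q).2 (c (Edge.target (q, false))).2 v
    simp only [livePath, Bool.false_eq_true, if_false, this, centerVertex_eq]
    rfl
  | true =>
    have := deg_upPath hm q (c (Edge.target (q, true))).2 (c q).2 v
    simp only [livePath, if_true, this, centerVertex_eq]
    rfl

end PathDegrees

end GridSwitching

/-! ### The grid as an instance of the abstract coding. -/

namespace GridSwitching

/-! ### Change of indices -/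

namespace Coding

variable {V X E : Type} {S : Coding V X E} {c c' : V → ℕ}

lemma val_of_mem {x : X → ZMod 2} {e : E} (h : S.mem e (((S.rv e).map c).getD 0)) :
    S.val c x e = S.base e + (x (S.own e) + S.ref (S.own e)) := by rw [val, if_pos h]

lemma val_of_not_mem {x : X → ZMod 2} {e : E} (h : ¬ S.mem e (((S.rv e).map c).getD 0)) :
    S.val c x e = S.base e := by rw [val, if_neg h, add_zero]

lemma val_congr (h : ∀ e q, S.rv e = some q → c q = c' q) : S.val c = S.val c' := by
  funext x e
  have : ((S.rv e).map c).getD 0 = ((S.rv e).map c').getD 0 := by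
    cases hq : S.rv e with
    | none => rfl
    | some q => simp [h e q hq]
  by_cases hm : S.mem e (((S.rv e).map c).getD 0)
  · rw [val_of_mem hm, val_of_mem (this ▸ hm)]
  · rw [val_of_not_mem hm, val_of_not_mem (this ▸ hm)]

lemma Run.congr (h : ∀ e q, S.rv e = some q → c q = c' q) {R : Finset V}
    {l : List (X × ZMod 2 × ZMod 2)} {D : ℕ → List (E × ZMod 2)} {x : ℕ → X → ZMod 2}
    (hR : ∀ q ∈ R, c q = c' q) (hr : S.Run c R l D x) : S.Run c' R l D x := by
  have hv := val_congr h
  refine ⟨hr.length, ?_, hr.cons, ?_, hr.query, ?_⟩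
  · have hs : S.Satisfiable c = S.Satisfiable c' := by
      funext l D; simp only [Satisfiable, hv]
    exact hs ▸ hr.first
  · rw [← hv]; exact hr.sat
  · intro q hq; rw [← hR q hq]; exact hr.window q hq

lemma needed_congr (h : ∀ e q, S.rv e = some q → c q = c' q) {D : ℕ → List (E × ZMod 2)} {q : V}
    {d u : ℕ} : S.Needed c D q d u ↔ S.Needed c' D q d u := by
  constructor
  · rintro ⟨l, h1, h2, h3⟩; exact ⟨l, h1, h2, h _ _ h2 ▸ h3⟩
  · rintro ⟨l, h1, h2, h3⟩; exact ⟨l, h1, h2, (h _ _ h2).symm ▸ h3⟩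

lemma pend_congr (h : ∀ e q, S.rv e = some q → c q = c' q) {R : Finset V}
    {D : ℕ → List (E × ZMod 2)} {x : ℕ → X → ZMod 2} {u : ℕ} {q : V} {d : ℕ} :
    S.Pend c R D x u q d ↔ S.Pend c' R D x u q d := by
  simp only [Pend, FirstAt, needed_congr h]

end Coding

section GridCoding

variable {T m : ℕ} [NeZero T] [NeZero m]

/-- The path of index `P` between the centers with indices `j` and `i`. -/
def pathAt (T : ℕ) {m : ℕ} (P : Edge m) (j i : ℕ) : Set (Edge (T * m)) :=
  if P.2 then upPath T m P.1 j i else rightPath T m P.1 j i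

lemma livePath_eq (c : Centers T m) (P : Edge m) :
    livePath c P = pathAt T P (c P.1) (c P.target) := rfl

lemma isHalfLine_pathAt (hm : 3 ≤ m) (P : Edge m) (e : Edge (T * m)) :
    IsHalfLine (numCenters T) fun j i => e ∈ pathAt T P j i := by
  obtain ⟨q, d⟩ := P
  cases d with
  | false => simpa [pathAt] using isHalfLine_rightPath hm q e
  | true => simpa [pathAt] using isHalfLine_upPath hm q e

open Classical in
/-- The indices `c₀`, replaced by `i` on `R₀`. -/
noncomputable def idx (R₀ : Set (Vertex m)) (c₀ : Vertex m → ℕ) (i : ℕ) (v : Vertex m) : ℕ :=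
  if v ∈ R₀ then i else c₀ v

lemma idx_of_mem {R₀ : Set (Vertex m)} {c₀ : Vertex m → ℕ} {i : ℕ} {v : Vertex m} (h : v ∈ R₀) :
    idx R₀ c₀ i v = i := if_pos h

lemma idx_of_notMem {R₀ : Set (Vertex m)} {c₀ : Vertex m → ℕ} {i : ℕ} {v : Vertex m}
    (h : v ∉ R₀) : idx R₀ c₀ i v = c₀ v := if_neg h

open Classical in
/-- The endpoint of `P` in `R₀`. -/
noncomputable def rootEnd (R₀ : Set (Vertex m)) (P : Edge m) : Option (Vertex m) :=
  if P.1 ∈ R₀ then some P.1 else if P.target ∈ R₀ then some P.target else none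

/-- No edge has both endpoints in `R₀`. -/
def IsIndepSet (R₀ : Set (Vertex m)) : Prop := ∀ P : Edge m, P.1 ∈ R₀ → P.target ∉ R₀

lemma rootEnd_eq_some {R₀ : Set (Vertex m)} {P : Edge m} {q : Vertex m}
    (h : rootEnd R₀ P = some q) : q ∈ R₀ ∧ q ∈ P.ends := by
  rw [rootEnd] at h
  split_ifs at h with h1 h2
  · obtain rfl := Option.some.inj h; exact ⟨h1, Edge.mem_ends.2 (.inl rfl)⟩
  · obtain rfl := Option.some.inj h; exact ⟨h2, Edge.mem_ends.2 (.inr rfl)⟩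

lemma rootEnd_of_mem {R₀ : Set (Vertex m)} (hR : IsIndepSet R₀) {P : Edge m} {q : Vertex m}
    (h : q ∈ R₀) (hq : q ∈ P.ends) : rootEnd R₀ P = some q := by
  rw [rootEnd]
  rcases Edge.mem_ends.1 hq with rfl | rfl
  · rw [if_pos h]
  · rw [if_neg fun h' => hR P h' h, if_pos h]

/-- With index `i` on `R₀` and `c₀` elsewhere, the edge `e` is on a path. -/
def Touch (R₀ : Set (Vertex m)) (c₀ : Vertex m → ℕ) (e : Edge (T * m)) (i : ℕ) : Prop :=
  e ∈ pathAt T (owner e) (idx R₀ c₀ i (owner e).1) (idx R₀ c₀ i (owner e).target)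

/-- At most one end of the owner lies in `R₀`; fixing the index of the other end cuts a half-line of
pairs down to an upper interval or at most a point. -/
lemma exists_pivot (hm : 3 ≤ m) {R₀ : Set (Vertex m)} (hR : IsIndepSet R₀) {c₀ : Vertex m → ℕ}
    (hc₀ : ∀ v, c₀ v < numCenters T) (e : Edge (T * m)) : ∃ p,
      (∀ i < numCenters T, Touch R₀ c₀ e i ↔ p ≤ i) ∨
        (∀ i < numCenters T, Touch R₀ c₀ e i → i = p) := by
  obtain ⟨j₀, i₀, h⟩ := isHalfLine_pathAt hm (owner e) e
  have ha := hc₀ (owner e).1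
  have hb := hc₀ (owner e).target
  by_cases h1 : (owner e).1 ∈ R₀
  · have h2 : (owner e).target ∉ R₀ := hR _ h1
    simp only [Touch, idx_of_mem h1, idx_of_notMem h2]
    rcases h with h | h | h
    · exact ⟨j₀, .inr fun i hi hp => ((h i hi _ hb).1 hp).1⟩
    · by_cases hi₀ : c₀ (owner e).target = i₀
      · exact ⟨j₀, .inl fun i hi => (h i hi _ hb).trans (by simp [hi₀])⟩
      · exact ⟨j₀, .inr fun i hi hp => absurd ((h i hi _ hb).1 hp).1 hi₀⟩
    · exact ⟨j₀, .inr fun i hi hp => (h i hi _ hb hp).1⟩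
  · by_cases h2 : (owner e).target ∈ R₀
    · simp only [Touch, idx_of_mem h2, idx_of_notMem h1]
      rcases h with h | h | h
      · by_cases hj₀ : c₀ (owner e).1 = j₀
        · exact ⟨i₀, .inl fun i hi => (h _ ha i hi).trans (by simp [hj₀])⟩
        · exact ⟨i₀, .inr fun i hi hp => absurd ((h _ ha i hi).1 hp).1 hj₀⟩
      · exact ⟨i₀, .inr fun i hi hp => ((h _ ha i hi).1 hp).1⟩
      · exact ⟨i₀, .inr fun i hi hp => (h _ ha i hi hp).2⟩
    · simp only [Touch, idx_of_notMem h1, idx_of_notMem h2]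
      by_cases hp : e ∈ pathAt T (owner e) (c₀ (owner e).1) (c₀ (owner e).target)
      · exact ⟨0, .inl fun i _ => by simp [hp]⟩
      · exact ⟨0, .inr fun i _ h => absurd h hp⟩

/-- The coding of the indices on `R₀`, for fixed indices `c₀` elsewhere, a fixed assignment `A` and
a reference assignment `x₀`. -/
noncomputable def gridCoding (R₀ : Set (Vertex m)) (c₀ : Vertex m → ℕ)
    (A : Edge (T * m) → ZMod 2) (x₀ : Edge m → ZMod 2) (ℓ L o t : ℕ) (G : ℕ → DNF (T * m)) :
    Coding (Vertex m) (Edge m) (Edge (T * m)) where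
  L := L
  o := o
  t := t
  own := owner
  rv e := rootEnd R₀ (owner e)
  mem := Touch R₀ c₀
  pv e := Classical.epsilon fun p => (∀ i < numCenters T, Touch R₀ c₀ e i ↔ p ≤ i) ∨
        (∀ i < numCenters T, Touch R₀ c₀ e i → i = p)
  base := A
  ref := x₀
  cons D h := Cons owner D (roundState ℓ (Restriction.empty m) h)
  fml u := G (u / (ℓ + 1))

lemma isPivot_gridCoding (hm : 3 ≤ m) {R₀ : Set (Vertex m)} (hR : IsIndepSet R₀)
    {c₀ : Vertex m → ℕ} (hc₀ : ∀ v, c₀ v < numCenters T) {A : Edge (T * m) → ZMod 2}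
    {x₀ : Edge m → ZMod 2} {ℓ L o t : ℕ} {G : ℕ → DNF (T * m)} (ho : o + 2 ^ L ≤ numCenters T) :
    (gridCoding R₀ c₀ A x₀ ℓ L o t G).IsPivot := by
  intro e
  rcases Classical.epsilon_spec (exists_pivot hm hR hc₀ e) with h | h
  · exact .inl fun i hi => h i (hi.2.trans_le ho)
  · exact .inr fun i hi => h i (hi.2.trans_le ho)

/-- The coding uses the fixed indices only off `R₀`; the decoder therefore knows it before it knows
the centers on `R₀`. -/
lemma gridCoding_congr {R₀ : Set (Vertex m)} {c₀ c₁ : Vertex m → ℕ} (h : ∀ v ∉ R₀, c₀ v = c₁ v)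
    (A : Edge (T * m) → ZMod 2) (x₀ : Edge m → ZMod 2) (ℓ L o t : ℕ) (G : ℕ → DNF (T * m)) :
    gridCoding R₀ c₀ A x₀ ℓ L o t G = gridCoding R₀ c₁ A x₀ ℓ L o t G := by
  have : idx R₀ c₀ = idx R₀ c₁ := by
    funext i v
    by_cases hv : v ∈ R₀
    · rw [idx_of_mem hv, idx_of_mem hv]
    · rw [idx_of_notMem hv, idx_of_notMem hv, h v hv]
  have : Touch (T := T) R₀ c₀ = Touch R₀ c₁ := by funext e i; simp only [Touch, this]
  simp only [gridCoding, this]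

/-! ### The substituted variables -/

open Classical in
/-- The change of a suggested assignment when the variables `x_P` are shifted by `x₀`. -/
noncomputable def shift (c : Centers T m) (x₀ : Edge m → ZMod 2) : Edge (T * m) → ZMod 2 :=
  ∑ P : Edge m, fun e => x₀ P * ind (livePath c P) e

lemma shift_apply (c : Centers T m) (x₀ : Edge m → ZMod 2) (e : Edge (T * m)) :
    shift c x₀ e = x₀ (owner e) * ind (livePath c (owner e)) e := by
  rw [shift, Finset.sum_apply]
  refine Finset.sum_eq_single _ (fun P _ hP => ?_) (by simp)
  have : e ∉ livePath c P := fun h => hP (owner_of_mem_livePath h).symm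
  simp [ind, this]

lemma gridRestriction_eq_inr {c : Centers T m} {a : Edge (T * m) → ZMod 2} {e : Edge (T * m)}
    {P : Edge m} {d : ZMod 2} (h : gridRestriction c a e = .inr (P, d)) :
    owner e = P ∧ e ∈ livePath c P := by
  rw [gridRestriction] at h
  split_ifs at h with h1
  have h2 := h1.choose_spec
  rw [(Prod.mk.inj (Sum.inr.inj h)).1] at h2
  exact ⟨owner_of_mem_livePath h2, h2⟩

open Classical in
lemma val_gridRestriction (c : Centers T m) (a : Edge (T * m) → ZMod 2) (x : Edge m → ZMod 2)
    (e : Edge (T * m)) : Subst.val (gridRestriction c a) x e =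
      a e + if e ∈ livePath c (owner e) then x (owner e) else 0 := by
  by_cases h : ∃ P, e ∈ livePath c P
  · have h1 := owner_of_mem_livePath h.choose_spec
    have h2 : e ∈ livePath c (owner e) := by rw [h1]; exact h.choose_spec
    simp only [Subst.val, gridRestriction, dif_pos h]
    rw [if_pos h2, ← h1, add_comm]
  · have h2 : e ∉ livePath c (owner e) := fun h2 => h ⟨_, h2⟩
    simp only [Subst.val, gridRestriction, dif_neg h]
    rw [if_neg h2, add_zero]

lemma touch_root {R₀ : Set (Vertex m)} (hR : IsIndepSet R₀) (c : Vertex m → ℕ)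
    (e : Edge (T * m)) : Touch R₀ c e (((rootEnd R₀ (owner e)).map c).getD 0) ↔
      e ∈ pathAt T (owner e) (c (owner e).1) (c (owner e).target) := by
  rw [Touch]
  by_cases h1 : (owner e).1 ∈ R₀
  · have h2 : (owner e).target ∉ R₀ := hR _ h1
    simp [rootEnd, h1, idx_of_mem h1, idx_of_notMem h2]
  · by_cases h2 : (owner e).target ∈ R₀
    · simp [rootEnd, h1, h2, idx_of_mem h2, idx_of_notMem h1]
    · rw [idx_of_notMem h1, idx_of_notMem h2]

/-- On a path the reference occurs twice, once in the shifted base and once in `x + ref`, and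
cancels. -/
lemma val_gridCoding {R₀ : Set (Vertex m)} (hR : IsIndepSet R₀) (c : Centers T m)
    (a : Edge (T * m) → ZMod 2) (x₀ : Edge m → ZMod 2) (ℓ L o t : ℕ) (G : ℕ → DNF (T * m)) :
    (gridCoding R₀ (fun v => c v) (a + shift c x₀) x₀ ℓ L o t G).val (fun v => c v) =
      Subst.val (gridRestriction c a) := by
  funext x e
  rw [val_gridRestriction]
  have h : _ ↔ e ∈ livePath c (owner e) := touch_root hR (fun v => (c v : ℕ)) e
  by_cases hp : e ∈ livePath c (owner e)
  · rw [if_pos hp, Coding.val_of_mem (h.2 hp)]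
    simp only [gridCoding, Pi.add_apply, shift_apply, ind, if_pos hp]
    have := CharTwo.add_self_eq_zero (x₀ (owner e))
    linear_combination this
  · rw [if_neg hp, Coding.val_of_not_mem (mt h.1 hp)]
    simp only [gridCoding, Pi.add_apply, shift_apply, ind, if_neg hp]
    ring

lemma satisfiable_gridCoding {R₀ : Set (Vertex m)} (hR : IsIndepSet R₀) (c : Centers T m)
    (a : Edge (T * m) → ZMod 2) (x₀ : Edge m → ZMod 2) (ℓ L o t : ℕ) (G : ℕ → DNF (T * m))
    (h : List (Query m)) (D : Term (T * m)) :
    (gridCoding R₀ (fun v => c v) (a + shift c x₀) x₀ ℓ L o t G).Satisfiable (fun v => c v) h D ↔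
      Alive owner (gridRestriction c a) D (roundState ℓ (Restriction.empty m) h) := by
  rw [Coding.Satisfiable, val_gridCoding hR]
  rfl

end GridCoding


end GridSwitching

/-! ### Nine colours, and reference assignments built from colours of faces. -/

namespace GridSwitching

section Colours

variable {m : ℕ} [NeZero m]

/-! ### Colour classes of the small torus -/

/-- A proper colouring of the cycle with three colours. -/
def colour3 (z : ZMod m) : Fin 3 :=
  if z.val + 1 = m then 2 else if z.val % 2 = 0 then 0 else 1

lemma colour3_add_one_ne (hm : 3 ≤ m) (z : ZMod m) : colour3 (z + 1) ≠ colour3 z := by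
  have : Fact (1 < m) := ⟨by omega⟩
  by_cases h : z.val + 1 = m
  · have h1 : z + 1 = 0 := by
      have : ((z.val + 1 : ℕ) : ZMod m) = 0 := by rw [h]; simp
      simpa using this
    have h2 : colour3 z = 2 := if_pos h
    rw [h1, h2, colour3, ZMod.val_zero, if_neg (by omega)]
    simp
  · have h1 : (z + 1).val = z.val + 1 := by
      have := ZMod.val_lt z
      rw [ZMod.val_add, ZMod.val_one, Nat.mod_eq_of_lt (by omega)]
    simp only [colour3, h1, if_neg h]
    split_ifs <;> simp <;> omega

/-- A colouring of the torus with nine colours. -/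
def colour (v : Vertex m) : Fin 3 × Fin 3 := (colour3 v.1, colour3 v.2)

lemma isIndepSet_colour (hm : 3 ≤ m) (κ : Fin 3 × Fin 3) :
    IsIndepSet {v : Vertex m | colour v = κ} := by
  rintro ⟨v, d⟩ h h'
  rw [Set.mem_ofPred_eq] at h h'
  rw [← h] at h'
  cases d
  · exact colour3_add_one_ne hm v.1 (Prod.mk.inj h').1
  · exact colour3_add_one_ne hm v.2 (Prod.mk.inj h').2

/-! ### Reference assignments -/

open Classical in
/-- The reference assignment for `R₀`: one edge at each vertex of `R₀`, changed by the sum of `φ`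
over the two faces at each edge. -/
noncomputable def refAssign (R₀ : Set (Vertex m)) (φ : Fin 3 × Fin 3 → ZMod 2) (P : Edge m) :
    ZMod 2 :=
  (if P.2 = false ∧ P.1 ∈ R₀ then 1 else 0) +
    (φ (colour P.1) +
      φ (colour (if P.2 then (P.1.1 - 1, P.1.2) else (P.1.1, P.1.2 - 1))))

lemma notMem_left {R₀ : Set (Vertex m)} (hR : IsIndepSet R₀) {q : Vertex m} (hq : q ∈ R₀) :
    (q.1 - 1, q.2) ∉ R₀ := fun h => hR ((q.1 - 1, q.2), false) h (by
      simpa [Edge.target_false] using hq)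

/-- Each of the four faces at `q` borders two edges at `q`, so `φ` cancels. Of the distinguished
edges only `(q, false)` remains, because the left neighbour of `q` is not in `R₀`. -/
lemma deg_refAssign (hm : 3 ≤ m) {R₀ : Set (Vertex m)} (hR : IsIndepSet R₀)
    (φ : Fin 3 × Fin 3 → ZMod 2) {q : Vertex m} (hq : q ∈ R₀) : deg (refAssign R₀ φ) q = 1 := by
  rw [deg_eq hm]
  simp only [refAssign, hq, notMem_left hR hq, false_and, and_true, and_false, if_true, if_false,
    Bool.true_eq_false, Bool.false_eq_true]
  have h : ∀ z : ZMod 2, z + z = 0 := CharTwo.add_self_eq_zero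
  linear_combination h (φ (colour q)) + h (φ (colour (q.1, q.2 - 1))) +
    h (φ (colour (q.1 - 1, q.2))) + h (φ (colour (q.1 - 1, q.2 - 1)))

/-- Four of nine values are prescribed, and five are free. -/
lemma thirtyTwo_le_card (a b c d : Fin 3 × Fin 3) (r u w : ZMod 2) (hab : a ≠ b) (hac : a ≠ c)
    (had : a ≠ d) (hbc : b ≠ c) (hbd : b ≠ d) (hcd : c ≠ d) :
    32 ≤ (Finset.univ.filter fun φ : Fin 3 × Fin 3 → ZMod 2 =>
      φ a = 0 ∧ φ b = r ∧ φ c = u ∧ φ d = w).card := by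
  let s : Fin 3 × Fin 3 → Finset (ZMod 2) := fun p =>
    if p = a then {0} else if p = b then {r} else if p = c then {u} else if p = d then {w} else
      Finset.univ
  have h1 : Fintype.piFinset s ⊆ Finset.univ.filter fun φ : Fin 3 × Fin 3 → ZMod 2 =>
      φ a = 0 ∧ φ b = r ∧ φ c = u ∧ φ d = w := by
    intro φ hφ
    rw [Fintype.mem_piFinset] at hφ
    have ha := hφ a
    have hb := hφ b
    have hc := hφ c
    have hd := hφ d
    simp only [s, if_true, hab.symm, hac.symm, had.symm, hbc.symm, hbd.symm, hcd.symm, if_false,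
      Finset.mem_singleton] at ha hb hc hd
    simp [ha, hb, hc, hd]
  refine le_trans ?_ (Finset.card_le_card h1)
  rw [Fintype.card_piFinset]
  have h2 : ∀ p, (s p).card = if p ∈ ({a, b, c, d} : Finset (Fin 3 × Fin 3)) then 1 else 2 := by
    intro p
    simp only [s, Finset.mem_insert, Finset.mem_singleton]
    split_ifs <;> simp_all
  have h3 : ({a, b, c, d} : Finset (Fin 3 × Fin 3)).card = 4 := by
    rw [Finset.card_insert_of_notMem, Finset.card_insert_of_notMem, Finset.card_insert_of_notMem,
      Finset.card_singleton] <;> simp [hab, hac, had, hbc, hbd, hcd]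
  rw [Finset.prod_congr rfl fun p _ => h2 p, Finset.prod_ite, Finset.prod_const_one, one_mul,
    Finset.prod_const, Finset.filter_not, Finset.card_sdiff_of_subset (Finset.filter_subset _ _),
    Finset.filter_mem_eq_inter, Finset.univ_inter, h3]
  simp

/-- The four faces at `q` have different colours. With the value `0` on one of them, three edges at
`q` determine the values on the other three faces, and the fourth edge fits because both sides have
odd sum at `q`. -/
lemma thirtyTwo_le_card_refAssign (hm : 3 ≤ m) {R₀ : Set (Vertex m)} (hR : IsIndepSet R₀)
    {x : Edge m → ZMod 2} {q : Vertex m} (hq : q ∈ R₀) (hx : deg x q = 1) :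
    32 ≤ (Finset.univ.filter fun φ : Fin 3 × Fin 3 → ZMod 2 =>
      ∀ P : Edge m, q ∈ P.ends → x P = refAssign R₀ φ P).card := by
  have hk := colour3_add_one_ne hm (q.1 - 1)
  have hl := colour3_add_one_ne hm (q.2 - 1)
  rw [sub_add_cancel] at hk hl
  refine le_trans (thirtyTwo_le_card (colour q) (colour (q.1, q.2 - 1)) (colour (q.1 - 1, q.2))
    (colour (q.1 - 1, q.2 - 1)) (x (q, false) + 1) (x (q, true))
    (x (q, true) + x ((q.1 - 1, q.2), false)) ?_ ?_ ?_ ?_ ?_ ?_) (Finset.card_le_card ?_)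
  · simp [colour, hl]
  · simp [colour, hk]
  · simp [colour, hk]
  · simp [colour, hk]
  · simp [colour, hk]
  · simp [colour, hl]
  · intro φ hφ
    simp only [Finset.mem_filter, Finset.mem_univ, true_and] at hφ ⊢
    obtain ⟨h1, h2, h3, h4⟩ := hφ
    rw [deg_eq hm] at hx
    have h : ∀ z : ZMod 2, z + z = 0 := CharTwo.add_self_eq_zero
    rintro ⟨v, d⟩ hP
    rcases Edge.mem_ends.1 hP with hv | hv
    · dsimp only at hv
      subst hv
      cases d
      · simp only [refAssign, hq, and_true, if_true, if_false, Bool.false_eq_true, h1, h2]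
        linear_combination -h 1
      · simp only [refAssign, hq, false_and, if_true, if_false, Bool.true_eq_false, h1, h3]
        ring
    · cases d
      · have hv' : v = (q.1 - 1, q.2) := by rw [hv, Edge.target_false]; simp
        subst hv'
        simp only [refAssign, notMem_left hR hq, and_false, if_false,
          Bool.false_eq_true, h3, h4]
        linear_combination -h (x (q, true))
      · have hv' : v = (q.1, q.2 - 1) := by rw [hv, Edge.target_true]; simp
        subst hv'
        simp only [refAssign, false_and, if_true, if_false, Bool.true_eq_false, h2, h4]
        linear_combination hx - h (x (q, false)) - h (x (q, true)) - h (x ((q.1 - 1, q.2), false)) 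

end Colours

end GridSwitching

/-! ### A trace gains many bits for a suitable colour, window and reference assignment. -/

namespace GridSwitching

/-- Flipping bit `d` stays within the block of height `d + 1`. -/
lemma exists_sibling {L o i d : ℕ} (hi : InWindow L o i) (hd : d < L) :
    ∃ i', InWindow L o i' ∧ SameAbove o (d + 1) i i' ∧ i' ≠ i := by
  refine ⟨ofBitsAt L o fun b => if b = d then !(i - o).testBit d else (i - o).testBit b,
    inWindow_ofBitsAt _, fun b hb => ?_, fun h => ?_⟩
  · rw [testBit_ofBitsAt, if_neg (by omega)]
    by_cases hb' : b < L
    · simp [hb']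
    · simp [hb', hi.testBit (not_lt.1 hb')]
  · have h1 := testBit_ofBitsAt (L := L) (o := o)
      (fun b => if b = d then !(i - o).testBit d else (i - o).testBit b) d
    rw [h] at h1
    simp [hd] at h1

section Gain

variable {T m : ℕ} [NeZero T] [NeZero m]

/-- The number of gained bits of the indices on `R₀` is at least `g`. -/
def IsGaining (R₀ : Set (Vertex m)) (x₀ : Edge m → ZMod 2) (ℓ L o t r₀ g : ℕ)
    (G : ℕ → DNF (T * m)) (c : Centers T m) (a : Edge (T * m) → ZMod 2) : Prop :=
  ∃ (R : Finset (Vertex m)) (h : List (Query m)) (D : ℕ → Term (T * m)) (x : ℕ → Edge m → ZMod 2),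
    R.card ≤ r₀ ∧ (∀ q ∈ R, q ∈ R₀) ∧
    (gridCoding R₀ (fun v => c v) (a + shift c x₀) x₀ ℓ L o t G).Run (fun v => c v) R h D x ∧
    ∃ B : Finset (Vertex m × ℕ), (∀ p ∈ B,
      (gridCoding R₀ (fun v => c v) (a + shift c x₀) x₀ ℓ L o t G).Pend (fun v => c v) R D x 0
        p.1 p.2) ∧ g ≤ B.card

/-- An edge on a path determines the index of one end of the path. -/
lemma exists_determined_end (hm : 3 ≤ m) {c : Centers T m} {e : Edge (T * m)}
    (he : e ∈ livePath c (owner e)) : ∃ v ∈ (owner e).ends, ∀ R₀ : Set (Vertex m), IsIndepSet R₀ →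
      v ∈ R₀ → ∀ i < numCenters T, Touch R₀ (fun v => c v) e i → i = c v := by
  obtain ⟨j₀, i₀, h⟩ := isHalfLine_pathAt hm (owner e) e
  have ha := (c (owner e).1).2
  have hb := (c (owner e).target).2
  rw [livePath_eq] at he
  have h1 : ∀ R₀ : Set (Vertex m), IsIndepSet R₀ → (owner e).1 ∈ R₀ → ∀ i,
      Touch R₀ (fun v => c v) e i → e ∈ pathAt T (owner e) i (c (owner e).target) := by
    intro R₀ hR hv i ht
    rwa [Touch, idx_of_mem hv, idx_of_notMem (hR _ hv)] at ht
  have h2 : ∀ R₀ : Set (Vertex m), IsIndepSet R₀ → (owner e).target ∈ R₀ → ∀ i,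
      Touch R₀ (fun v => c v) e i → e ∈ pathAt T (owner e) (c (owner e).1) i := by
    intro R₀ hR hv i ht
    rwa [Touch, idx_of_mem hv, idx_of_notMem fun h => hR _ h hv] at ht
  -- The end whose index is constant along the half-line is the determined one; for a single pair
  -- either end would do.
  rcases h with h | h | h
  · refine ⟨_, Edge.mem_ends.2 (.inl rfl), fun R₀ hR hv i hi ht => ?_⟩
    exact ((h i hi _ hb).1 (h1 R₀ hR hv i ht)).1.trans ((h _ ha _ hb).1 he).1.symm
  · refine ⟨_, Edge.mem_ends.2 (.inr rfl), fun R₀ hR hv i hi ht => ?_⟩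
    exact ((h _ ha i hi).1 (h2 R₀ hR hv i ht)).1.trans ((h _ ha _ hb).1 he).1.symm
  · refine ⟨_, Edge.mem_ends.2 (.inl rfl), fun R₀ hR hv i hi ht => ?_⟩
    exact (h i hi _ hb (h1 R₀ hR hv i ht)).1.trans (h _ ha _ hb he).1.symm

lemma card_filter_mem_ends_le (q : Vertex m) :
    (Finset.univ.filter fun P : Edge m => q ∈ P.ends).card ≤ 4 := by
  refine (Finset.card_le_card (t := {(q, false), (q, true), ((q.1 - 1, q.2), false),
    ((q.1, q.2 - 1), true)}) ?_).trans Finset.card_le_four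
  rintro ⟨v, d⟩ h
  simp only [Finset.mem_filter, Finset.mem_univ, true_and, Edge.mem_ends] at h
  rcases h with rfl | rfl <;> cases d <;> simp [Edge.target_false, Edge.target_true]

open Classical in
/-- A stage of a trace. -/
lemma exists_stage (hm : 3 ≤ m) {c : Centers T m} {a : Edge (T * m) → ZMod 2} {ℓ s : ℕ}
    {F : Fin s → DNF (T * m)} {h : List (Query m)} {fi : ℕ → Fin s}
    (hT : IsTrace ℓ owner (gridRestriction c a) F (Restriction.empty m) h fi) {u : ℕ}
    (hu : u < h.length) :
    ∃ (D : Term (T * m)) (x : Edge m → ZMod 2) (l : Literal (T * m)) (v : Vertex m),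
      firstAlive owner (gridRestriction c a) (F (fi (u / (ℓ + 1))))
        (roundState ℓ (Restriction.empty m) (h.take u)) = some D ∧
      x ∈ Cons owner D (roundState ℓ (Restriction.empty m) (h.take u)) ∧
      Sat (Subst.val (gridRestriction c a) x) D ∧ l ∈ D ∧ (∃ p, h[u]? = some (owner l.1, p)) ∧
      l.1 ∈ livePath c (owner l.1) ∧ v ∈ (owner l.1).ends ∧
      ∀ R₀ : Set (Vertex m), IsIndepSet R₀ → v ∈ R₀ → ∀ i < numCenters T,
        Touch R₀ (fun v => c v) l.1 i → i = c v := by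
  obtain ⟨-, D, hD, e, b, d, hl, he⟩ := hT u _ (List.getElem?_eq_getElem hu)
  obtain ⟨he1, he2⟩ := gridRestriction_eq_inr he
  have ha := List.find?_some hD
  rw [decide_eq_true_eq] at ha
  obtain ⟨x, hx, hxs⟩ := ha
  rw [← he1] at he2
  obtain ⟨v, hv, hvs⟩ := exists_determined_end hm he2
  refine ⟨D, x, (e, b), v, hD, hx, hxs, hl, ⟨h[u].2, ?_⟩, he2, hv, hvs⟩
  rw [List.getElem?_eq_getElem hu]
  exact congrArg some (Prod.ext he1.symm rfl)

lemma not_mem_take_of_isTrace {N : ℕ} {ℓ s : ℕ} {own : Edge N → Edge m} {σ : Subst N m}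
    {F : Fin s → DNF N} {h : List (Query m)} {fi : ℕ → Fin s}
    (hT : IsTrace ℓ own σ F (Restriction.empty m) h fi) {u u' : ℕ} {P : Edge m}
    {p p' : ZMod 2 × ZMod 2} (hu : h[u]? = some (P, p)) (hu' : h[u']? = some (P, p')) :
    u = u' := by
  wlog hlt : u < u' generalizing u u' p p'
  · rcases eq_or_lt_of_le (not_lt.1 hlt) with h | h
    · exact h.symm
    · exact (this hu' hu h).symm
  refine absurd ?_ (hT u' _ hu').1
  rw [mem_supp_roundState]
  refine .inr (List.mem_map.2 ⟨(P, p), ?_, rfl⟩)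
  rw [List.mem_iff_getElem?]
  exact ⟨u, by rw [List.getElem?_take_of_lt hlt, hu]⟩

/-- A vertex has four edges, so at least a quarter of `t` vertices occur, and they fall into `9 * 2
= 18` classes by colour and window; this gives `t / 72`, rounded up. -/
lemma exists_subset_of_fibres {t : ℕ} (ht : 0 < t) (v : ℕ → Vertex m) (P : ℕ → Edge m)
    (hP : Set.InjOn P (Finset.range t)) (hv : ∀ u < t, v u ∈ (P u).ends)
    (f : Vertex m → (Fin 3 × Fin 3) × Bool) : ∃ (κ : (Fin 3 × Fin 3) × Bool) (R : Finset (Vertex m)),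
      R.card = (t + 71) / 72 ∧ ∀ q ∈ R, f q = κ ∧ ∃ u < t, v u = q := by
  classical
  have h1 : t ≤ 4 * ((Finset.range t).image v).card := by
    conv_lhs => rw [← Finset.card_range t]
    refine Finset.card_le_mul_card_image _ 4 fun q _ => ?_
    refine le_trans ?_ (card_filter_mem_ends_le q)
    refine Finset.card_le_card_of_injOn P ?_ (hP.mono ?_)
    · intro u hu
      simp only [Finset.coe_filter, Set.mem_ofPred_eq, Finset.mem_range,
        Finset.mem_univ, true_and] at hu ⊢
      rw [← hu.2]; exact hv u hu.1
    · intro u hu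
      exact Finset.mem_coe.2 (Finset.mem_filter.1 (Finset.mem_coe.1 hu)).1
  obtain ⟨κ, -, hκ⟩ := Finset.exists_lt_card_fiber_of_mul_lt_card_of_maps_to
    (s := (Finset.range t).image v) (t := Finset.univ) (f := f) (n := (t + 71) / 72 - 1)
    (fun _ _ => Finset.mem_univ _) (by
      rw [Finset.card_univ]
      rw [show Fintype.card ((Fin 3 × Fin 3) × Bool) = 18 from rfl]
      omega)
  obtain ⟨R, hR1, hR2⟩ := Finset.exists_subset_card_eq (Nat.le_of_pred_lt hκ)
  refine ⟨κ, R, hR2, fun q hq => ?_⟩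
  obtain ⟨h2, h3⟩ := Finset.mem_filter.1 (hR1 hq)
  obtain ⟨u, hu, hu'⟩ := Finset.mem_image.1 h2
  exact ⟨h3, u, Finset.mem_range.1 hu, hu'⟩

/-- Some reference assignment agrees often. -/
lemma exists_refAssign (hm : 3 ≤ m) {R₀ : Set (Vertex m)} (hR : IsIndepSet R₀)
    (B : Finset (Vertex m × ℕ)) (x : Vertex m × ℕ → Edge m → ZMod 2)
    (hB : ∀ p ∈ B, p.1 ∈ R₀ ∧ deg (x p) p.1 = 1) :
    ∃ (φ : Fin 3 × Fin 3 → ZMod 2) (B' : Finset (Vertex m × ℕ)), B' ⊆ B ∧ B.card ≤ 16 * B'.card ∧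
      ∀ p ∈ B', ∀ P : Edge m, p.1 ∈ P.ends → x p P = refAssign R₀ φ P := by
  classical
  let r : (Fin 3 × Fin 3 → ZMod 2) → Vertex m × ℕ → Prop := fun φ p =>
    ∀ P : Edge m, p.1 ∈ P.ends → x p P = refAssign R₀ φ P
  -- Double counting: each element of `B` is served by at least 32 of the 512 choices of `φ`, so
  -- some `φ` serves a sixteenth of `B`.
  have h1 : B.card * 32 ≤ ∑ φ, (B.filter (r φ)).card := by
    have h2 : ∑ φ, (B.filter (r φ)).card = ∑ p ∈ B, (Finset.univ.filter fun φ => r φ p).card :=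
      Finset.sum_card_bipartiteAbove_eq_sum_card_bipartiteBelow (s := Finset.univ) (t := B) r
    rw [h2, ← smul_eq_mul]
    refine Finset.card_nsmul_le_sum _ _ _ fun p hp => ?_
    obtain ⟨h3, h4⟩ := hB p hp
    refine (thirtyTwo_le_card_refAssign hm hR h3 h4).trans (le_of_eq ?_)
    congr!
  by_contra! hcon
  have h3 : ∀ φ, 16 * (B.filter (r φ)).card < B.card := by
    intro φ
    by_contra! hle
    obtain ⟨p, hp, P, h4, h5⟩ := hcon φ _ (Finset.filter_subset _ _) hle
    exact h5 ((Finset.mem_filter.1 hp).2 P h4)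
  have h4 : ∑ φ : Fin 3 × Fin 3 → ZMod 2, 16 * (B.filter (r φ)).card < 512 * B.card := by
    have h5 : Fintype.card (Fin 3 × Fin 3 → ZMod 2) = 512 := by simp
    rw [← h5, ← smul_eq_mul, ← Finset.card_univ, ← Finset.sum_const]
    exact Finset.sum_lt_sum_of_nonempty Finset.univ_nonempty fun φ _ => h3 φ
  rw [← Finset.mul_sum] at h4
  omega

/-- The start of the window of the index `i`. -/
def windowStart (T L : ℕ) (b : Bool) : ℕ := if b then numCenters T - 2 ^ L else 0

/-- `Δ` need not be a power of two; two overlapping windows of length `2 ^ L` cover all indices. -/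
lemma inWindow_windowStart {L i : ℕ} (hL : 2 ^ L ≤ numCenters T) (hL' : numCenters T ≤ 2 * 2 ^ L)
    (hi : i < numCenters T) : InWindow L (windowStart T L (decide (2 ^ L ≤ i))) i := by
  by_cases h : 2 ^ L ≤ i <;> simp only [windowStart, InWindow, h, decide_true, decide_false,
    if_true, Bool.false_eq_true, if_false] <;> omega

/-- The determined ends of the queried paths supply the vertices. All `L` bits of each of them are
needed at some stage, and the reference assignment is chosen so that at least a sixteenth of the
first uses agree with it. -/
lemma exists_isGaining (hm : 3 ≤ m) {c : Centers T m} {a : Edge (T * m) → ZMod 2} {ℓ s t L : ℕ}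
    (ht : 0 < t) {F : Fin s → DNF (T * m)} {h : List (Query m)} {fi : ℕ → Fin s}
    (hlen : h.length = t)
    (hT : IsTrace ℓ owner (gridRestriction c a) F (Restriction.empty m) h fi)
    (hL : 2 ^ L ≤ numCenters T) (hL' : numCenters T ≤ 2 * 2 ^ L) {G : ℕ → DNF (T * m)}
    (hG : ∀ u < t, G (u / (ℓ + 1)) = F (fi (u / (ℓ + 1)))) :
    ∃ (κ : Fin 3 × Fin 3) (b : Bool) (φ : Fin 3 × Fin 3 → ZMod 2),
      IsGaining {v | colour v = κ} (refAssign {v | colour v = κ} φ) ℓ L (windowStart T L b) t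
        ((t + 71) / 72) ((L * ((t + 71) / 72) + 15) / 16) G c a := by
  classical
  have hst : ∀ u, ∃ (D : Term (T * m)) (x : Edge m → ZMod 2) (l : Literal (T * m)) (v : Vertex m),
      u < t → firstAlive owner (gridRestriction c a) (F (fi (u / (ℓ + 1))))
        (roundState ℓ (Restriction.empty m) (h.take u)) = some D ∧
      x ∈ Cons owner D (roundState ℓ (Restriction.empty m) (h.take u)) ∧
      Sat (Subst.val (gridRestriction c a) x) D ∧ l ∈ D ∧ (∃ p, h[u]? = some (owner l.1, p)) ∧
      l.1 ∈ livePath c (owner l.1) ∧ v ∈ (owner l.1).ends ∧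
      ∀ R₀ : Set (Vertex m), IsIndepSet R₀ → v ∈ R₀ → ∀ i < numCenters T,
        Touch R₀ (fun v => c v) l.1 i → i = c v := by
    intro u
    by_cases hu : u < t
    · obtain ⟨D, x, l, v, hh⟩ := exists_stage hm hT (hlen.symm ▸ hu)
      exact ⟨D, x, l, v, fun _ => hh⟩
    · exact ⟨[], 0, (((0, 0), false), 0), 0, fun h => absurd h hu⟩
  choose D x l v hD hx hxs hl hq hlive hv hdet using hst
  have hP : Set.InjOn (fun u => owner (l u).1) (Finset.range t) := by
    intro u hu u' hu' he
    simp only [Finset.coe_range, Set.mem_Iio] at hu hu' he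
    obtain ⟨p, hp⟩ := hq u hu
    obtain ⟨p', hp'⟩ := hq u' hu'
    exact not_mem_take_of_isTrace hT hp (he ▸ hp')
  obtain ⟨⟨κ, b⟩, R, hR, hRv⟩ := exists_subset_of_fibres ht v (fun u => owner (l u).1) hP hv
    fun q => (colour q, decide (2 ^ L ≤ (c q : ℕ)))
  have hR₀ : IsIndepSet {v : Vertex m | colour v = κ} := isIndepSet_colour hm κ
  set R₀ : Set (Vertex m) := {v : Vertex m | colour v = κ} with hR₀def
  have hmem : ∀ q ∈ R, q ∈ R₀ := fun q hq => (Prod.mk.inj (hRv q hq).1).1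
  have hwin : ∀ q ∈ R, InWindow L (windowStart T L b) (c q) := by
    intro q hq
    rw [← (Prod.mk.inj (hRv q hq).1).2]
    exact inWindow_windowStart hL hL' (c q).2
  have hwin' : ∀ i, InWindow L (windowStart T L b) i → i < numCenters T := by
    intro i hi
    have := hi.2
    cases b <;> simp only [windowStart, if_true, Bool.false_eq_true, if_false] at this <;> omega
  let S := fun φ : Fin 3 × Fin 3 → ZMod 2 => gridCoding R₀ (fun v => c v)
    (a + shift c (refAssign R₀ φ)) (refAssign R₀ φ) ℓ L (windowStart T L b) t G
  -- First uses depend on the geometry and the indices only, not on the reference, so `S 0` stands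
  -- for every `S φ`.
  have hneed : ∀ p : Vertex m × ℕ, ∃ u, p ∈ R ×ˢ Finset.range L →
      (S 0).FirstAt (fun v => c v) D p.1 p.2 u := by
    rintro ⟨q, d⟩
    by_cases hp : (q, d) ∈ R ×ˢ Finset.range L
    swap
    · exact ⟨0, fun h => absurd h hp⟩
    rw [Finset.mem_product, Finset.mem_range] at hp
    obtain ⟨u, hu, rfl⟩ := (hRv q hp.1).2
    -- Within the window the edge `l u` is on a path only for the true index of `v u`, so changing
    -- bit `d` takes it off the path.
    have hN : (S 0).Needed (fun v => c v) D (v u) d u := by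
      refine ⟨l u, hl u hu, rootEnd_of_mem hR₀ (hmem _ hp.1) (hv u hu), ?_⟩
      obtain ⟨i', h1, h2, h3⟩ := exists_sibling (hwin _ hp.1) hp.2
      refine ⟨c (v u), i', hwin _ hp.1, h1, SameAbove.refl _ _ _, h2, ?_, fun hi =>
        h3 (hdet u hu R₀ hR₀ (hmem _ hp.1) i' (hwin' _ h1) hi)⟩
      have h4 := (touch_root hR₀ (fun v => (c v : ℕ)) (l u).1).2 (hlive u hu)
      rw [rootEnd_of_mem hR₀ (hmem _ hp.1) (hv u hu)] at h4
      exact h4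
    have hex : ∃ u', (S 0).Needed (fun v => c v) D (v u) d u' := ⟨u, hN⟩
    exact ⟨Nat.find hex, fun _ => ⟨(Nat.find_min' hex hN).trans_lt hu, Nat.find_spec hex,
      fun u' hu' => Nat.find_min hex hu'⟩⟩
  choose w hw using hneed
  -- The root of a witness avoids the ends of all owners of its term, so the sum at the vertex
  -- concerned is odd, as the reference assignments require.
  have hsol : ∀ p ∈ R ×ˢ Finset.range L, p.1 ∈ R₀ ∧ deg (x (w p)) p.1 = 1 := by
    intro p hp
    have hpR := hmem _ (Finset.mem_product.1 hp).1
    refine ⟨hpR, ?_⟩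
    obtain ⟨hlt, ⟨l', hl', hrv, -⟩, -⟩ := hw p hp
    obtain ⟨r, -, hr, hsol, -⟩ := hx _ hlt
    rw [hsol, if_neg]
    rintro rfl
    exact hr l' hl' (rootEnd_eq_some hrv).2
  obtain ⟨φ, B, hB, hcard, hagree⟩ := exists_refAssign hm hR₀ (R ×ˢ Finset.range L)
    (fun p => x (w p)) hsol
  refine ⟨κ, b, φ, R, h, D, x, hR.le, hmem, ⟨hlen, ?_, hx, ?_, ?_, hwin⟩, B, ?_, ?_⟩
  · intro u hu
    have h1 := hD u hu
    rw [firstAlive, ← hG u hu] at h1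
    rw [← h1]
    congr 1
    funext D'
    exact decide_eq_decide.2 (satisfiable_gridCoding hR₀ c a _ ℓ L _ t G _ D')
  · intro u hu
    rw [val_gridCoding hR₀]
    exact hxs u hu
  · intro u hu
    exact ⟨l u, hl u hu, hq u hu⟩
  · intro p hp
    have hp' := hB hp
    refine ⟨(Finset.mem_product.1 hp').1, Finset.mem_range.1 (Finset.mem_product.1 hp').2, w p,
      Nat.zero_le _, hw p hp', fun e he => ?_⟩
    exact hagree p hp _ (rootEnd_eq_some he).2
  · rw [Finset.card_product, Finset.card_range, hR, mul_comm] at hcard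
    omega

end Gain

end GridSwitching

/-! ### Averaging over the centers of one class with the shifted assignment held fixed. -/

namespace GridSwitching

/-! ### Averaging -/

section Averaging

variable {V Y : Type*} [Fintype V] [Fintype Y] {Δ : ℕ}

open Classical in
/-- The choice `c'` on `R₀` and `c` elsewhere. -/
noncomputable def mix (R₀ : Set V) (c' c : V → Fin Δ) (v : V) : Fin Δ :=
  if v ∈ R₀ then c' v else c v

lemma mix_of_mem {R₀ : Set V} {c' c : V → Fin Δ} {v : V} (h : v ∈ R₀) : mix R₀ c' c v = c' v :=
  if_pos h

lemma mix_of_notMem {R₀ : Set V} {c' c : V → Fin Δ} {v : V} (h : v ∉ R₀) :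
    mix R₀ c' c v = c v := if_neg h

lemma mix_mix (R₀ : Set V) (c' c : V → Fin Δ) : mix R₀ (mix R₀ c' c) (mix R₀ c c') = c' := by
  funext v
  by_cases h : v ∈ R₀
  · rw [mix_of_mem h, mix_of_mem h]
  · rw [mix_of_notMem h, mix_of_notMem h]

/-- Exchanging the values of two choices outside `R₀` is an involution on pairs of choices. -/
lemma sum_sum_mix [DecidableEq V] (R₀ : Set V) (f : (V → Fin Δ) → ℝ) :
    ∑ c, ∑ c', f (mix R₀ c' c) = Fintype.card (V → Fin Δ) * ∑ c, f c := by
  have h1 : Function.Involutive fun p : (V → Fin Δ) × (V → Fin Δ) =>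
      (mix R₀ p.1 p.2, mix R₀ p.2 p.1) := fun p =>
    Prod.ext (mix_mix R₀ p.1 p.2) (mix_mix R₀ p.2 p.1)
  rw [Finset.sum_comm, ← Fintype.sum_prod_type' (f := fun c' c => f (mix R₀ c' c))]
  have h2 := Fintype.sum_equiv h1.toPerm (fun p => f (mix R₀ p.1 p.2))
    (fun p : (V → Fin Δ) × (V → Fin Δ) => f p.1) fun p => rfl
  rw [h2, Fintype.sum_prod_type]
  simp [Finset.mul_sum]

open Classical in
-- In the variable `A = τ c a` the set of admissible values does not change with the centers on
-- `R₀`. All the fractions that arise by resampling on `R₀` thus have one denominator, and for each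
-- fixed `A` the bad choices can be counted.
lemma sum_card_div_card_le [DecidableEq V] (R₀ : Set V) (S B : (V → Fin Δ) → Y → Prop)
    (τ : (V → Fin Δ) → Y → Y) (hτ : ∀ c, Function.Involutive (τ c))
    (hS : ∀ c c' A, (∀ v ∉ R₀, c v = c' v) → S c (τ c A) → S c' (τ c' A)) {K : ℝ} (hK0 : 0 ≤ K)
    (hK : ∀ c A, (Finset.card {c' | B (mix R₀ c' c) (τ (mix R₀ c' c) A)} : ℝ) ≤ K) :
    ∑ c, (Finset.card {a | S c a ∧ B c a} : ℝ) / (Finset.card {a | S c a} : ℝ) ≤ K := by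
  have hcard : ∀ c (P : Y → Prop), Finset.card {a | P a} = Finset.card {A | P (τ c A)} := by
    intro c P
    refine Finset.card_bij (fun a _ => τ c a) ?_ ?_ ?_
    · intro a ha; simpa [hτ c a] using ha
    · intro a _ b _ h; exact (hτ c).injective h
    · intro A hA; exact ⟨τ c A, by simpa using hA, hτ c A⟩
  let N : (V → Fin Δ) → Finset Y := fun c => {A | S c (τ c A)}
  have hN : ∀ c c', N (mix R₀ c' c) = N c := by
    intro c c'
    ext A
    simp only [N, Finset.mem_filter, Finset.mem_univ, true_and]
    exact ⟨hS _ _ A fun v hv => mix_of_notMem hv, hS _ _ A fun v hv => (mix_of_notMem hv).symm⟩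
  let f : (V → Fin Δ) → ℝ := fun c => (((N c).filter fun A => B c (τ c A)).card : ℝ) / ((N c).card : ℝ)
  have hf : ∀ c, (Finset.card {a | S c a ∧ B c a} : ℝ) / (Finset.card {a | S c a} : ℝ) = f c := by
    intro c
    have e1 : Finset.card {a | S c a ∧ B c a} = ((N c).filter fun A => B c (τ c A)).card := by
      rw [Finset.filter_filter]
      convert hcard c fun a => S c a ∧ B c a
    have e2 : Finset.card {a | S c a} = (N c).card := hcard c (S c)
    rw [e1, e2]
  rw [Finset.sum_congr rfl fun c _ => hf c]
  have h1 : ∀ c, ∑ c', f (mix R₀ c' c) ≤ K := by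
    intro c
    have h2 : ∑ c', f (mix R₀ c' c) = (∑ A ∈ N c,
        (Finset.card {c' | B (mix R₀ c' c) (τ (mix R₀ c' c) A)} : ℝ)) / ((N c).card : ℝ) := by
      simp only [f, hN]
      rw [← Finset.sum_div]
      congr 1
      exact_mod_cast Finset.sum_card_bipartiteAbove_eq_sum_card_bipartiteBelow
        (s := Finset.univ) (t := N c) fun c' A => B (mix R₀ c' c) (τ (mix R₀ c' c) A)
    rw [h2]
    refine div_le_of_le_mul₀ (Nat.cast_nonneg _) hK0 ?_
    refine (Finset.sum_le_card_nsmul _ _ K fun A _ => hK c A).trans (le_of_eq ?_)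
    rw [nsmul_eq_mul, mul_comm]
  have h2 := Finset.sum_le_card_nsmul Finset.univ _ K fun c _ => h1 c
  rw [sum_sum_mix, nsmul_eq_mul, Finset.card_univ] at h2
  rcases isEmpty_or_nonempty (V → Fin Δ) with he | he
  · rw [Finset.univ_eq_empty, Finset.sum_empty]; exact hK0
  · exact le_of_mul_le_mul_left h2 (Nat.cast_pos.2 Fintype.card_pos)

end Averaging

section Suggested

variable {T m : ℕ} [NeZero T] [NeZero m]

open Classical in
lemma deg_shift (hm : 3 ≤ m) (c : Centers T m) (x₀ : Edge m → ZMod 2) (v : Vertex (T * m)) :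
    deg (shift c x₀) v = ∑ P : Edge m, x₀ P * ((if v = centerVertex c P.1 then 1 else 0) +
      (if v = centerVertex c P.target then 1 else 0)) := by
  rw [shift, deg_sum]
  refine Finset.sum_congr rfl fun P _ => ?_
  rw [deg_smul, deg_livePath hm]

lemma deg_shift_centerVertex (hm : 3 ≤ m) (c : Centers T m) (x₀ : Edge m → ZMod 2)
    (q : Vertex m) : deg (shift c x₀) (centerVertex c q) = deg x₀ q := by
  classical
  rw [deg_shift hm, deg_eq_sum hm]
  refine Finset.sum_congr rfl fun P _ => ?_
  simp only [(centerVertex_injective c).eq_iff, mul_add, mul_ite, mul_one, mul_zero,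
    eq_comm (a := q)]

lemma deg_shift_of_ne (hm : 3 ≤ m) (c : Centers T m) (x₀ : Edge m → ZMod 2) {v : Vertex (T * m)}
    (hv : ∀ q, centerVertex c q ≠ v) : deg (shift c x₀) v = 0 := by
  classical
  rw [deg_shift hm]
  refine Finset.sum_eq_zero fun P _ => ?_
  rw [if_neg (hv _).symm, if_neg (hv _).symm, add_zero, mul_zero]

/-- A path contributes only at its two ends, so the shift carries the vertex sums of `x₀` to the
centers and adds nothing elsewhere. -/
lemma isSuggested_add_shift_iff (hm : 3 ≤ m) (c : Centers T m) (x₀ : Edge m → ZMod 2)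
    (A : Edge (T * m) → ZMod 2) : IsSuggested c (A + shift c x₀) ↔
      (∀ q, deg A (centerVertex c q) = deg x₀ q) ∧
        ∀ v, (∀ q, centerVertex c q ≠ v) → deg A v = 1 := by
  classical
  have h0 : IsSuggested c (A + shift c x₀) ↔ ∀ v, deg (A + shift c x₀) v =
    if ∃ q, centerVertex c q = v then 0 else 1 := by
    refine forall_congr' fun v => ?_
    rw [deg]
  rw [h0]
  constructor
  · intro h
    refine ⟨fun q => ?_, fun v hv => ?_⟩
    · have := h (centerVertex c q)
      rw [if_pos ⟨q, rfl⟩, deg_add, deg_shift_centerVertex hm] at this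
      have h2 := CharTwo.add_self_eq_zero (deg x₀ q)
      linear_combination this - h2
    · have := h v
      rwa [if_neg (by simpa using hv), deg_add, deg_shift_of_ne hm c x₀ hv, add_zero] at this
  · rintro ⟨h1, h2⟩ v
    rw [deg_add]
    by_cases hv : ∃ q, centerVertex c q = v
    · obtain ⟨q, rfl⟩ := hv
      rw [if_pos ⟨q, rfl⟩, h1, deg_shift_centerVertex hm, CharTwo.add_self_eq_zero]
    · rw [if_neg hv]
      push Not at hv
      rw [h2 v hv, deg_shift_of_ne hm c x₀ hv, add_zero]

/-- At a center on `R₀` the reference has odd sum, so `A` has odd sum there, just as at a vertex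
that is no center. Moving these centers is invisible to `A`. -/
lemma isSuggested_add_shift_congr (hm : 3 ≤ m) {R₀ : Set (Vertex m)} {x₀ : Edge m → ZMod 2}
    (hx₀ : ∀ q ∈ R₀, deg x₀ q = 1) {c c' : Centers T m} (hc : ∀ q ∉ R₀, c q = c' q)
    {A : Edge (T * m) → ZMod 2} (h : IsSuggested c (A + shift c x₀)) :
    IsSuggested c' (A + shift c' x₀) := by
  rw [isSuggested_add_shift_iff hm] at h ⊢
  obtain ⟨h1, h2⟩ := h
  have hcv : ∀ q ∉ R₀, centerVertex c q = centerVertex c' q := by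
    intro q hq; rw [centerVertex, centerVertex, hc q hq]
  constructor
  · intro q
    by_cases hq : q ∈ R₀
    · rw [hx₀ q hq]
      by_cases hv : ∃ q', centerVertex c q' = centerVertex c' q
      · obtain ⟨q', hq'⟩ := hv
        rw [← hq', h1]
        refine hx₀ q' ?_
        by_contra hn
        rw [hcv q' hn] at hq'
        exact hn (centerVertex_injective c' hq' ▸ hq)
      · push Not at hv
        exact h2 _ hv
    · rw [← hcv q hq, h1]
  · intro v hv
    by_cases hv' : ∃ q, centerVertex c q = v
    · obtain ⟨q, rfl⟩ := hv'
      rw [h1]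
      refine hx₀ q ?_
      by_contra hn
      exact hv q (hcv q hn).symm
    · push Not at hv'
      exact h2 _ hv'

/-- Shifting twice restores `A`, and the coding depends only on `c` off `R₀`, while a run reads
indices only on `R₀`. So for given `c` and `A` all choices `c'` are handled by one coding, as the
counting bound requires. -/
lemma IsGaining.exists_run {R₀ : Set (Vertex m)} {x₀ : Edge m → ZMod 2} {ℓ L o t r₀ g : ℕ}
    {G : ℕ → DNF (T * m)} {c c' : Centers T m} {A : Edge (T * m) → ZMod 2}
    (h : IsGaining R₀ x₀ ℓ L o t r₀ g G (mix R₀ c' c) (A + shift (mix R₀ c' c) x₀)) :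
    ∃ (R : Finset (Vertex m)) (h : List (Query m)) (D : ℕ → Term (T * m))
      (x : ℕ → Edge m → ZMod 2), R.card ≤ r₀ ∧
    (gridCoding R₀ (fun v => c v) A x₀ ℓ L o t G).Run (fun v => c' v) R h D x ∧
    ∃ B : Finset (Vertex m × ℕ), (∀ p ∈ B,
      (gridCoding R₀ (fun v => c v) A x₀ ℓ L o t G).Pend (fun v => c' v) R D x 0
        p.1 p.2) ∧ g ≤ B.card := by
  obtain ⟨R, l, D, x, hR, hR₀, hr, B, hB, hg⟩ := h
  have hA : A + shift (mix R₀ c' c) x₀ + shift (mix R₀ c' c) x₀ = A := by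
    funext e
    have := CharTwo.add_self_eq_zero (shift (mix R₀ c' c) x₀ e)
    simp only [Pi.add_apply]
    linear_combination this
  have hS := gridCoding_congr (T := T) (R₀ := R₀) (c₀ := fun v => (mix R₀ c' c v : ℕ))
    (c₁ := fun v => (c v : ℕ)) (fun v hv => by rw [mix_of_notMem hv]) A x₀ ℓ L o t G
  rw [hA, hS] at hr hB
  have hc : ∀ e q, (gridCoding R₀ (fun v => (c v : ℕ)) A x₀ ℓ L o t G).rv e = some q →
      (mix R₀ c' c q : ℕ) = c' q := by
    intro e q hq
    rw [mix_of_mem (rootEnd_eq_some hq).1]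
  refine ⟨R, l, D, x, hR, hr.congr hc fun q hq => by rw [mix_of_mem (hR₀ q hq)], B, ?_, hg⟩
  intro p hp
  exact (Coding.pend_congr hc).1 (hB p hp)

open Classical in
lemma sum_isGaining_le (hm : 3 ≤ m) {R₀ : Set (Vertex m)} (hR : IsIndepSet R₀)
    {x₀ : Edge m → ZMod 2} (hx₀ : ∀ q ∈ R₀, deg x₀ q = 1) {ℓ L o t r₀ g k : ℕ} (hk : 0 < k)
    (ho : o + 2 ^ L ≤ numCenters T) {G : ℕ → DNF (T * m)} (hG : ∀ r, (G r).IsWidth k) :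
    ∑ c : Centers T m, (Finset.card {a : Edge (T * m) → ZMod 2 |
        IsSuggested c a ∧ IsGaining R₀ x₀ ℓ L o t r₀ g G c a} : ℝ) /
      (Finset.card {a : Edge (T * m) → ZMod 2 | IsSuggested c a} : ℝ) ≤
    Fintype.card (Centers T m) * (Fintype.card (Coding.Codes k L (t + r₀) (L * r₀)) / 2 ^ g) := by
  refine sum_card_div_card_le R₀ (fun c a => IsSuggested c a)
    (fun c a => IsGaining R₀ x₀ ℓ L o t r₀ g G c a) (fun c a => a + shift c x₀) ?_ ?_
    (mul_nonneg (Nat.cast_nonneg _) (div_nonneg (Nat.cast_nonneg _) (pow_nonneg two_pos.le _))) ?_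
  · intro c a
    funext e
    have := CharTwo.add_self_eq_zero (shift c x₀ e)
    simp only [Pi.add_apply]
    linear_combination this
  · intro c c' A hc h
    exact isSuggested_add_shift_congr hm hx₀ hc h
  · intro c A
    have := Coding.card_mul_two_pow_le (isPivot_gridCoding hm hR (fun v => (c v).2) (A := A)
      (x₀ := x₀) (ℓ := ℓ) (t := t) (G := G) ho) (r₀ := r₀) (g := g) ho hk
      (fun u _ D' hD' => hG _ D' hD')
      ({c' : Centers T m | IsGaining R₀ x₀ ℓ L o t r₀ g G (mix R₀ c' c)
        (A + shift (mix R₀ c' c) x₀)} : Finset (Centers T m))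
      (fun c' hc' => ((Finset.mem_filter.1 hc').2).exists_run)
    rw [← mul_div_assoc, le_div_iff₀ (by positivity), Fintype.card_fun, Fintype.card_fin]
    exact_mod_cast this

end Suggested

end GridSwitching

/-! ### Union bound and numerical estimate. -/

namespace GridSwitching

section Final

variable {T m : ℕ} [NeZero T] [NeZero m]

lemma gridProb_eq_zero {E : Subst (T * m) m → Prop} (h : ∀ c a, ¬ E (gridRestriction c a)) :
    gridProb T m E = 0 := by
  simp [gridProb, h]

lemma gridProb_le_one (E : Subst (T * m) m → Prop) : gridProb T m E ≤ 1 := by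
  classical
  rw [gridProb]
  refine div_le_one_of_le₀ ?_ (Nat.cast_nonneg _)
  refine (Finset.sum_le_card_nsmul _ _ 1 fun c _ => ?_).trans (by simp)
  refine div_le_one_of_le₀ (Nat.cast_le.2 (Finset.card_le_card ?_)) (Nat.cast_nonneg _)
  intro a ha
  simp only [Finset.mem_filter, Finset.mem_univ, true_and] at ha ⊢
  exact ha.1

open Classical in
lemma gridProb_le_of_exists (hT : 0 < numCenters T) {ι : Type*} [Fintype ι]
    {E : Subst (T * m) m → Prop} (B : ι → Centers T m → (Edge (T * m) → ZMod 2) → Prop)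
    (hE : ∀ c a, E (gridRestriction c a) → ∃ i, B i c a) {ε : ℝ}
    (hB : ∀ i, ∑ c : Centers T m, (Finset.card {a : Edge (T * m) → ZMod 2 |
        IsSuggested c a ∧ B i c a} : ℝ) /
      (Finset.card {a : Edge (T * m) → ZMod 2 | IsSuggested c a} : ℝ) ≤
      Fintype.card (Centers T m) * ε) : gridProb T m E ≤ Fintype.card ι * ε := by
  have hne : Nonempty (Centers T m) := ⟨fun _ => ⟨0, hT⟩⟩
  rw [gridProb, div_le_iff₀ (Nat.cast_pos.2 Fintype.card_pos)]
  have h1 : ∀ c : Centers T m, (Finset.card {a : Edge (T * m) → ZMod 2 |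
      IsSuggested c a ∧ E (gridRestriction c a)} : ℝ) /
        (Finset.card {a : Edge (T * m) → ZMod 2 | IsSuggested c a} : ℝ) ≤
      ∑ i, (Finset.card {a : Edge (T * m) → ZMod 2 | IsSuggested c a ∧ B i c a} : ℝ) /
        (Finset.card {a : Edge (T * m) → ZMod 2 | IsSuggested c a} : ℝ) := by
    intro c
    rw [← Finset.sum_div]
    refine div_le_div_of_nonneg_right ?_ (Nat.cast_nonneg _)
    have h2 : ({a : Edge (T * m) → ZMod 2 | IsSuggested c a ∧ E (gridRestriction c a)} :
        Finset (Edge (T * m) → ZMod 2)) ⊆ Finset.univ.biUnion fun i =>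
          {a : Edge (T * m) → ZMod 2 | IsSuggested c a ∧ B i c a} := by
      intro a ha
      simp only [Finset.mem_filter, Finset.mem_univ, true_and, Finset.mem_biUnion] at ha ⊢
      obtain ⟨i, hi⟩ := hE c a ha.2
      exact ⟨i, ha.1, hi⟩
    exact_mod_cast (Finset.card_le_card h2).trans Finset.card_biUnion_le
  refine (Finset.sum_le_sum fun c _ => h1 c).trans ?_
  rw [Finset.sum_comm]
  refine (Finset.sum_le_card_nsmul _ _ _ fun i _ => hB i).trans (le_of_eq ?_)
  rw [nsmul_eq_mul, Finset.card_univ]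
  ring

lemma depth_ccdt_nil (ℓ : ℕ) : (ccdt (n := m) ℓ []).depth = 0 := by
  rw [ccdt]
  cases ([] : List (DNF m)).length + Fintype.card (Edge m) <;> simp [ccdtAux, DTree.depth]

/-- The union runs over `9` colours, `2` windows and `512` reference assignments, together `9216`,
and over the formulas of the rounds. -/
lemma gridProb_le_codes (hm : 3 ≤ m) (hodd : Odd m) (hT : 0 < numCenters T) {k ℓ s t : ℕ}
    (hk : 0 < k) (ht : 0 < t) (hℓ : 0 < ℓ) (hs : 0 < s) (hsize : 2 * (t + k) < m)
    (F : Fin s → DNF (T * m)) (hF : ∀ i, (F i).IsWidth k) :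
    gridProb T m (fun ρ => t ≤ (ccdt ℓ (List.ofFn fun i => (F i).subst ρ)).depth) ≤
      9216 * (s : ℝ) ^ ⌈(t : ℝ) / (ℓ : ℝ)⌉₊ *
        (Fintype.card (Coding.Codes k (Nat.log 2 (numCenters T)) (t + (t + 71) / 72)
          (Nat.log 2 (numCenters T) * ((t + 71) / 72))) /
            2 ^ ((Nat.log 2 (numCenters T) * ((t + 71) / 72) + 15) / 16)) := by
  classical
  set N := ⌈(t : ℝ) / (ℓ : ℝ)⌉₊ with hN
  set L := Nat.log 2 (numCenters T) with hLdef
  set r₀ := (t + 71) / 72 with hr₀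
  have hL : 2 ^ L ≤ numCenters T := Nat.pow_log_le_self 2 hT.ne'
  have hL' : numCenters T ≤ 2 * 2 ^ L := by
    rw [← pow_succ']; exact (Nat.lt_pow_succ_log_self one_lt_two _).le
  -- A round has `ℓ + 1` queries, so `⌈t / ℓ⌉` rounds are more than enough.
  have hround : ∀ u < t, u / (ℓ + 1) < N := by
    intro u hu
    rw [hN, Nat.lt_ceil, lt_div_iff₀ (Nat.cast_pos.2 hℓ)]
    have h1 : u / (ℓ + 1) * ℓ ≤ u / (ℓ + 1) * (ℓ + 1) := Nat.mul_le_mul_left _ (Nat.le_succ ℓ)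
    have h2 := Nat.div_mul_le_self u (ℓ + 1)
    exact_mod_cast (h1.trans h2).trans_lt hu
  let G : (Fin N → Fin s) → ℕ → DNF (T * m) := fun f r => if h : r < N then F (f ⟨r, h⟩) else []
  have hG : ∀ f r, (G f r).IsWidth k := by
    intro f r
    by_cases h : r < N
    · simp only [G, dif_pos h]; exact hF _
    · simp only [G, dif_neg h]; intro C hC; simp at hC
  have hmain := gridProb_le_of_exists (T := T) (m := m) hT
    (E := fun ρ => t ≤ (ccdt ℓ (List.ofFn fun i => (F i).subst ρ)).depth)
    (ι := ((Fin 3 × Fin 3) × Bool × (Fin 3 × Fin 3 → ZMod 2)) × (Fin N → Fin s))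
    (fun p c a => IsGaining {v | colour v = p.1.1} (refAssign {v | colour v = p.1.1} p.1.2.2) ℓ L
      (windowStart T L p.1.2.1) t r₀ ((L * r₀ + 15) / 16) (G p.2) c a)
    (ε := Fintype.card (Coding.Codes k L (t + r₀) (L * r₀)) / 2 ^ ((L * r₀ + 15) / 16)) ?_ ?_
  · refine hmain.trans (le_of_eq ?_)
    have h1 : Fintype.card ((Fin 3 × Fin 3) × Bool × (Fin 3 × Fin 3 → ZMod 2)) = 9216 := by simp
    rw [Fintype.card_prod, h1, Fintype.card_fun, Fintype.card_fin, Fintype.card_fin]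
    push_cast
    ring
  · intro c a hE
    obtain ⟨h, fi, hlen, htr⟩ := exists_isTrace_ccdt hm hodd
      (fun e P d he => (gridRestriction_eq_inr (c := c) (a := a) he).1) ℓ F hF ⟨0, hs⟩ t hsize hE
    obtain ⟨κ, b, φ, hg⟩ := exists_isGaining hm ht hlen htr hL hL' (G := G fun r => fi r) (by
      intro u hu
      simp only [G, dif_pos (hround u hu)])
    exact ⟨((κ, b, φ), fun r => fi r), hg⟩
  · intro p
    refine sum_isGaining_le hm (isIndepSet_colour hm _)
      (fun q hq => deg_refAssign hm (isIndepSet_colour hm _) _ hq) hk ?_ (hG _)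
    rw [windowStart]
    split_ifs <;> omega

/-- A query must come from a variable of a live term, and empty terms have none. -/
lemma gridProb_eq_zero_of_width_zero (hm : 3 ≤ m) (hodd : Odd m) {ℓ s t : ℕ} (ht : 0 < t)
    (hs : 0 < s) (hsize : 2 * t < m) (F : Fin s → DNF (T * m)) (hF : ∀ i, (F i).IsWidth 0) :
    gridProb T m (fun ρ => t ≤ (ccdt ℓ (List.ofFn fun i => (F i).subst ρ)).depth) = 0 := by
  refine gridProb_eq_zero fun c a hE => ?_
  obtain ⟨h, fi, hlen, htr⟩ := exists_isTrace_ccdt hm hodd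
    (fun e P d he => (gridRestriction_eq_inr (c := c) (a := a) he).1) ℓ F hF ⟨0, hs⟩ t
    (by simpa using hsize) hE
  obtain ⟨-, D, hD, e, b, d, hl, -⟩ := htr 0 _ (List.getElem?_eq_getElem (by omega))
  have h1 := hF _ D (List.mem_of_find?_eq_some hD)
  have h2 := List.length_pos_of_mem hl
  omega

/-! ### The numerical estimate -/

/-- Since `(64/63) ^ 32 ≤ 2`, the advice costs at most `L * r₀ / 32` bits beside the `36 * k * t`,
half of the `L * r₀ / 16` gained; and `2304 = 32 * 72`. -/
lemma codes_div_le {k L t r₀ : ℕ} (hr : r₀ ≤ t) (hr' : t ≤ 72 * r₀) :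
    (Fintype.card (Coding.Codes k L (t + r₀) (L * r₀)) : ℝ) / 2 ^ ((L * r₀ + 15) / 16) ≤
      (2 : ℝ) ^ ((36 * (k * t) : ℝ) - (L * t : ℝ) / 2304) := by
  have h1 : (64 / 63 : ℝ) ^ (L * r₀) ≤ (2 : ℝ) ^ ((L * r₀ : ℝ) / 32) := by
    have h2 : (64 / 63 : ℝ) ≤ (2 : ℝ) ^ (1 / 32 : ℝ) := by
      rw [one_div, Real.le_rpow_inv_iff_of_pos (by norm_num) (by norm_num) (by norm_num),
        show (32 : ℝ) = ((32 : ℕ) : ℝ) by norm_num, Real.rpow_natCast]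
      norm_num
    calc (64 / 63 : ℝ) ^ (L * r₀) ≤ ((2 : ℝ) ^ (1 / 32 : ℝ)) ^ (L * r₀) :=
          pow_le_pow_left₀ (by norm_num) h2 _
      _ = _ := by
          rw [← Real.rpow_natCast, ← Real.rpow_mul (by norm_num)]
          congr 1; push_cast; ring
  have h3 : (2 : ℝ) ^ ((L * r₀ : ℝ) / 16) ≤ 2 ^ ((L * r₀ + 15) / 16) := by
    rw [← Real.rpow_natCast]
    refine Real.rpow_le_rpow_of_exponent_le (by norm_num) ?_
    rw [div_le_iff₀ (by norm_num)]
    have : L * r₀ ≤ (L * r₀ + 15) / 16 * 16 := by omega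
    exact_mod_cast this
  have h4 : (2 : ℝ) ^ (18 * k * (t + r₀)) = (2 : ℝ) ^ (18 * k * (t + r₀) : ℝ) := by
    rw [← Real.rpow_natCast]; push_cast; rfl
  rw [div_le_iff₀ (by positivity)]
  calc (Fintype.card (Coding.Codes k L (t + r₀) (L * r₀)) : ℝ)
      ≤ (64 / 63) ^ (L * r₀) * 2 ^ (18 * k * (t + r₀)) := Coding.card_codes_le _ _ _ _
    _ ≤ (2 : ℝ) ^ ((L * r₀ : ℝ) / 32) * (2 : ℝ) ^ (18 * k * (t + r₀) : ℝ) := by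
        rw [h4]; exact mul_le_mul_of_nonneg_right h1 (by positivity)
    _ ≤ (2 : ℝ) ^ ((36 * (k * t) : ℝ) - (L * t : ℝ) / 2304) * (2 : ℝ) ^ ((L * r₀ : ℝ) / 16) := by
        rw [← Real.rpow_add (by norm_num), ← Real.rpow_add (by norm_num)]
        refine Real.rpow_le_rpow_of_exponent_le (by norm_num) ?_
        have e1 : (k * r₀ : ℝ) ≤ k * t := by exact_mod_cast Nat.mul_le_mul_left k hr
        have e2 : (L * t : ℝ) ≤ L * (72 * r₀) := by exact_mod_cast Nat.mul_le_mul_left L hr'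
        linarith
    _ ≤ _ := mul_le_mul_of_nonneg_left h3 (by positivity)

/-- Here `117504 = 2304 * 51`. Of the 51, 36 pay for the advice, 14 for `9216 ≤ 2 ^ 14`, and one for
rounding `log₂ Δ` down; this uses `k, t ≥ 1`. -/
lemma codes_bound_le {k Δ t : ℕ} (hk : 0 < k) (ht : 0 < t) (hΔ : 0 < Δ) :
    9216 * (2 : ℝ) ^ ((36 * (k * t) : ℝ) - (Nat.log 2 Δ * t : ℝ) / 2304) ≤
      ((2 : ℝ) ^ ((117504 : ℝ) * k) / Δ) ^ ((1 / 2304 : ℝ) * t) := by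
  have h1 : (Δ : ℝ) ≤ (2 : ℝ) ^ ((Nat.log 2 Δ : ℝ) + 1) := by
    have := (Nat.lt_pow_succ_log_self one_lt_two Δ).le
    have h2 : (Δ : ℝ) ≤ (2 : ℝ) ^ (Nat.log 2 Δ + 1) := by exact_mod_cast this
    rwa [← Real.rpow_natCast, Nat.cast_add, Nat.cast_one] at h2
  have h2 : (2 : ℝ) ^ ((117504 : ℝ) * k - ((Nat.log 2 Δ : ℝ) + 1)) ≤
      (2 : ℝ) ^ ((117504 : ℝ) * k) / Δ := by
    rw [Real.rpow_sub (by norm_num)]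
    exact div_le_div_of_nonneg_left (by positivity) (Nat.cast_pos.2 hΔ) h1
  have h3 : (9216 : ℝ) ≤ (2 : ℝ) ^ (14 : ℝ) := by
    rw [show (14 : ℝ) = ((14 : ℕ) : ℝ) by norm_num, Real.rpow_natCast]; norm_num
  calc 9216 * (2 : ℝ) ^ ((36 * (k * t) : ℝ) - (Nat.log 2 Δ * t : ℝ) / 2304)
      ≤ (2 : ℝ) ^ (14 : ℝ) * (2 : ℝ) ^ ((36 * (k * t) : ℝ) - (Nat.log 2 Δ * t : ℝ) / 2304) :=
        mul_le_mul_of_nonneg_right h3 (by positivity)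
    _ ≤ ((2 : ℝ) ^ ((117504 : ℝ) * k - ((Nat.log 2 Δ : ℝ) + 1))) ^ ((1 / 2304 : ℝ) * t) := by
        rw [← Real.rpow_add (by norm_num), ← Real.rpow_mul (by norm_num)]
        refine Real.rpow_le_rpow_of_exponent_le (by norm_num) ?_
        have e1 : (1 : ℝ) ≤ k := by exact_mod_cast hk
        have e2 : (1 : ℝ) ≤ t := by exact_mod_cast ht
        have e3 : (t : ℝ) ≤ k * t := by nlinarith
        linarith
    _ ≤ _ := Real.rpow_le_rpow (by positivity) h2 (by positivity)

end Final

end GridSwitching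

theorem mainTheorem2 :
    ∃ C c : ℝ, 0 < C ∧ 0 < c ∧
      ∀ (T m : ℕ) [NeZero T] [NeZero m], Odd T → Odd m → 0 < GridSwitching.numCenters T →
      ∀ k ℓ s t : ℕ, 1 ≤ ℓ → 8 * (k + t) ≤ m →
      ∀ F : Fin s → GridSwitching.DNF (T * m), (∀ i, (F i).IsWidth k) →
        GridSwitching.gridProb T m (fun ρ =>
            t ≤ (GridSwitching.ccdt ℓ (List.ofFn fun i => (F i).subst ρ)).depth) ≤
          (s : ℝ) ^ ⌈(t : ℝ) / (ℓ : ℝ)⌉₊ *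
            ((2 : ℝ) ^ (C * k) / (GridSwitching.numCenters T : ℝ)) ^ (c * t) := by
  refine ⟨117504, 1 / 2304, by norm_num, by norm_num, ?_⟩
  intro T m _ _ _ hodd hT k ℓ s t hℓ hsize F hF
  -- The encoding needs a query, a formula and a literal position, so `t = 0`, `s = 0` and `k = 0`
  -- are treated apart.
  rcases Nat.eq_zero_or_pos t with rfl | ht
  · simpa using GridSwitching.gridProb_le_one _
  rcases Nat.eq_zero_or_pos s with rfl | hs
  · rw [GridSwitching.gridProb_eq_zero]
    · positivity
    · intro c a h
      rw [List.ofFn_zero, GridSwitching.depth_ccdt_nil] at h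
      omega
  rcases Nat.eq_zero_or_pos k with rfl | hk
  · rw [GridSwitching.gridProb_eq_zero_of_width_zero (by omega) hodd ht hs (by omega) F hF]
    positivity
  refine (GridSwitching.gridProb_le_codes (by omega) hodd hT hk ht hℓ hs (by omega) F hF).trans ?_
  rw [mul_comm 9216, mul_assoc]
  refine mul_le_mul_of_nonneg_left ?_ (by positivity)
  refine le_trans ?_ (GridSwitching.codes_bound_le hk ht hT)
  exact mul_le_mul_of_nonneg_left (GridSwitching.codes_div_le (by omega) (by omega)) (by norm_num)
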